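/- **Conventions.** $I_\nu(z)=\sum_{k\ge 0}\frac{(z/2)^{2k+\nu}}{\Gamma(\nu+k+1)\,k!}$ is the modified Bessel function of the first kind of real order $\nu$ (with $1/\Gamma=0$ at the poles of $\Gamma$), and, for real $M$, $$Q_M(\alpha,\beta)=\frac1{\alpha^{M-1}}\int_\beta^\infty x^M e^{-(\alpha^2+x^2)/2}I_{M-1}(\alpha x)\,dx$$ is the generalized Marcum $Q$ function. It is extended to real or purely imaginary $\alpha$ (including $\alpha=0$) by using that $\alpha^{1-M}x^{1-M}I_{M-1}(\alpha x)$ is an even entire function of $\alpha x$ and to real or purely imaginary $\beta$ by integrating along the horizontal ray from $\sqrt{\beta^2}$ (which is $|\beta|$ or $i|\beta|$) to $+\infty$. Powers with non-integer exponents are principal values, except where another branch is specified. Also $(x)_m=x(x+1)\cdots(x+m-1)$, ${}_0F_1(;q;z)=\sum_{k\ge0}\frac{z^k}{(q)_k k!}$, and for a positive integer $b$ $$\delta_j(b,g,w,z)=\frac{(-1)^{b-1}z^{b-1-j}}{w^{b-1}\Gamma(b)}\sum_{k=0}^{\lfloor j/2\rfloor}\frac{(-1)^k(b-j+k)_{j-k}\,(g-j-1+k)_{j-2k}}{(j-2k)!\,k!}z^k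 .$$ **Proposition 1.** Let $c\in\mathbb R$, $p>0$, let each of $\alpha,\beta$ be real or purely imaginary, and suppose $\tilde p:=2p+\alpha^2>0$. For real $\mu_1,\mu_2$ put $$\mathrm{In}(\alpha,\beta,c,p,\mu_1,\mu_2)=\int_0^\infty e^{-pt}\,Q_{\mu_1}(\alpha\sqrt t,\beta)\,t^{(\mu_2-1)/2}I_{\mu_2-1}(c\sqrt t)\,dt .$$ In each of the following cases the integrals $\mathrm{In}$ that occur converge absolutely, and: 1. If $\mu_1=\mu_2=\mu$, where $\mu>0$ or $\mu\in\{0,-1,-2,\dots\}$, and $c\ne0$ or $\mu\ge1$, then $$\mathrm{In}(\alpha,\beta,c,p,\mu,\mu)=\frac1p\Big(\frac c{2p}\Big)^{\mu-1}e^{c^2/(4p)}\,Q_\mu\Big(\frac{\alpha c}{\sqrt{2p\,\tilde p}},\ \beta\sqrt{\frac{2p}{\tilde p}}\Big).$$ 2. If $\mu_2>0$, $\mu_1=\mu_2+n$ with an integer $n\ge1$, and $\alpha,\beta,c\neq0$, then $$\mathrm{In}(\alpha,\beta,c,p,\mu_2+n,\mu_2)=\mathrm{In}(\alpha,\beta,c,p,\mu_2,\mu_2)+\frac2c\Big(-\frac{\alpha^2}c\Big)^{-\mu_2}e^{-\beta^2/2}\sum_{k=0}^{n-1}\sum_{j=0}^{2k}\Big(\frac{\beta^2}2\Big)^j\Big(\frac{-\alpha^2}{\tilde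 p}\Big)^{-k+j}$$ $$\times\ \delta_j\Big(k+1,\mu_2+k+1,-\frac{\alpha^2\beta^2}{2\tilde p},\frac{\alpha^2\beta^2c^2}{4\tilde p^2}\Big)\Big[1-Q_{\mu_2+k-j}\Big(\frac{ic}{\sqrt{\tilde p}},\frac{i\alpha\beta}{\sqrt{\tilde p}}\Big)\Big],$$ where $(-\alpha^2/c)^{-\mu_2}$ is taken on the branch with $(-\alpha^2/c)^{-\mu_2}\,(-\alpha^2\beta^2/\tilde p)^{\mu_2}=(c/\tilde p)^{\mu_2}(\beta^2)^{\mu_2}$, the other three powers being principal values (this is the principal value when $\alpha,\beta$ are real). 3. If $\mu_2>0$, $\mu_1=\mu_2+n$ with an integer $n\ge1$, and $c\ne0$ or $\mu_2\ge1$, then also $$\mathrm{In}(\alpha,\beta,c,p,\mu_2+n,\mu_2)=\mathrm{In}(\alpha,\beta,c,p,\mu_2,\mu_2)+\frac2{\tilde p}\,(\beta^2)^{\mu_2-1}\Big(\frac{c}{2\tilde p}\Big)^{\mu_2-1}\frac{e^{-\beta^2/2+c^2/(2\tilde p)}}{\Gamma(\mu_2)}$$ $$\times\sum_{j=1}^n\frac{(\beta^2/2)^j}{(j-1)!}\int_0^1t^{\mu_2-1}(1-t)^{j-1}\exp\Big(\frac{\alpha^2\beta^2}{2\tilde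 p}t\Big)\,{}_0F_1\Big(;\mu_2;\frac{\alpha^2\beta^2c^2}{4\tilde p^2}t\Big)dt,$$ where the integrals over $[0,1]$ converge absolutely (for $\beta=0$ the second summand on the right is read as $0$). 4. If $\mu_2=\mu_1+n$ with $\mu_1$ real and an integer $n\ge1$, where $\mu_2>0$ or $\mu_2\in\{0,-1,-2,\dots\}$, and $\alpha\ne0$, $c\neq0$, and $\beta\ne0$ or $\mu_1\ge0$, then $$\mathrm{In}(\alpha,\beta,c,p,\mu_1,\mu_1+n)=\mathrm{In}(\alpha,\beta,c,p,\mu_1+n,\mu_1+n)-\frac2c\Big(\frac c{\tilde p}\Big)^n\Big(\frac\beta\alpha\Big)^{\mu_1}\exp\Big(\frac{c^2/2-p\beta^2}{\tilde p}\Big)$$ $$\times\sum_{k=0}^{n-1}\sum_{j=0}^{n-k-1}\Big(\frac\beta c\Big)^{j+k}\Big(\frac{\tilde p}\alpha\Big)^k(-\alpha)^j\,\frac{(-n+k+1)_j}{j!}\,I_{\mu_1+k+j}\Big(\frac{c\alpha\beta}{\tilde p}\Big),$$ where, for $\beta\neq0$, $(\beta/\alpha)^{\mu_1}$ is taken on the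 branch with $(\beta/\alpha)^{\mu_1}(c\alpha\beta/\tilde p)^{\mu_1}=(c/\tilde p)^{\mu_1}(\beta^2)^{\mu_1}$, the other three powers being principal values (this is the principal value when $\alpha,\beta>0$); for $\beta=0$ it is $1$ if $\mu_1=0$ and $0$ if $\mu_1>0$. -/

import Mathlib

open MeasureTheory Set

noncomputable section

namespace MarcumLaplace

/-- The entire even function `z ↦ (z/2)^(-ν) I_ν(z) = ∑ (z/2)^(2k) / (Γ(ν+k+1) k!)`.
At a pole of `Γ` the term is `0`, since `Complex.Gamma` is `0` there and `x / 0 = 0`; this is the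
usual convention `1/Γ = 0`. -/
def besselE (ν : ℝ) (z : ℂ) : ℂ :=
  ∑' k : ℕ, (z / 2) ^ (2 * k) / (Complex.Gamma ((ν : ℂ) + k + 1) * (k.factorial : ℂ))

/-- Modified Bessel function of the first kind of real order `ν`,
`I_ν(z) = ∑ (z/2)^(2k+ν) / (Γ(ν+k+1) k!)` (principal value of the power). -/
def besselI (ν : ℝ) (z : ℂ) : ℂ :=
  (z / 2) ^ (ν : ℂ) * besselE ν z

/-- Generalized Marcum Q function of real order `M`,
`Q_M(α,β) = α^(1-M) ∫_β^∞ x^M exp(-(α²+x²)/2) I_{M-1}(αx) dx`.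
The factor `α^(1-M) I_{M-1}(αx)` is written as `(x/2)^(M-1) besselE (M-1) (αx)`, which is entire in
`α` (so that `α = 0` and purely imaginary `α` are included).  The path of integration is the
horizontal ray from `√(β²)` (the root in the closed right half plane, i.e. `|β|` for real `β` and
`i|β|` for purely imaginary `β`) to `+∞`; `Q_M` is thus even in `β`. -/
def marcumQ (M : ℝ) (α β : ℂ) : ℂ :=
  ∫ s in Ioi (0 : ℝ),
    (fun x : ℂ => x ^ (M : ℂ) * Complex.exp (-(α ^ 2 + x ^ 2) / 2) *
        ((x / 2) ^ ((M : ℂ) - 1) * besselE (M - 1) (α * x)))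
      ((β ^ 2) ^ (1 / 2 : ℂ) + (s : ℂ))

/-- Integrand of the Laplace transform
`exp(-pt) Q_{μ₁}(α√t, β) t^((μ₂-1)/2) I_{μ₂-1}(c√t)`. -/
def integrand (α β : ℂ) (c p μ₁ μ₂ : ℝ) (t : ℝ) : ℂ :=
  Complex.exp (-(p : ℂ) * t) * marcumQ μ₁ (α * (Real.sqrt t : ℂ)) β *
    (t : ℂ) ^ (((μ₂ : ℂ) - 1) / 2) * besselI (μ₂ - 1) ((c : ℂ) * (Real.sqrt t : ℂ))

/-- `In(α,β,c,p,μ₁,μ₂)`. -/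
def laplaceIn (α β : ℂ) (c p μ₁ μ₂ : ℝ) : ℂ :=
  ∫ t in Ioi (0 : ℝ), integrand α β c p μ₁ μ₂ t

/-- The integral `In(α,β,c,p,μ₁,μ₂)` converges absolutely. -/
def InConverges (α β : ℂ) (c p μ₁ μ₂ : ℝ) : Prop :=
  IntegrableOn (integrand α β c p μ₁ μ₂) (Ioi (0 : ℝ))

/-- `p̃ = 2p + α²`, a real number since `α` is real or purely imaginary. -/
def pTilde (p : ℝ) (α : ℂ) : ℝ := 2 * p + (α ^ 2).re

/-- Pochhammer symbol `(x)_m = x (x+1) ⋯ (x+m-1)`. -/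
def poch (x : ℂ) (m : ℕ) : ℂ := (ascPochhammer ℂ m).eval x

/-- `₀F₁(;q;z) = ∑ z^k / ((q)_k k!)`. -/
def hyp0F1 (q z : ℂ) : ℂ :=
  ∑' k : ℕ, z ^ k / (poch q k * (k.factorial : ℂ))

/-- The coefficients `δ_j(b,g,w,z)`, for a positive integer `b`. -/
def deltaCoeff (j b : ℕ) (g : ℝ) (w z : ℂ) : ℂ :=
  (-1) ^ (b - 1) * z ^ ((b : ℤ) - 1 - (j : ℤ)) / (w ^ (b - 1) * Complex.Gamma (b : ℂ)) *
    ∑ k ∈ Finset.range (j / 2 + 1),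
      (-1) ^ k * poch ((b : ℂ) - j + k) (j - k) * poch ((g : ℂ) - j - 1 + k) (j - 2 * k) /
        (((j - 2 * k).factorial : ℂ) * (k.factorial : ℂ)) * z ^ k

/-- The power `(-α²/c)^(-μ)`, on the branch for which
`(-α²/c)^(-μ) * (-α²β²/P)^μ = (c/P)^μ * (β²)^μ` with principal values of the other three powers. -/
def negSqDivPow (α β : ℂ) (c P μ : ℝ) : ℂ :=
  ((c / P : ℝ) : ℂ) ^ (μ : ℂ) * (β ^ 2) ^ (μ : ℂ) / (-(α ^ 2 * β ^ 2) / (P : ℂ)) ^ (μ : ℂ)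

/-- The power `(β/α)^μ`, on the branch for which
`(β/α)^μ * (cαβ/P)^μ = (c/P)^μ * (β²)^μ` with principal values of the other three powers. -/
def divPow (α β : ℂ) (c P μ : ℝ) : ℂ :=
  ((c / P : ℝ) : ℂ) ^ (μ : ℂ) * (β ^ 2) ^ (μ : ℂ) / ((c : ℂ) * (α * β / (P : ℂ))) ^ (μ : ℂ)

/-- For `α > 0` and `β ≥ 0`, `marcumQ` is given by its usual defining formula. -/
theorem marcumQ_eq (M a b : ℝ) (ha : 0 < a) (hb : 0 ≤ b) :
    marcumQ M a b = 1 / (a : ℂ) ^ ((M : ℂ) - 1) *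
      ∫ x in Ioi b, (x : ℂ) ^ (M : ℂ) * Complex.exp (-((a : ℂ) ^ 2 + (x : ℂ) ^ 2) / 2) *
        besselI (M - 1) ((a : ℂ) * x) := by
  have hsq : ((b : ℂ) ^ 2) ^ (1 / 2 : ℂ) = (b : ℂ) := by
    have h := Complex.pow_cpow_nat_inv (x := (b : ℂ)) (n := 2) two_ne_zero
      (by rw [Complex.arg_ofReal_of_nonneg hb]; have := Real.pi_pos; simp; linarith)
      (by rw [Complex.arg_ofReal_of_nonneg hb]; have := Real.pi_pos; positivity)
    rw [show (1 / 2 : ℂ) = ((2 : ℕ) : ℂ)⁻¹ by norm_num]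
    exact h
  have hshift : ∀ f : ℝ → ℂ, ∫ s in Ioi (0 : ℝ), f (b + s) = ∫ x in Ioi b, f x := by
    intro f
    have h := (measurePreserving_add_left volume b).setIntegral_preimage_emb
      (measurableEmbedding_addLeft b) f (Ioi b)
    rw [← h]
    congr 2
    simp
  rw [marcumQ, ← integral_const_mul, hsq]
  have := hshift (fun x : ℝ => (x : ℂ) ^ (M : ℂ) *
    Complex.exp (-((a : ℂ) ^ 2 + (x : ℂ) ^ 2) / 2) *
      (((x : ℂ) / 2) ^ ((M : ℂ) - 1) * besselE (M - 1) ((a : ℂ) * x)))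
  simp only [Complex.ofReal_add] at this
  simp only [this]
  refine setIntegral_congr_fun measurableSet_Ioi (fun x hx => ?_)
  have hx0 : 0 ≤ x := hb.trans (le_of_lt hx)
  have ha0 : (a : ℂ) ^ ((M : ℂ) - 1) ≠ 0 := by
    rw [Ne, Complex.cpow_eq_zero_iff]
    exact fun h => ha.ne' (by exact_mod_cast h.1)
  have hmul : ((a : ℂ) * x / 2) ^ ((M : ℂ) - 1)
      = (a : ℂ) ^ ((M : ℂ) - 1) * ((x : ℂ) / 2) ^ ((M : ℂ) - 1) := by
    have := Complex.mul_cpow_ofReal_nonneg (a := a) (b := x / 2) ha.le (by positivity)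
      ((M : ℂ) - 1)
    push_cast at this
    rw [← this, mul_div_assoc]
  simp only [besselI]
  push_cast
  rw [hmul]
  field_simp

/-- `negSqDivPow` is a value of the multivalued power `(-α²/c)^(-μ)`, the logarithm of `-α²/c` not
depending on `μ`. -/
theorem negSqDivPow_branch (α β : ℂ) (c P : ℝ) (hα : α ≠ 0) (hβ : β ≠ 0) (hc : c ≠ 0)
    (hP : 0 < P) :
    ∃ L : ℂ, Complex.exp L = -α ^ 2 / c ∧
      ∀ μ : ℝ, negSqDivPow α β c P μ = Complex.exp (-(μ : ℂ) * L) := by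
  have hP' : (P : ℂ) ≠ 0 := by exact_mod_cast hP.ne'
  have hc' : (c : ℂ) ≠ 0 := by exact_mod_cast hc
  have h1 : ((c / P : ℝ) : ℂ) ≠ 0 := by exact_mod_cast (div_ne_zero hc hP.ne')
  have h2 : β ^ 2 ≠ 0 := pow_ne_zero 2 hβ
  have h3 : -(α ^ 2 * β ^ 2) / (P : ℂ) ≠ 0 :=
    div_ne_zero (neg_ne_zero.2 (mul_ne_zero (pow_ne_zero 2 hα) h2)) hP'
  refine ⟨Complex.log (-(α ^ 2 * β ^ 2) / (P : ℂ)) - Complex.log ((c / P : ℝ) : ℂ)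
    - Complex.log (β ^ 2), ?_, fun μ => ?_⟩
  · rw [Complex.exp_sub, Complex.exp_sub, Complex.exp_log h1, Complex.exp_log h2,
      Complex.exp_log h3]
    push_cast
    field_simp
  · rw [negSqDivPow, Complex.cpow_def_of_ne_zero h1, Complex.cpow_def_of_ne_zero h2,
      Complex.cpow_def_of_ne_zero h3, ← Complex.exp_add, ← Complex.exp_sub]
    congr 1
    ring

/-- For real `α`, `β` it is the principal value. -/
theorem negSqDivPow_real (a b c P μ : ℝ) (ha : a ≠ 0) (hb : b ≠ 0) (hc : c ≠ 0) (hP : 0 < P) :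
    negSqDivPow a b c P μ = (-(a : ℂ) ^ 2 / c) ^ (-(μ : ℂ)) := by
  have hP' : (P : ℂ) ≠ 0 := by exact_mod_cast hP.ne'
  have hc' : (c : ℂ) ≠ 0 := by exact_mod_cast hc
  have ha' : (a : ℂ) ≠ 0 := by exact_mod_cast ha
  have hb' : (b : ℂ) ≠ 0 := by exact_mod_cast hb
  have h1 : ((c / P : ℝ) : ℂ) ≠ 0 := by exact_mod_cast (div_ne_zero hc hP.ne')
  have h2 : (b : ℂ) ^ 2 ≠ 0 := pow_ne_zero 2 hb'
  have h3 : -((a : ℂ) ^ 2 * (b : ℂ) ^ 2) / (P : ℂ) ≠ 0 :=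
    div_ne_zero (neg_ne_zero.2 (mul_ne_zero (pow_ne_zero 2 ha') h2)) hP'
  have h4 : -(a : ℂ) ^ 2 / (c : ℂ) ≠ 0 := div_ne_zero (neg_ne_zero.2 (pow_ne_zero 2 ha')) hc'
  have hQ : 0 < a ^ 2 * b ^ 2 / P := by positivity
  have e3 : Complex.log (-((a : ℂ) ^ 2 * (b : ℂ) ^ 2) / (P : ℂ))
      = (Real.log (a ^ 2 * b ^ 2 / P) : ℂ) + Complex.log (-1) := by
    rw [← Complex.log_ofReal_mul hQ (by norm_num)]
    congr 1
    push_cast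
    ring
  have e2 : Complex.log ((b : ℂ) ^ 2) = (Real.log (b ^ 2) : ℂ) := by
    rw [Complex.ofReal_log (by positivity)]
    push_cast
    rfl
  have e1 : Complex.log ((c / P : ℝ) : ℂ) = (Real.log (1 / P) : ℂ) + Complex.log (c : ℂ) := by
    rw [← Complex.log_ofReal_mul (by positivity) hc']
    congr 1
    push_cast
    ring
  have e4 : Complex.log (-(a : ℂ) ^ 2 / (c : ℂ))
      = (Real.log (a ^ 2) : ℂ) + Complex.log (-1) - Complex.log (c : ℂ) := by
    rcases lt_or_gt_of_ne hc with h | h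
    · have hk : 0 < a ^ 2 / (-c) := div_pos (by positivity) (by linarith)
      have : -(a : ℂ) ^ 2 / (c : ℂ) = ((a ^ 2 / (-c) : ℝ) : ℂ) := by
        push_cast
        field_simp
      rw [this, ← Complex.ofReal_log hk.le, Real.log_div (by positivity) (by linarith)]
      have hcc : (c : ℂ) = ((-c : ℝ) : ℂ) * (-1) := by push_cast; ring
      rw [hcc, Complex.log_ofReal_mul (by linarith) (by norm_num)]
      push_cast
      ring
    · have hk : 0 < a ^ 2 / c := div_pos (by positivity) h
      have : -(a : ℂ) ^ 2 / (c : ℂ) = ((a ^ 2 / c : ℝ) : ℂ) * (-1) := by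
        push_cast
        ring
      rw [this, Complex.log_ofReal_mul hk (by norm_num), Real.log_div (by positivity) h.ne',
        ← Complex.ofReal_log h.le]
      push_cast
      ring
  rw [negSqDivPow, Complex.cpow_def_of_ne_zero h1, Complex.cpow_def_of_ne_zero h2,
    Complex.cpow_def_of_ne_zero h3, Complex.cpow_def_of_ne_zero h4, ← Complex.exp_add,
    ← Complex.exp_sub, e1, e2, e3, e4, Real.log_div one_ne_zero hP.ne',
    Real.log_div (by positivity) hP.ne', Real.log_mul (by positivity) (by positivity), Real.log_one]
  congr 1
  push_cast
  ring

/-- `divPow` is a value of the multivalued power `(β/α)^μ`, the logarithm of `β/α` not depending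
on `μ`. -/
theorem divPow_branch (α β : ℂ) (c P : ℝ) (hα : α ≠ 0) (hβ : β ≠ 0) (hc : c ≠ 0) (hP : 0 < P) :
    ∃ L : ℂ, Complex.exp L = β / α ∧ ∀ μ : ℝ, divPow α β c P μ = Complex.exp ((μ : ℂ) * L) := by
  have hP' : (P : ℂ) ≠ 0 := by exact_mod_cast hP.ne'
  have hc' : (c : ℂ) ≠ 0 := by exact_mod_cast hc
  have h1 : ((c / P : ℝ) : ℂ) ≠ 0 := by exact_mod_cast (div_ne_zero hc hP.ne')
  have h2 : β ^ 2 ≠ 0 := pow_ne_zero 2 hβ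
  have h3 : (c : ℂ) * (α * β / (P : ℂ)) ≠ 0 :=
    mul_ne_zero hc' (div_ne_zero (mul_ne_zero hα hβ) hP')
  refine ⟨Complex.log ((c / P : ℝ) : ℂ) + Complex.log (β ^ 2)
    - Complex.log ((c : ℂ) * (α * β / (P : ℂ))), ?_, fun μ => ?_⟩
  · rw [Complex.exp_sub, Complex.exp_add, Complex.exp_log h1, Complex.exp_log h2,
      Complex.exp_log h3]
    push_cast
    field_simp
  · rw [divPow, Complex.cpow_def_of_ne_zero h1, Complex.cpow_def_of_ne_zero h2,
      Complex.cpow_def_of_ne_zero h3, ← Complex.exp_add, ← Complex.exp_sub]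
    congr 1
    ring

/-- For `α, β > 0` it is the principal value. -/
theorem divPow_real (a b c P μ : ℝ) (ha : 0 < a) (hb : 0 < b) (hc : c ≠ 0) (hP : 0 < P) :
    divPow a b c P μ = ((b : ℂ) / a) ^ (μ : ℂ) := by
  have hP' : (P : ℂ) ≠ 0 := by exact_mod_cast hP.ne'
  have hc' : (c : ℂ) ≠ 0 := by exact_mod_cast hc
  have ha' : (a : ℂ) ≠ 0 := by exact_mod_cast ha.ne'
  have hb' : (b : ℂ) ≠ 0 := by exact_mod_cast hb.ne'
  have h1 : ((c / P : ℝ) : ℂ) ≠ 0 := by exact_mod_cast (div_ne_zero hc hP.ne')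
  have h2 : (b : ℂ) ^ 2 ≠ 0 := pow_ne_zero 2 hb'
  have h3 : (c : ℂ) * ((a : ℂ) * b / (P : ℂ)) ≠ 0 :=
    mul_ne_zero hc' (div_ne_zero (mul_ne_zero ha' hb') hP')
  have h4 : (b : ℂ) / a ≠ 0 := div_ne_zero hb' ha'
  have hQ : 0 < a * b / P := by positivity
  have e3 : Complex.log ((c : ℂ) * ((a : ℂ) * b / (P : ℂ)))
      = (Real.log (a * b / P) : ℂ) + Complex.log (c : ℂ) := by
    rw [← Complex.log_ofReal_mul hQ hc']
    congr 1
    push_cast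
    ring
  have e2 : Complex.log ((b : ℂ) ^ 2) = (Real.log (b ^ 2) : ℂ) := by
    rw [Complex.ofReal_log (by positivity)]
    push_cast
    rfl
  have e1 : Complex.log ((c / P : ℝ) : ℂ) = (Real.log (1 / P) : ℂ) + Complex.log (c : ℂ) := by
    rw [← Complex.log_ofReal_mul (by positivity) hc']
    congr 1
    push_cast
    ring
  have e4 : Complex.log ((b : ℂ) / a) = (Real.log (b / a) : ℂ) := by
    rw [Complex.ofReal_log (by positivity)]
    push_cast
    rfl
  rw [divPow, Complex.cpow_def_of_ne_zero h1, Complex.cpow_def_of_ne_zero h2,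
    Complex.cpow_def_of_ne_zero h3, Complex.cpow_def_of_ne_zero h4, ← Complex.exp_add,
    ← Complex.exp_sub, e1, e2, e3, e4, Real.log_div one_ne_zero hP.ne',
    Real.log_div (by positivity) hP.ne', Real.log_mul ha.ne' hb.ne', Real.log_one,
    Real.log_div hb.ne' ha.ne', Real.log_pow]
  congr 1
  push_cast
  ring

end MarcumLaplace

end

/-!
The factor `(z/2)^(-ν) I_ν(z)` is `F_ν(z²/4)` for the Bessel–Clifford function `cliffordF`
`F_ν(w) = ∑ w^k / (Γ(ν+k+1) k!)`, an entire function with `F_ν' = F_{ν+1}` and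
`F_{ν-1} = ν F_ν + w F_{ν+1}`. Put `a = α²/2` (real), `b = β²/2`, `C = c²/4` and `s = p + a`, which
is half of `p̃`. Everything is expressed through `F`, so that the only multivalued powers left are
`b^M` and `(c/2)^(μ-1)`.

**The Marcum function.** With `u = x²/2` the defining integral is
`e^{-a} ∫ u^(M-1) e^{-u} F_{M-1}(au)` over the image of a horizontal ray. For `M > 0` the ray is
deformed into the segment `[0,b]` and the positive axis, which gives (`marcumQ_of_pos`)
`Q_M = 1 - e^{-a} b^M ∫_0^1 τ^(M-1) e^{-bτ} F_{M-1}(abτ) dτ`. There is a similar formula for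
`M = -m` (`marcumQ_neg_natCast`), and an antiderivative along the ray gives
`Q_{M+1} - Q_M = e^{-a-b} b^M F_M(ab)` for all real `M` if `b ≠ 0`, and for `M ≥ 0` if `b = 0`
(`marcumQ_add_one_sub`).

**Equal orders.** After Fubini, the Laplace transform of the average over `τ` is Weber's second
exponential integral (`integral_weber`)
`∫ e^{-st} t^N F_N(Ct) F_N(xt) dt = s^{-N-1} e^{(C+x)/s} F_N(xC/s²)`, and the result is again of
the form of `marcumQ_of_pos`. For `μ = -m` one of the two averages needs in addition a Möbius
substitution of `[0,1]`.

**Orders differing by an integer.** By the recurrence in `M`, each unit of difference adds an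
integral `∫ e^{-st} t^(μ-1) F_{μ-1}(Ct) F_ν(abt) dt` (`laplaceIn_add_natCast`). If `ν` is below
`μ - 1` by an integer, Weber's integral with one order lowered (`integral_weber_sub`) evaluates it
as a finite sum of Bessel functions. If `ν = μ + k`, Sonine's integral
`k! F_{μ+k}(x) = ∫_0^1 τ^(μ-1) (1-τ)^k F_{μ-1}(xτ) dτ` and Fubini turn it into an integral over
`[0,1]` (`integral_weber_add`), which is the finite-range form of the result.

**Reduction to Marcum functions.** For `k = 0` that integral over `[0,1]` is, up to a power of
`b'`, `Y(μ) = e^{a'} (1 - Q_μ)` at modified parameters `a'`, `b'`. Raising `k` by one amounts to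
the operator `(S f)(μ) = μ f(μ+1) + a' f(μ+2) - b' f(μ)`. The recurrence of `Q` shows `S Y = T Y`
for the operator `(T f)(μ) = a' f(μ+1) + μ f(μ) - b' f(μ-1)`, and `S (T + k) = (T + k + 1) S`, so
that `S^k Y = (T + k - 1) ⋯ (T + 1) T Y` (`contigSeq_succ_eq`). The coefficients of the right hand
side have a closed form (`contigSeq_eq_sum`), which is that of the `δ_j`.
-/

namespace MarcumLaplace

open Filter Topology

/-! ### The Bessel–Clifford function -/

/-- The Bessel–Clifford function `F_ν(w) = ∑ w^k / (Γ(ν+k+1) k!)` (with `1/Γ = 0` at the poles),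
an entire function of `w` for every real `ν`.  It is related to the modified Bessel function by
`(z/2)^(-ν) I_ν(z) = F_ν(z²/4)`. -/
noncomputable def cliffordF (ν : ℝ) (w : ℂ) : ℂ :=
  ∑' k : ℕ, (Complex.Gamma ((ν : ℂ) + k + 1))⁻¹ * (w ^ k / (k.factorial : ℂ))

theorem besselE_eq_cliffordF (ν : ℝ) (z : ℂ) : besselE ν z = cliffordF ν (z ^ 2 / 4) := by
  unfold besselE cliffordF
  refine tsum_congr fun k => ?_
  rw [pow_mul, show (z / 2) ^ 2 = z ^ 2 / 4 by ring]
  rw [div_eq_mul_inv, div_eq_mul_inv, mul_inv]; ring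

/-- The reciprocal Gamma coefficients decay faster than any geometric sequence. -/
theorem exists_norm_inv_Gamma_le (ν : ℝ) {ε : ℝ} (hε : 0 < ε) :
    ∃ K : ℝ, 0 < K ∧ ∀ k : ℕ, ‖(Complex.Gamma ((ν : ℂ) + k + 1))⁻¹‖ ≤ K * ε ^ k := by
  set c : ℕ → ℝ := fun k => ‖(Complex.Gamma ((ν : ℂ) + k + 1))⁻¹‖ with hc
  have hrec : ∀ k : ℕ, c k = |ν + k + 1| * c (k + 1) := by
    intro k
    simp only [hc]
    rw [Complex.one_div_Gamma_eq_self_mul_one_div_Gamma_add_one, norm_mul]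
    congr 2
    · rw [← Real.norm_eq_abs, ← Complex.norm_real]; push_cast; rfl
    · push_cast; ring_nf
  obtain ⟨k₀, hk₀⟩ := exists_nat_ge (1 / ε - ν)
  have hstep : ∀ k, k₀ ≤ k → c (k + 1) ≤ ε * c k := by
    intro k hk
    have h1 : (k₀ : ℝ) ≤ k := by exact_mod_cast hk
    have h2 : 1 / ε ≤ |ν + k + 1| := le_trans (by linarith) (le_abs_self _)
    have h3 : 0 ≤ c (k + 1) := norm_nonneg _
    rw [hrec k]
    calc c (k + 1) = ε * (1 / ε * c (k + 1)) := by field_simp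
      _ ≤ ε * (|ν + k + 1| * c (k + 1)) := by gcongr
  set K : ℝ := 1 + ∑ k ∈ Finset.range (k₀ + 1), c k / ε ^ k
  have hKpos : ∀ k, 0 ≤ c k / ε ^ k := fun k => div_nonneg (norm_nonneg _) (by positivity)
  have hK : 0 < K := by
    have : 0 ≤ ∑ k ∈ Finset.range (k₀ + 1), c k / ε ^ k := Finset.sum_nonneg fun k _ => hKpos k
    simp only [K]; linarith
  have hsmall : ∀ k, k ≤ k₀ → c k ≤ K * ε ^ k := by
    intro k hk
    rw [← div_le_iff₀ (by positivity)]
    have := Finset.single_le_sum (f := fun k => c k / ε ^ k) (fun i _ => hKpos i)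
      (Finset.mem_range.2 (Nat.lt_succ_of_le hk))
    simp only [K]; linarith
  refine ⟨K, hK, fun k => ?_⟩
  rcases le_total k k₀ with h | h
  · exact hsmall k h
  · induction k, h using Nat.le_induction with
    | base => exact hsmall _ le_rfl
    | succ k hk ih =>
      calc c (k + 1) ≤ ε * c k := hstep k hk
        _ ≤ ε * (K * ε ^ k) := by gcongr
        _ = K * ε ^ (k + 1) := by ring

theorem summable_norm_cliffordF (ν : ℝ) (w : ℂ) :
    Summable fun k : ℕ =>
      ‖(Complex.Gamma ((ν : ℂ) + k + 1))⁻¹ * (w ^ k / (k.factorial : ℂ))‖ := by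
  obtain ⟨K, hK, h⟩ := exists_norm_inv_Gamma_le ν one_pos
  refine Summable.of_nonneg_of_le (fun _ => norm_nonneg _) (fun k => ?_)
    ((Real.summable_pow_div_factorial ‖w‖).mul_left K)
  rw [norm_mul, norm_div, norm_pow, Complex.norm_natCast]
  have := h k
  rw [one_pow, mul_one] at this
  gcongr

theorem summable_cliffordF (ν : ℝ) (w : ℂ) :
    Summable fun k : ℕ => (Complex.Gamma ((ν : ℂ) + k + 1))⁻¹ * (w ^ k / (k.factorial : ℂ)) :=
  (summable_norm_cliffordF ν w).of_norm

/-- `F_ν` has order `1/2`; growth slower than every exponential is all that is needed. -/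
theorem exists_norm_cliffordF_le (ν : ℝ) {ε : ℝ} (hε : 0 < ε) :
    ∃ K : ℝ, 0 < K ∧ ∀ w : ℂ, ‖cliffordF ν w‖ ≤ K * Real.exp (ε * ‖w‖) := by
  obtain ⟨K, hK, h⟩ := exists_norm_inv_Gamma_le ν hε
  refine ⟨K, hK, fun w => ?_⟩
  have hs : HasSum (fun k : ℕ => K * ((ε * ‖w‖) ^ k / (k.factorial : ℝ)))
      (K * Real.exp (ε * ‖w‖)) := by
    rw [Real.exp_eq_exp_ℝ]
    exact (NormedSpace.expSeries_div_hasSum_exp (ε * ‖w‖)).mul_left K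
  refine tsum_of_norm_bounded hs fun k => ?_
  rw [norm_mul, norm_div, norm_pow, Complex.norm_natCast, mul_pow]
  calc _ ≤ K * ε ^ k * (‖w‖ ^ k / (k.factorial : ℝ)) := by gcongr; exact h k
    _ = _ := by ring

theorem cliffordF_zero (ν : ℝ) : cliffordF ν 0 = (Complex.Gamma ((ν : ℂ) + 1))⁻¹ := by
  unfold cliffordF
  rw [tsum_eq_single 0]
  · simp
  · intro k hk; simp [hk]

theorem hasDerivAt_cliffordF (ν : ℝ) (w : ℂ) :
    HasDerivAt (cliffordF ν) (cliffordF (ν + 1) w) w := by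
  obtain ⟨K, hK, h⟩ := exists_norm_inv_Gamma_le ν one_pos
  set R : ℝ := ‖w‖ + 1
  have hR : 0 < R := by positivity
  have key : HasDerivAt (cliffordF ν)
      (∑' k : ℕ, (Complex.Gamma ((ν : ℂ) + k + 1))⁻¹ *
        (k * w ^ (k - 1) / (k.factorial : ℂ))) w := by
    refine hasDerivAt_tsum_of_isPreconnected (u := fun k : ℕ =>
        K * (k * R ^ (k - 1) / (k.factorial : ℝ)))
      (t := Metric.ball 0 R) (y₀ := w) ?_ Metric.isOpen_ball
      (convex_ball 0 R).isPreconnected (g := fun (k : ℕ) (w : ℂ) =>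
        (Complex.Gamma ((ν : ℂ) + k + 1))⁻¹ * (w ^ k / (k.factorial : ℂ)))
      (g' := fun (k : ℕ) (w : ℂ) =>
        (Complex.Gamma ((ν : ℂ) + k + 1))⁻¹ * (k * w ^ (k - 1) / (k.factorial : ℂ)))
      ?_ ?_ ?_ (summable_cliffordF ν w) ?_
    · refine Summable.mul_left K ?_
      rw [← summable_nat_add_iff 1]
      refine (Real.summable_pow_div_factorial R).congr fun k => ?_
      rw [Nat.factorial_succ]; push_cast
      have : (k : ℝ) + 1 ≠ 0 := by positivity
      field_simp
    · intro k y _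
      exact ((hasDerivAt_pow k y).div_const _).const_mul _
    · intro k y hy
      rw [mem_ball_zero_iff] at hy
      rw [norm_mul, norm_div, norm_mul, norm_pow, Complex.norm_natCast, Complex.norm_natCast]
      have := h k
      rw [one_pow, mul_one] at this
      gcongr
    · simp [R]
    · simp [R]
  convert key using 1
  have hsum : Summable fun k : ℕ =>
      (Complex.Gamma ((ν : ℂ) + k + 1))⁻¹ * (k * w ^ (k - 1) / (k.factorial : ℂ)) := by
    rw [← summable_nat_add_iff 1]
    refine (summable_cliffordF (ν + 1) w).congr fun k => ?_
    rw [Nat.factorial_succ]; push_cast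
    have : (k : ℂ) + 1 ≠ 0 := by exact_mod_cast Nat.succ_ne_zero k
    rw [mul_div_mul_left _ _ this]
    ring_nf
  rw [hsum.tsum_eq_zero_add]
  simp only [Nat.cast_zero, zero_mul, zero_div, mul_zero, zero_add]
  unfold cliffordF
  refine tsum_congr fun k => ?_
  rw [Nat.factorial_succ]; push_cast
  have : (k : ℂ) + 1 ≠ 0 := by exact_mod_cast Nat.succ_ne_zero k
  rw [mul_div_mul_left _ _ this]
  ring_nf

theorem differentiable_cliffordF (ν : ℝ) : Differentiable ℂ (cliffordF ν) :=
  fun w => (hasDerivAt_cliffordF ν w).differentiableAt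

@[fun_prop]
theorem continuous_cliffordF (ν : ℝ) : Continuous (cliffordF ν) :=
  (differentiable_cliffordF ν).continuous

/-- The three-term recurrence of the Bessel functions. -/
theorem cliffordF_sub_one (ν : ℝ) (w : ℂ) :
    cliffordF (ν - 1) w = ν * cliffordF ν w + w * cliffordF (ν + 1) w := by
  have h1 : HasSum (fun k : ℕ => (k : ℂ) * ((Complex.Gamma ((ν : ℂ) + k + 1))⁻¹ *
      (w ^ k / (k.factorial : ℂ)))) (w * cliffordF (ν + 1) w) := by
    rw [← hasSum_nat_add_iff' 1]
    simp only [Finset.range_one, Finset.sum_singleton, Nat.cast_zero, zero_mul, sub_zero]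
    refine ((summable_cliffordF (ν + 1) w).hasSum.mul_left w).congr_fun fun k => ?_
    rw [Nat.factorial_succ]; push_cast
    have : (k : ℂ) + 1 ≠ 0 := by exact_mod_cast Nat.succ_ne_zero k
    have e : (ν : ℂ) + 1 + k + 1 = ν + (k + 1) + 1 := by ring
    rw [e]
    field_simp
    ring
  have h2 := ((summable_cliffordF ν w).hasSum.mul_left (ν : ℂ)).add h1
  unfold cliffordF at h2 ⊢
  rw [← h2.tsum_eq]
  refine tsum_congr fun k => ?_
  have e : ((ν - 1 : ℝ) : ℂ) + k + 1 = ν + k := by push_cast; ring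
  rw [e, Complex.one_div_Gamma_eq_self_mul_one_div_Gamma_add_one]
  ring

theorem cliffordF_eq_add (ν : ℝ) (w : ℂ) :
    cliffordF ν w = (ν + 1) * cliffordF (ν + 1) w + w * cliffordF (ν + 2) w := by
  have := cliffordF_sub_one (ν + 1) w
  rw [add_sub_cancel_right] at this
  rw [this, show ν + 1 + 1 = ν + 2 by ring]; push_cast; ring

/-- Reflection at integer orders, `I_{-q} = I_q`: the first `q` terms of the series of `F_{-q}`
vanish. -/
theorem cliffordF_neg_natCast (q : ℕ) (w : ℂ) :
    cliffordF (-(q : ℝ)) w = w ^ q * cliffordF q w := by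
  have hz : ∀ k ∈ Finset.range q, (Complex.Gamma (((-(q : ℝ) : ℝ) : ℂ) + k + 1))⁻¹ *
      (w ^ k / (k.factorial : ℂ)) = 0 := by
    intro k hk
    have hk' : k + 1 ≤ q := Finset.mem_range.1 hk
    have : ((-(q : ℝ) : ℝ) : ℂ) + k + 1 = -((q - (k + 1) : ℕ) : ℂ) := by
      push_cast [Nat.cast_sub hk']; ring
    rw [this, Complex.Gamma_neg_nat_eq_zero, inv_zero, zero_mul]
  unfold cliffordF
  rw [← (summable_cliffordF (-(q : ℝ)) w).sum_add_tsum_nat_add q, Finset.sum_eq_zero hz, zero_add,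
    ← tsum_mul_left]
  refine tsum_congr fun k => ?_
  have e : ((-(q : ℝ) : ℝ) : ℂ) + ((k + q : ℕ) : ℂ) + 1 = k + 1 := by push_cast; ring
  have e2 : ((q : ℝ) : ℂ) + k + 1 = ((k + q : ℕ) : ℂ) + 1 := by push_cast; ring
  rw [e, e2, Complex.Gamma_nat_eq_factorial, Complex.Gamma_nat_eq_factorial, pow_add]
  field_simp

/-! ### Laplace transforms of Bessel functions -/

/-- A sequence of entire functions each of which is the derivative of the preceding one is given
by the Taylor series of its first member. -/
theorem hasSum_of_forall_hasDerivAt_succ {f : ℕ → ℂ → ℂ}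
    (h : ∀ k x, HasDerivAt (f k) (f (k + 1) x) x) (x : ℂ) :
    HasSum (fun k => f k 0 * (x ^ k / (k.factorial : ℂ))) (f 0 x) := by
  have hd : ∀ k, iteratedDeriv k (f 0) = f k := by
    intro k
    induction k with
    | zero => simp
    | succ k ih => rw [iteratedDeriv_succ, ih]; exact funext fun x => (h k x).deriv
  have := Complex.hasSum_taylorSeries_of_entire
    (fun x => (h 0 x).differentiableAt : Differentiable ℂ (f 0)) 0 x
  refine this.congr_fun fun k => ?_
  rw [hd, sub_zero, smul_eq_mul, smul_eq_mul]; ring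

/-- Differentiation under the integral sign for `x ↦ ∫ w(t) φ(xt)`. -/
theorem hasDerivAt_integral_mul_comp {m : Measure ℝ} {w : ℝ → ℂ} {φ φ' : ℂ → ℂ}
    (hφ : ∀ z, HasDerivAt φ (φ' z) z) (hφ' : Continuous φ') (hw : AEStronglyMeasurable w m)
    (h0 : ∀ x : ℂ, Integrable (fun t : ℝ => w t * φ (x * t)) m)
    (hB : ∀ R > 0, ∃ B : ℝ → ℝ, Integrable B m ∧
      ∀ᵐ t : ℝ ∂m, ∀ x : ℂ, ‖x‖ ≤ R → ‖w t * (t * φ' (x * t))‖ ≤ B t) (x : ℂ) :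
    HasDerivAt (fun x : ℂ => ∫ t : ℝ, w t * φ (x * t) ∂m)
      (∫ t : ℝ, w t * (t * φ' (x * t)) ∂m) x := by
  obtain ⟨B, hBi, hB⟩ := hB (‖x‖ + 1) (by positivity)
  refine (hasDerivAt_integral_of_dominated_loc_of_deriv_le (s := Metric.ball x 1)
    (F := fun (x : ℂ) (t : ℝ) => w t * φ (x * t))
    (F' := fun (x : ℂ) (t : ℝ) => w t * (t * φ' (x * t))) (bound := B)
    (Metric.ball_mem_nhds x one_pos) (Eventually.of_forall fun y => (h0 y).1) (h0 x) ?_ ?_ hBi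
    ?_).2
  · refine hw.mul (Continuous.aestronglyMeasurable ?_)
    fun_prop
  · filter_upwards [hB] with t ht y hy
    refine ht y ?_
    rw [Metric.mem_ball, dist_eq_norm] at hy
    have := norm_le_norm_add_norm_sub' y x
    linarith
  · refine Eventually.of_forall fun t y _ => ?_
    have h1 : HasDerivAt (fun y : ℂ => y * (t : ℂ)) t y := by
      simpa using (hasDerivAt_id y).mul_const (t : ℂ)
    have h2 := ((hφ (y * t)).comp y h1).const_mul (w t)
    rw [mul_comm (φ' (y * t))] at h2
    exact h2

theorem exists_norm_cliffordF_mul_le (ν : ℝ) {ε : ℝ} (hε : 0 < ε) {R : ℝ} (hR : 0 < R) :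
    ∃ K : ℝ, 0 < K ∧ ∀ x : ℂ, ‖x‖ ≤ R → ∀ t : ℝ, 0 ≤ t →
      ‖cliffordF ν (x * t)‖ ≤ K * Real.exp (ε * t) := by
  obtain ⟨K, hK, h⟩ := exists_norm_cliffordF_le ν (div_pos hε hR)
  refine ⟨K, hK, fun x hx t ht => (h _).trans ?_⟩
  refine mul_le_mul_of_nonneg_left (Real.exp_le_exp.2 ?_) hK.le
  rw [norm_mul, Complex.norm_real, Real.norm_of_nonneg ht]
  calc ε / R * (‖x‖ * t) ≤ ε / R * (R * t) := by gcongr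
    _ = ε * t := by field_simp

theorem exists_norm_cliffordF_mul_le' (ν : ℝ) {ε : ℝ} (hε : 0 < ε) (x : ℂ) :
    ∃ K : ℝ, 0 < K ∧ ∀ t : ℝ, 0 ≤ t → ‖cliffordF ν (x * t)‖ ≤ K * Real.exp (ε * t) := by
  obtain ⟨K, hK, h⟩ := exists_norm_cliffordF_mul_le ν hε (R := ‖x‖ + 1) (by positivity)
  exact ⟨K, hK, fun t ht => h x (by linarith) t ht⟩

theorem hasDerivAt_integral_mul_cliffordF {m : Measure ℝ} {w : ℝ → ℂ} (ν : ℝ)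
    (hm : ∀ᵐ t ∂m, 0 ≤ t) {δ : ℝ} (hδ : 0 < δ)
    (hw : Integrable (fun t : ℝ => w t * (Real.exp (δ * t) : ℂ)) m) (x : ℂ) :
    HasDerivAt (fun x : ℂ => ∫ t : ℝ, w t * cliffordF ν (x * t) ∂m)
      (∫ t : ℝ, w t * (t * cliffordF (ν + 1) (x * t)) ∂m) x := by
  have hwm : AEStronglyMeasurable w m := by
    have : AEStronglyMeasurable (fun t : ℝ => (w t * (Real.exp (δ * t) : ℂ)) *
        (Real.exp (-(δ * t)) : ℂ)) m :=
      hw.1.mul (Continuous.aestronglyMeasurable (by fun_prop))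
    refine this.congr (Eventually.of_forall fun t => ?_)
    simp only
    rw [mul_assoc, ← Complex.ofReal_mul, ← Real.exp_add]; simp
  refine hasDerivAt_integral_mul_comp (hasDerivAt_cliffordF ν) (continuous_cliffordF _) hwm ?_ ?_ x
  · intro x
    obtain ⟨K, hK, h⟩ := exists_norm_cliffordF_mul_le' ν hδ x
    refine (hw.norm.const_mul K).mono' (hwm.mul (Continuous.aestronglyMeasurable (by fun_prop))) ?_
    filter_upwards [hm] with t ht
    rw [norm_mul, norm_mul, Complex.norm_real, Real.norm_of_nonneg (Real.exp_nonneg _)]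
    calc _ ≤ ‖w t‖ * (K * Real.exp (δ * t)) := by gcongr; exact h t ht
      _ = _ := by ring
  · intro R hR
    obtain ⟨K, hK, h⟩ := exists_norm_cliffordF_mul_le (ν + 1) (half_pos hδ) hR
    refine ⟨fun t => K * (2 / δ) * ‖w t * (Real.exp (δ * t) : ℂ)‖, hw.norm.const_mul _, ?_⟩
    filter_upwards [hm] with t ht x hx
    rw [norm_mul, norm_mul, norm_mul, Complex.norm_real, Complex.norm_real, Real.norm_of_nonneg ht,
      Real.norm_of_nonneg (Real.exp_nonneg _)]
    have h1 : t ≤ 2 / δ * Real.exp (δ / 2 * t) := by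
      have := Real.add_one_le_exp (δ / 2 * t)
      calc t = 2 / δ * (δ / 2 * t) := by field_simp
        _ ≤ _ := by gcongr; linarith
    calc ‖w t‖ * (t * ‖cliffordF (ν + 1) (x * t)‖)
        ≤ ‖w t‖ * ((2 / δ * Real.exp (δ / 2 * t)) * (K * Real.exp (δ / 2 * t))) := by
          gcongr; exact h x hx t ht
      _ = K * (2 / δ) * (‖w t‖ * (Real.exp (δ / 2 * t) * Real.exp (δ / 2 * t))) := by ring
      _ = _ := by rw [← Real.exp_add]; congr 4; ring

/-- The weight `e^{-st} t^N` of the Laplace transforms. -/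
noncomputable def expPow (s N : ℝ) (t : ℝ) : ℂ := Complex.exp (-(s : ℂ) * t) * (t : ℂ) ^ (N : ℂ)

theorem norm_expPow (s N : ℝ) {t : ℝ} (ht : 0 < t) :
    ‖expPow s N t‖ = t ^ N * Real.exp (-s * t) := by
  rw [expPow, norm_mul, Complex.norm_exp, Complex.norm_cpow_eq_rpow_re_of_pos ht, mul_comm]
  simp

theorem expPow_add_one (s N : ℝ) {t : ℝ} (ht : 0 < t) :
    expPow s (N + 1) t = t * expPow s N t := by
  have : (t : ℂ) ≠ 0 := by exact_mod_cast ht.ne'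
  rw [expPow, expPow]; push_cast
  rw [Complex.cpow_add _ _ this, Complex.cpow_one]; ring

theorem continuousOn_expPow (s N : ℝ) : ContinuousOn (expPow s N) (Ioi 0) := by
  intro t ht
  unfold expPow
  refine ContinuousAt.continuousWithinAt (ContinuousAt.mul (by fun_prop) ?_)
  exact Complex.continuousAt_ofReal_cpow_const _ _ (Or.inr (ne_of_gt ht))

theorem integrableOn_expPow_mul {s N δ K : ℝ} (hN : -1 < N) (hδ : δ < s) {g : ℝ → ℂ}
    (hg : ContinuousOn g (Ioi 0)) (hb : ∀ t, 0 < t → ‖g t‖ ≤ K * Real.exp (δ * t)) :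
    IntegrableOn (fun t => expPow s N t * g t) (Ioi 0) := by
  have h := (integrableOn_rpow_mul_exp_neg_mul_rpow (p := 1) hN one_pos (sub_pos.2 hδ)).const_mul K
  refine Integrable.mono' h
    (((continuousOn_expPow s N).mul hg).aestronglyMeasurable measurableSet_Ioi) ?_
  filter_upwards [ae_restrict_mem measurableSet_Ioi] with t ht
  have ht : 0 < t := ht
  rw [norm_mul, norm_expPow s N ht, Real.rpow_one]
  calc _ ≤ t ^ N * Real.exp (-s * t) * (K * Real.exp (δ * t)) := by gcongr; exact hb t ht
    _ = K * (t ^ N * (Real.exp (-s * t) * Real.exp (δ * t))) := by ring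
    _ = _ := by rw [← Real.exp_add]; ring_nf

theorem ae_nonneg_Ioi : ∀ᵐ t : ℝ ∂(volume.restrict (Ioi (0 : ℝ))), 0 ≤ t := by
  filter_upwards [ae_restrict_mem measurableSet_Ioi] with t ht using le_of_lt ht

theorem ae_nonneg_Ioc : ∀ᵐ t : ℝ ∂(volume.restrict (Ioc (0 : ℝ) 1)), 0 ≤ t := by
  filter_upwards [ae_restrict_mem measurableSet_Ioc] with t ht using le_of_lt ht.1

theorem continuous_cliffordF_mul (ν : ℝ) (x : ℂ) :
    Continuous fun t : ℝ => cliffordF ν (x * t) := by fun_prop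

theorem integrableOn_expPow_mul_cliffordF {s N : ℝ} (hs : 0 < s) (hN : -1 < N) (ν : ℝ) (x : ℂ) :
    IntegrableOn (fun t : ℝ => expPow s N t * cliffordF ν (x * t)) (Ioi 0) := by
  obtain ⟨K, -, h⟩ := exists_norm_cliffordF_mul_le' ν (half_pos hs) x
  exact integrableOn_expPow_mul hN (half_lt_self hs) (continuous_cliffordF_mul ν x).continuousOn
    fun t ht => h t ht.le

theorem integrableOn_expPow_mul_cliffordF_mul_exp {s N δ : ℝ} (hs : δ < s) (hN : -1 < N)
    (ν : ℝ) (x : ℂ) :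
    IntegrableOn (fun t : ℝ => expPow s N t * cliffordF ν (x * t) * (Real.exp (δ * t) : ℂ))
      (Ioi 0) := by
  obtain ⟨K, -, h⟩ := exists_norm_cliffordF_mul_le' ν (half_pos (sub_pos.2 hs)) x
  simp only [mul_assoc]
  refine integrableOn_expPow_mul (δ := δ + (s - δ) / 2) (K := K) hN (by linarith)
    (by fun_prop) fun t ht => ?_
  rw [norm_mul, Complex.norm_real, Real.norm_of_nonneg (Real.exp_nonneg _)]
  calc _ ≤ K * Real.exp ((s - δ) / 2 * t) * Real.exp (δ * t) := by gcongr; exact h t ht.le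
    _ = _ := by rw [mul_assoc, ← Real.exp_add]; ring_nf

theorem integrableOn_expPow_mul_cliffordF_mul_cliffordF {s N : ℝ} (hs : 0 < s) (hN : -1 < N)
    (ν ν' : ℝ) (C x : ℂ) :
    IntegrableOn (fun t : ℝ => expPow s N t * cliffordF ν (C * t) * cliffordF ν' (x * t))
      (Ioi 0) := by
  obtain ⟨K, hK, h⟩ := exists_norm_cliffordF_mul_le' ν (ε := s / 4) (by positivity) C
  obtain ⟨K', -, h'⟩ := exists_norm_cliffordF_mul_le' ν' (ε := s / 4) (by positivity) x
  simp only [mul_assoc]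
  refine integrableOn_expPow_mul (δ := s / 2) (K := K * K') hN (by linarith)
    (by fun_prop) fun t ht => ?_
  rw [norm_mul]
  calc _ ≤ (K * Real.exp (s / 4 * t)) * (K' * Real.exp (s / 4 * t)) := by
        gcongr
        · exact h t ht.le
        · exact h' t ht.le
    _ = K * K' * (Real.exp (s / 4 * t) * Real.exp (s / 4 * t)) := by ring
    _ = _ := by rw [← Real.exp_add]; ring_nf

theorem integral_expPow {s N : ℝ} (hs : 0 < s) (hN : -1 < N) :
    ∫ t in Ioi (0 : ℝ), expPow s N t =
      (s : ℂ) ^ (-((N : ℂ) + 1)) * Complex.Gamma ((N : ℂ) + 1) := by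
  have h := Complex.integral_cpow_mul_exp_neg_mul_Ioi (a := (N : ℂ) + 1) (r := s)
    (by simp; linarith) hs
  rw [Complex.cpow_neg, ← Complex.inv_cpow _ _ (by
    rw [Complex.arg_ofReal_of_nonneg hs.le]; exact Real.pi_pos.ne), ← one_div, ← h]
  refine setIntegral_congr_fun measurableSet_Ioi fun t _ => ?_
  simp only [expPow]
  rw [add_sub_cancel_right, mul_comm, neg_mul]

/-- The Laplace transform `∫ e^{-st} t^N F_N(Ct) dt = s^{-N-1} e^{C/s}`: differentiation in `C`
raises `N` by one, and the resulting Taylor series in `C` is an exponential series. -/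
theorem integral_expPow_mul_cliffordF {s N : ℝ} (hs : 0 < s) (hN : -1 < N) (C : ℂ) :
    ∫ t in Ioi (0 : ℝ), expPow s N t * cliffordF N (C * t) =
      (s : ℂ) ^ (-((N : ℂ) + 1)) * Complex.exp (C / s) := by
  have hs' : (s : ℂ) ≠ 0 := by exact_mod_cast hs.ne'
  set f : ℕ → ℂ → ℂ := fun k x =>
    ∫ t in Ioi (0 : ℝ), expPow s (N + k) t * cliffordF (N + k) (x * t)
  have hNk : ∀ k : ℕ, -1 < N + k := fun k => by
    have : (0 : ℝ) ≤ k := k.cast_nonneg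
    linarith
  have hder : ∀ k x, HasDerivAt (f k) (f (k + 1) x) x := by
    intro k x
    have h := hasDerivAt_integral_mul_cliffordF (w := expPow s (N + k)) (N + k) ae_nonneg_Ioi
      (half_pos hs) (integrableOn_expPow_mul (K := 1) (hNk k) (half_lt_self hs) (by fun_prop)
        (fun t _ => by rw [Complex.norm_real, Real.norm_of_nonneg (Real.exp_nonneg _), one_mul])) x
    convert h using 1
    refine setIntegral_congr_fun measurableSet_Ioi fun t ht => ?_
    push_cast
    rw [← add_assoc, expPow_add_one _ _ ht]; ring
  have h0 : ∀ k, f k 0 = (s : ℂ) ^ (-((N : ℂ) + 1)) * (1 / s) ^ k := by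
    intro k
    have hG : Complex.Gamma (((N + k : ℝ) : ℂ) + 1) ≠ 0 := by
      refine Complex.Gamma_ne_zero_of_re_pos ?_
      have := hNk k
      simp at this ⊢
      linarith
    simp only [f, zero_mul, cliffordF_zero]
    rw [integral_mul_const, integral_expPow hs (hNk k), mul_assoc, mul_inv_cancel₀ hG, mul_one]
    push_cast
    rw [show -((N : ℂ) + k + 1) = -((N : ℂ) + 1) - k by ring, Complex.cpow_sub _ _ hs',
      Complex.cpow_natCast]
    simp [div_eq_mul_inv]
  have h1 := hasSum_of_forall_hasDerivAt_succ hder C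
  have h2 : HasSum (fun k : ℕ => (s : ℂ) ^ (-((N : ℂ) + 1)) *
      ((C / s) ^ k / (k.factorial : ℂ))) ((s : ℂ) ^ (-((N : ℂ) + 1)) * Complex.exp (C / s)) := by
    rw [Complex.exp_eq_exp_ℂ]
    exact (NormedSpace.expSeries_div_hasSum_exp (C / (s : ℂ))).mul_left _
  have h3 : f 0 C = (s : ℂ) ^ (-((N : ℂ) + 1)) * Complex.exp (C / s) := by
    refine h1.unique (h2.congr_fun fun k => ?_)
    rw [h0]; ring
  simpa [f] using h3

/-- Sonine's first integral: averaging `F_{μ-1}` against a Beta density raises the order. -/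
theorem integral_beta_mul_cliffordF {μ : ℝ} (hμ : 0 < μ) (k : ℕ) (x : ℂ) :
    ∫ τ in Ioc (0 : ℝ) 1, (τ : ℂ) ^ ((μ : ℂ) - 1) * (1 - (τ : ℂ)) ^ k * cliffordF (μ - 1) (x * τ) =
      (k.factorial : ℂ) * cliffordF (μ + k) x := by
  have hμj : ∀ j : ℕ, 0 < μ + j := fun j => by positivity
  have hconv : ∀ j : ℕ, IntegrableOn (fun τ : ℝ =>
      (τ : ℂ) ^ (((μ + j : ℝ) : ℂ) - 1) * (1 - (τ : ℂ)) ^ k) (Ioc 0 1) := by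
    intro j
    have h := Complex.betaIntegral_convergent (u := ((μ + j : ℝ) : ℂ)) (v := (k : ℂ) + 1)
      (by rw [Complex.ofReal_re]; exact hμj j) (by simp; positivity)
    rw [intervalIntegrable_iff_integrableOn_Ioc_of_le zero_le_one] at h
    refine h.congr_fun (fun τ _ => ?_) measurableSet_Ioc
    simp only
    rw [add_sub_cancel_right, Complex.cpow_natCast]
  set f : ℕ → ℂ → ℂ := fun j x => ∫ τ in Ioc (0 : ℝ) 1,
    (τ : ℂ) ^ (((μ + j : ℝ) : ℂ) - 1) * (1 - (τ : ℂ)) ^ k * cliffordF (μ + j - 1) (x * τ)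
  have hder : ∀ j x, HasDerivAt (f j) (f (j + 1) x) x := by
    intro j x
    have hexp : IntegrableOn (fun τ : ℝ => (τ : ℂ) ^ (((μ + j : ℝ) : ℂ) - 1) *
        (1 - (τ : ℂ)) ^ k * (Real.exp (1 * τ) : ℂ)) (Ioc 0 1) := by
      refine Integrable.mono' ((hconv j).norm.mul_const (Real.exp 1))
        ((hconv j).1.mul (Continuous.aestronglyMeasurable (by fun_prop))) ?_
      filter_upwards [ae_restrict_mem measurableSet_Ioc] with τ hτ
      rw [norm_mul, Complex.norm_real, Real.norm_of_nonneg (Real.exp_nonneg _)]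
      gcongr
      linarith [hτ.2]
    have h := hasDerivAt_integral_mul_cliffordF (μ + j - 1) ae_nonneg_Ioc one_pos hexp x
    convert h using 1
    refine setIntegral_congr_fun measurableSet_Ioc fun t ht => ?_
    have ht0 : (t : ℂ) ≠ 0 := by exact_mod_cast ht.1.ne'
    have e1 : ((μ + ((j + 1 : ℕ) : ℝ) : ℝ) : ℂ) - 1 = ((μ + j : ℝ) : ℂ) - 1 + 1 := by
      push_cast; ring
    have e2 : μ + ((j + 1 : ℕ) : ℝ) - 1 = μ + j - 1 + 1 := by push_cast; ring
    rw [e1, e2, Complex.cpow_add _ _ ht0, Complex.cpow_one]; ring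
  have h0 : ∀ j, f j 0 = (k.factorial : ℂ) * (Complex.Gamma (((μ + k : ℝ) : ℂ) + j + 1))⁻¹ := by
    intro j
    simp only [f, zero_mul, cliffordF_zero]
    have hre : 0 < ((μ + j : ℝ) : ℂ).re := by rw [Complex.ofReal_re]; exact hμj j
    have hb := Complex.Gamma_mul_Gamma_eq_betaIntegral hre
      (by simp; positivity : 0 < ((k : ℂ) + 1).re)
    have hbi : Complex.betaIntegral ((μ + j : ℝ) : ℂ) ((k : ℂ) + 1) = ∫ τ in Ioc (0 : ℝ) 1,
        (τ : ℂ) ^ (((μ + j : ℝ) : ℂ) - 1) * (1 - (τ : ℂ)) ^ k := by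
      rw [Complex.betaIntegral, intervalIntegral.integral_of_le zero_le_one]
      refine setIntegral_congr_fun measurableSet_Ioc fun τ _ => ?_
      rw [add_sub_cancel_right, Complex.cpow_natCast]
    rw [integral_mul_const, ← hbi]
    rw [Complex.Gamma_nat_eq_factorial] at hb
    have hG1 := Complex.Gamma_ne_zero_of_re_pos hre
    have hG2 : Complex.Gamma (((μ + j : ℝ) : ℂ) + (k + 1)) ≠ 0 := by
      refine Complex.Gamma_ne_zero_of_re_pos ?_
      simp; positivity
    have e1 : ((μ + j - 1 : ℝ) : ℂ) + 1 = ((μ + j : ℝ) : ℂ) := by push_cast; ring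
    have e2 : ((μ + k : ℝ) : ℂ) + j + 1 = ((μ + j : ℝ) : ℂ) + (k + 1) := by push_cast; ring
    rw [e1, e2]
    field_simp
    rw [mul_comm (Complex.betaIntegral _ _), ← hb]
  have h1 := hasSum_of_forall_hasDerivAt_succ hder x
  have h2 := (summable_cliffordF (μ + k) x).hasSum.mul_left (k.factorial : ℂ)
  have h3 : f 0 x = (k.factorial : ℂ) * cliffordF (μ + k) x := by
    refine h1.unique (h2.congr_fun fun j => ?_)
    rw [h0]; ring
  simpa [f] using h3

/-! ### Weber's second exponential integral -/

theorem hasDerivAt_expPow_add_one (s N : ℝ) {t : ℝ} (ht : 0 < t) :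
    HasDerivAt (expPow s (N + 1)) ((N + 1) * expPow s N t - s * expPow s (N + 1) t) t := by
  have ht' : (t : ℂ) ∈ Complex.slitPlane := Or.inl (by simpa using ht)
  have h1 : HasDerivAt (fun z : ℂ => Complex.exp (-(s : ℂ) * z)) (Complex.exp (-(s : ℂ) * t) * (-s))
      (t : ℂ) := by
    simpa using ((hasDerivAt_id (t : ℂ)).const_mul (-(s : ℂ))).cexp
  have h2 : HasDerivAt (fun z : ℂ => z ^ ((N + 1 : ℝ) : ℂ))
      (((N + 1 : ℝ) : ℂ) * (t : ℂ) ^ (((N + 1 : ℝ) : ℂ) - 1)) (t : ℂ) := by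
    simpa using (hasDerivAt_id (t : ℂ)).cpow_const (c := ((N + 1 : ℝ) : ℂ)) ht'
  refine (h1.mul h2).comp_ofReal.congr_deriv ?_
  simp only [expPow]
  rw [show ((N + 1 : ℝ) : ℂ) - 1 = N by push_cast; ring]
  push_cast
  ring

theorem continuousAt_expPow_zero (s : ℝ) {N : ℝ} (hN : 0 < N) :
    ContinuousAt (expPow s N) 0 := by
  unfold expPow
  refine ContinuousAt.mul (by fun_prop) ?_
  exact Complex.continuousAt_ofReal_cpow_const _ _ (Or.inl (by simpa using hN))

/-- Integration by parts against `e^{-st}`, using `(t^{N+1} F_{N+1}(Ct))' = t^N F_N(Ct)`. -/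
theorem integral_expPow_mul_cliffordF_by_parts {s N : ℝ} (hs : 0 < s) (hN : -1 < N) (ν : ℝ)
    (C x : ℂ) :
    (s : ℂ) * ∫ t in Ioi (0 : ℝ),
        expPow s (N + 1) t * cliffordF (N + 1) (C * t) * cliffordF ν (x * t) =
      (∫ t in Ioi (0 : ℝ), expPow s N t * cliffordF N (C * t) * cliffordF ν (x * t)) +
        x * ∫ t in Ioi (0 : ℝ),
          expPow s (N + 1) t * cliffordF (N + 1) (C * t) * cliffordF (ν + 1) (x * t) := by
  have hN1 : -1 < N + 1 := by linarith
  have i1 := integrableOn_expPow_mul_cliffordF_mul_cliffordF hs hN1 (N + 1) ν C x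
  have i2 := integrableOn_expPow_mul_cliffordF_mul_cliffordF hs hN N ν C x
  have i3 := integrableOn_expPow_mul_cliffordF_mul_cliffordF hs hN1 (N + 1) (ν + 1) C x
  set G : ℝ → ℂ := fun t => expPow s (N + 1) t * cliffordF (N + 1) (C * t) * cliffordF ν (x * t)
  set G' : ℝ → ℂ := fun t => expPow s N t * cliffordF N (C * t) * cliffordF ν (x * t) +
    x * (expPow s (N + 1) t * cliffordF (N + 1) (C * t) * cliffordF (ν + 1) (x * t)) - s * G t
  have hF : ∀ (ρ : ℝ) (y : ℂ) (t : ℝ), HasDerivAt (fun t : ℝ => cliffordF ρ (y * t))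
      (cliffordF (ρ + 1) (y * t) * y) t := by
    intro ρ y t
    have h1 : HasDerivAt (fun z : ℂ => y * z) y (t : ℂ) := by
      simpa using (hasDerivAt_id (t : ℂ)).const_mul y
    exact ((hasDerivAt_cliffordF ρ (y * t)).comp (t : ℂ) h1).comp_ofReal
  have hder : ∀ t ∈ Ioi (0 : ℝ), HasDerivAt G (G' t) t := by
    intro t ht
    refine (((hasDerivAt_expPow_add_one s N ht).mul (hF (N + 1) C t)).mul (hF ν x t)).congr_deriv ?_
    have := cliffordF_eq_add N (C * t)
    simp only [G', G, Pi.mul_apply]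
    rw [this, expPow_add_one _ _ ht, show N + 1 + 1 = N + 2 by ring]
    ring
  have hint : IntegrableOn G' (Ioi 0) := (i2.add (i3.const_mul x)).sub (i1.const_mul (s : ℂ))
  have hcont : ContinuousWithinAt G (Ici 0) 0 := by
    refine ContinuousAt.continuousWithinAt ?_
    exact ((continuousAt_expPow_zero s (by linarith)).mul
      (continuous_cliffordF_mul _ _).continuousAt).mul (continuous_cliffordF_mul _ _).continuousAt
  have h0 : G 0 = 0 := by
    have : ((N + 1 : ℝ) : ℂ) ≠ 0 := by
      rw [Ne, Complex.ofReal_eq_zero]; linarith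
    simp only [G, expPow, Complex.ofReal_zero, Complex.zero_cpow this]
    ring
  have h := integral_Ioi_of_hasDerivAt_of_tendsto hcont hder hint
    (tendsto_zero_of_hasDerivAt_of_integrableOn_Ioi hder hint i1)
  rw [h0, sub_zero] at h
  have h' : ∫ t in Ioi (0 : ℝ), G' t = ((∫ t in Ioi (0 : ℝ), expPow s N t * cliffordF N (C * t) *
      cliffordF ν (x * t)) + x * ∫ t in Ioi (0 : ℝ), expPow s (N + 1) t *
      cliffordF (N + 1) (C * t) * cliffordF (ν + 1) (x * t)) - s * ∫ t in Ioi (0 : ℝ), G t := by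
    refine (integral_sub (i2.add (i3.const_mul x)) (i1.const_mul (s : ℂ))).trans ?_
    rw [integral_const_mul]
    congr 1
    exact (integral_add i2 (i3.const_mul x)).trans (by rw [integral_const_mul])
  rw [h'] at h
  linear_combination -h

theorem hasDerivAt_integral_expPow_mul_cliffordF {s N : ℝ} (hs : 0 < s) (hN : -1 < N) (ν ρ : ℝ)
    (C x : ℂ) :
    HasDerivAt (fun x : ℂ => ∫ t in Ioi (0 : ℝ),
        expPow s N t * cliffordF ρ (C * t) * cliffordF ν (x * t))
      (∫ t in Ioi (0 : ℝ),
        expPow s N t * cliffordF ρ (C * t) * (t * cliffordF (ν + 1) (x * t))) x :=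
  hasDerivAt_integral_mul_cliffordF ν ae_nonneg_Ioi (half_pos hs)
    (integrableOn_expPow_mul_cliffordF_mul_exp (half_lt_self hs) hN ρ C) x

/-- Weber's second exponential integral.  Integration by parts shows that the derivative in `x` of
`e^{-x/s}` times the left hand side is, up to the factor `C/s`, the same function with `N` raised by
one, so that its Taylor series is known. -/
theorem integral_weber {s N : ℝ} (hs : 0 < s) (hN : -1 < N) (C x : ℂ) :
    ∫ t in Ioi (0 : ℝ), expPow s N t * cliffordF N (C * t) * cliffordF N (x * t) =
      (s : ℂ) ^ (-((N : ℂ) + 1)) * Complex.exp ((C + x) / s) * cliffordF N (x * C / s ^ 2) := by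
  have hs' : (s : ℂ) ≠ 0 := by exact_mod_cast hs.ne'
  have hNk : ∀ k : ℕ, -1 < N + k := fun k => by
    have : (0 : ℝ) ≤ k := k.cast_nonneg
    linarith
  set W : ℕ → ℂ → ℂ := fun k x => ∫ t in Ioi (0 : ℝ),
    expPow s (N + k) t * cliffordF (N + k) (C * t) * cliffordF (N + k) (x * t)
  set f : ℕ → ℂ → ℂ := fun k x => (C / s) ^ k * (Complex.exp (-x / s) * W k x)
  have hW : ∀ k x, HasDerivAt (W k) ((W k x + C * W (k + 1) x) / s) x := by
    intro k x
    refine (hasDerivAt_integral_expPow_mul_cliffordF hs (hNk k) _ _ C x).congr_deriv ?_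
    have h := integral_expPow_mul_cliffordF_by_parts hs (hNk k) (N + k) x C
    have e0 : (∫ t in Ioi (0 : ℝ), expPow s (N + k) t * cliffordF (N + k) (C * t) *
        (t * cliffordF (N + k + 1) (x * t))) = ∫ t in Ioi (0 : ℝ), expPow s (N + k + 1) t *
          cliffordF (N + k + 1) (x * t) * cliffordF (N + k) (C * t) := by
      refine setIntegral_congr_fun measurableSet_Ioi fun t ht => ?_
      rw [expPow_add_one _ _ ht]; ring
    have e1 : W k x = ∫ t in Ioi (0 : ℝ), expPow s (N + k) t * cliffordF (N + k) (x * t) *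
        cliffordF (N + k) (C * t) := by
      refine setIntegral_congr_fun measurableSet_Ioi fun t _ => ?_
      ring
    have e2 : W (k + 1) x = ∫ t in Ioi (0 : ℝ), expPow s (N + k + 1) t *
        cliffordF (N + k + 1) (x * t) * cliffordF (N + k + 1) (C * t) := by
      refine setIntegral_congr_fun measurableSet_Ioi fun t _ => ?_
      push_cast
      rw [← add_assoc]; ring
    rw [e0, e1, e2, eq_div_iff hs', mul_comm, h]
  -- the factor `(C/s)^k` makes `f (k + 1)` exactly the derivative of `f k`
  have hder : ∀ k x, HasDerivAt (f k) (f (k + 1) x) x := by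
    intro k x
    have h1 : HasDerivAt (fun x : ℂ => Complex.exp (-x / s)) (Complex.exp (-x / s) * (-1 / s)) x :=
      ((hasDerivAt_id x).neg.div_const (s : ℂ)).cexp
    refine ((h1.mul (hW k x)).const_mul ((C / s) ^ k)).congr_deriv ?_
    simp only [f, pow_succ]
    field_simp
    ring
  have h0 : ∀ k, f k 0 = (s : ℂ) ^ (-((N : ℂ) + 1)) * Complex.exp (C / s) *
      ((C / s ^ 2) ^ k * (Complex.Gamma ((N : ℂ) + k + 1))⁻¹) := by
    intro k
    simp only [f, W, zero_mul, neg_zero, zero_div, Complex.exp_zero, one_mul, cliffordF_zero]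
    rw [integral_mul_const, integral_expPow_mul_cliffordF hs (hNk k)]
    push_cast
    rw [show -((N : ℂ) + k + 1) = -((N : ℂ) + 1) - k by ring, Complex.cpow_sub _ _ hs',
      Complex.cpow_natCast, div_pow, div_pow]
    field_simp
    ring
  have h1 := hasSum_of_forall_hasDerivAt_succ hder x
  have h2 := (summable_cliffordF N (x * C / s ^ 2)).hasSum.mul_left
    ((s : ℂ) ^ (-((N : ℂ) + 1)) * Complex.exp (C / s))
  have h3 : f 0 x = (s : ℂ) ^ (-((N : ℂ) + 1)) * Complex.exp (C / s) *
      cliffordF N (x * C / s ^ 2) := by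
    refine h1.unique (h2.congr_fun fun k => ?_)
    rw [h0, mul_div_assoc x, mul_pow x]; ring
  simp only [f, W, pow_zero, one_mul, Nat.cast_zero, add_zero] at h3
  calc _ = Complex.exp (x / s) * (Complex.exp (-x / s) * ∫ t in Ioi (0 : ℝ),
        expPow s N t * cliffordF N (C * t) * cliffordF N (x * t)) := by
        rw [← mul_assoc, ← Complex.exp_add, show x / (s : ℂ) + -x / s = 0 by ring, Complex.exp_zero,
          one_mul]
    _ = _ := by rw [h3, add_div, Complex.exp_add]; ring

/-- Weber's integral with the order of one factor lowered by `m`.  Since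
`F_{ν-1} = (ν + w d/dw) F_ν`, applying `ν + x d/dx` to both sides lowers `ν`. -/
theorem integral_weber_sub {s N : ℝ} (hs : 0 < s) (hN : -1 < N) (m : ℕ) (C x : ℂ) :
    ∫ t in Ioi (0 : ℝ), expPow s N t * cliffordF N (C * t) * cliffordF (N - m) (x * t) =
      (s : ℂ) ^ (-((N : ℂ) + 1)) * Complex.exp ((C + x) / s) *
        ∑ j ∈ Finset.range (m + 1), (m.choose j : ℂ) * (x / s) ^ j *
          cliffordF (N - m + j) (x * C / s ^ 2) := by
  have hs' : (s : ℂ) ≠ 0 := by exact_mod_cast hs.ne'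
  induction m generalizing x with
  | zero => simpa using integral_weber hs hN C x
  | succ m ih =>
    set ν : ℝ := N - m
    have hν : N - ((m + 1 : ℕ) : ℝ) = ν - 1 := by simp only [ν]; push_cast; ring
    set A : ℂ := (s : ℂ) ^ (-((N : ℂ) + 1))
    set R : ℂ → ℂ := fun x => A * Complex.exp ((C + x) / s) *
        ∑ j ∈ Finset.range (m + 1), (m.choose j : ℂ) * (x / s) ^ j *
          cliffordF (ν + j) (x * C / s ^ 2)
    have hD := hasDerivAt_integral_expPow_mul_cliffordF hs hN ν N C x
    have hfun : (fun x : ℂ => ∫ t in Ioi (0 : ℝ),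
        expPow s N t * cliffordF N (C * t) * cliffordF ν (x * t)) = R := funext ih
    rw [hfun] at hD
    have hexp : HasDerivAt (fun x : ℂ => A * Complex.exp ((C + x) / s))
        (A * (Complex.exp ((C + x) / s) * (1 / s))) x :=
      ((((hasDerivAt_id x).const_add C).div_const (s : ℂ)).cexp).const_mul A
    have hterm : ∀ j ∈ Finset.range (m + 1), HasDerivAt (fun x : ℂ => (m.choose j : ℂ) *
        (x / s) ^ j * cliffordF (ν + j) (x * C / s ^ 2))
        ((m.choose j : ℂ) * (j * (x / s) ^ (j - 1) * (1 / s)) * cliffordF (ν + j) (x * C / s ^ 2) +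
          (m.choose j : ℂ) * (x / s) ^ j *
            (cliffordF (ν + j + 1) (x * C / s ^ 2) * (C / s ^ 2))) x := by
      intro j _
      have h1 := (((hasDerivAt_id x).div_const (s : ℂ)).pow j).const_mul (m.choose j : ℂ)
      have h2 : HasDerivAt (fun x : ℂ => x * C / (s : ℂ) ^ 2) (C / s ^ 2) x := by
        simpa using ((hasDerivAt_id x).mul_const C).div_const ((s : ℂ) ^ 2)
      exact h1.mul ((hasDerivAt_cliffordF (ν + j) _).comp x h2)
    have hR := (hexp.mul (HasDerivAt.fun_sum hterm))
    have hval := hD.unique hR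
    have i1 := integrableOn_expPow_mul_cliffordF_mul_cliffordF hs hN N ν C x
    have i2 : IntegrableOn (fun t : ℝ => expPow s N t * cliffordF N (C * t) *
        (t * cliffordF (ν + 1) (x * t))) (Ioi 0) := by
      refine (integrableOn_expPow_mul_cliffordF_mul_cliffordF hs (by linarith : -1 < N + 1) N
        (ν + 1) C x).congr_fun (fun t ht => ?_) measurableSet_Ioi
      simp only
      rw [expPow_add_one _ _ ht]; ring
    have hlow : (∫ t in Ioi (0 : ℝ), expPow s N t * cliffordF N (C * t) *
        cliffordF (ν - 1) (x * t)) = ν * R x + x * ∫ t in Ioi (0 : ℝ),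
          expPow s N t * cliffordF N (C * t) * (t * cliffordF (ν + 1) (x * t)) := by
      rw [← congrFun hfun x, ← integral_const_mul, ← integral_const_mul,
        ← integral_add (i1.const_mul _) (i2.const_mul _)]
      refine setIntegral_congr_fun measurableSet_Ioi fun t _ => ?_
      rw [cliffordF_sub_one]; ring
    have hν' : ∀ j : ℕ, N - ((m + 1 : ℕ) : ℝ) + j = ν + j - 1 := fun j => by
      rw [hν]; ring
    rw [← hν] at hlow
    rw [hlow, hval]
    simp only [R]
    set z : ℂ := x * C / s ^ 2
    set y : ℂ := x / s
    set Ex : ℂ := Complex.exp ((C + x) / s)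
    -- each term of the sum reproduces itself one order lower and shifts by one index
    have hsum : ∀ j ∈ Finset.range (m + 1),
        (ν + y) * ((m.choose j : ℂ) * y ^ j * cliffordF (ν + j) z) +
          x * ((m.choose j : ℂ) * (j * y ^ (j - 1) * (1 / s)) * cliffordF (ν + j) z +
          (m.choose j : ℂ) * y ^ j * (cliffordF (ν + j + 1) z * (C / s ^ 2))) =
        (m.choose j : ℂ) * y ^ j * cliffordF (ν + j - 1) z +
          (m.choose j : ℂ) * y ^ (j + 1) * cliffordF (ν + j) z := by
      intro j _
      rw [cliffordF_sub_one (ν + j) z]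
      have hj : x * (j * y ^ (j - 1) * (1 / s)) = j * y ^ j := by
        rcases j with _ | j
        · simp
        · simp only [y, add_tsub_cancel_right, pow_succ]; ring
      push_cast
      simp only [z]
      linear_combination (m.choose j : ℂ) * cliffordF (ν + j) (x * C / s ^ 2) * hj
    have hfin : ∑ j ∈ Finset.range (m + 1 + 1), ((m + 1).choose j : ℂ) * y ^ j *
          cliffordF (N - ((m + 1 : ℕ) : ℝ) + j) z =
        ∑ j ∈ Finset.range (m + 1), ((m.choose j : ℂ) * y ^ j * cliffordF (ν + j - 1) z +
          (m.choose j : ℂ) * y ^ (j + 1) * cliffordF (ν + j) z) := by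
      simp only [hν']
      rw [Finset.sum_add_distrib, Finset.sum_range_succ']
      simp only [Nat.choose_succ_succ, Nat.cast_add, add_mul, Finset.sum_add_distrib]
      have e1 : ∀ j : ℕ, ν + ((j : ℝ) + ((1 : ℕ) : ℝ)) - 1 = ν + j := fun j => by push_cast; ring
      have e3 : ∑ j ∈ Finset.range (m + 1), (m.choose (j + 1) : ℂ) * y ^ (j + 1) *
          cliffordF (ν + j) z + ((m + 1).choose 0 : ℂ) * y ^ 0 *
            cliffordF (ν + ((0 : ℕ) : ℝ) - 1) z =
          ∑ j ∈ Finset.range (m + 1), (m.choose j : ℂ) * y ^ j * cliffordF (ν + j - 1) z := by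
        rw [Finset.sum_range_succ, Nat.choose_succ_self, Finset.sum_range_succ']
        simp only [e1, Nat.cast_add, Nat.choose_zero_right]
        simp
      simp only [e1]
      linear_combination e3
    rw [hfin, ← Finset.sum_congr rfl hsum]
    simp only [Finset.sum_add_distrib (f := fun j => (ν + y) * _), ← Finset.mul_sum]
    simp only [y]
    ring

/-- The case of negative integer `N`, where `t^N F_N(Ct)` is still regular at `t = 0`: by reflection
it is the preceding lemma with the two Bessel functions interchanged. -/
theorem integral_weber_sub_neg {s : ℝ} (hs : 0 < s) (q m : ℕ) (C x : ℂ) :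
    ∫ t in Ioi (0 : ℝ), expPow s (-q) t * cliffordF (-(q : ℝ)) (C * t) *
        cliffordF (-(q : ℝ) - m) (x * t) =
      (s : ℂ) ^ (-(((-(q : ℝ) : ℝ) : ℂ) + 1)) * Complex.exp ((C + x) / s) *
        ∑ j ∈ Finset.range (m + 1), (m.choose j : ℂ) * (x / s) ^ j *
          cliffordF (-(q : ℝ) - m + j) (x * C / s ^ 2) := by
  have hs' : (s : ℂ) ≠ 0 := by exact_mod_cast hs.ne'
  have h := integral_weber_sub hs (N := ((q + m : ℕ) : ℝ))
    (by have : (0 : ℝ) ≤ ((q + m : ℕ) : ℝ) := Nat.cast_nonneg _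
        linarith) m x C
  have e1 : ((q + m : ℕ) : ℝ) - m = q := by push_cast; ring
  rw [e1] at h
  have hl : (∫ t in Ioi (0 : ℝ), expPow s (-q) t * cliffordF (-(q : ℝ)) (C * t) *
        cliffordF (-(q : ℝ) - m) (x * t)) = C ^ q * x ^ (q + m) * ∫ t in Ioi (0 : ℝ),
          expPow s ((q + m : ℕ) : ℝ) t * cliffordF ((q + m : ℕ) : ℝ) (x * t) *
            cliffordF q (C * t) := by
    rw [← integral_const_mul]
    refine setIntegral_congr_fun measurableSet_Ioi fun t ht => ?_
    have ht : 0 < t := ht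
    have ht0 : (t : ℂ) ≠ 0 := by exact_mod_cast ht.ne'
    have e2 : -(q : ℝ) - m = -((q + m : ℕ) : ℝ) := by push_cast; ring
    rw [e2, cliffordF_neg_natCast, cliffordF_neg_natCast, expPow, expPow, mul_pow, mul_pow]
    push_cast
    rw [Complex.cpow_neg, Complex.cpow_natCast, ← Nat.cast_add (R := ℂ),
      Complex.cpow_natCast, pow_add]
    field_simp
  rw [hl, h, ← Finset.sum_range_reflect]
  have e3 : (s : ℂ) ^ (-(((-(q : ℝ) : ℝ) : ℂ) + 1)) =
      (s : ℂ) ^ (-((((q + m : ℕ) : ℝ) : ℂ) + 1)) * (s ^ q * s ^ q * s ^ m) := by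
    push_cast
    rw [show -(-(q : ℂ) + 1) = -((q : ℂ) + m + 1) + q + q + m by ring, Complex.cpow_add _ _ hs',
      Complex.cpow_add _ _ hs', Complex.cpow_add _ _ hs', Complex.cpow_natCast,
      Complex.cpow_natCast]
    ring
  rw [e3, add_comm x C]
  simp only [Finset.mul_sum]
  refine Finset.sum_congr rfl fun j hj => ?_
  have hj' : j ≤ m := Nat.lt_succ_iff.1 (Finset.mem_range.1 hj)
  rw [show m + 1 - 1 - j = m - j by omega, Nat.choose_symm hj']
  have e4 : (q : ℝ) + ((m - j : ℕ) : ℝ) = ((q + (m - j) : ℕ) : ℝ) := by push_cast; ring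
  have e5 : -(q : ℝ) - m + j = -((q + (m - j) : ℕ) : ℝ) := by
    push_cast [Nat.cast_sub hj']; ring
  rw [e4, e5, cliffordF_neg_natCast]
  obtain ⟨i, rfl⟩ := Nat.exists_eq_add_of_le hj'
  rw [Nat.add_sub_cancel_left, show C * x / (s : ℂ) ^ 2 = x * C / s ^ 2 by ring]
  generalize cliffordF ((q + i : ℕ) : ℝ) (x * C / (s : ℂ) ^ 2) = F
  simp only [div_pow, mul_pow]
  field_simp
  ring

/-- Fubini for a product of a Laplace-type weight and an integrable weight on `(0,1]`, coupled by a
kernel of moderate growth. -/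
theorem integral_mul_intervalIntegral_swap {w ω : ℝ → ℂ} {κ : ℝ → ℝ → ℂ} {δ K : ℝ}
    (hw : IntegrableOn (fun t : ℝ => w t * (Real.exp (δ * t) : ℂ)) (Ioi 0))
    (hω : IntegrableOn ω (Ioc 0 1)) (hκ : Continuous (Function.uncurry κ))
    (hb : ∀ t τ, 0 < t → 0 < τ → τ ≤ 1 → ‖κ t τ‖ ≤ K * Real.exp (δ * t)) :
    IntegrableOn (fun t => w t * ∫ τ in Ioc (0 : ℝ) 1, ω τ * κ t τ) (Ioi 0) ∧
    ∫ t in Ioi (0 : ℝ), w t * ∫ τ in Ioc (0 : ℝ) 1, ω τ * κ t τ =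
      ∫ τ in Ioc (0 : ℝ) 1, ω τ * ∫ t in Ioi (0 : ℝ), w t * κ t τ := by
  have hwm : AEStronglyMeasurable w (volume.restrict (Ioi 0)) := by
    have : AEStronglyMeasurable (fun t : ℝ => (w t * (Real.exp (δ * t) : ℂ)) *
        (Real.exp (-(δ * t)) : ℂ)) (volume.restrict (Ioi 0)) :=
      hw.1.mul (Continuous.aestronglyMeasurable (by fun_prop))
    refine this.congr (Eventually.of_forall fun t => ?_)
    simp only
    rw [mul_assoc, ← Complex.ofReal_mul, ← Real.exp_add]; simp
  have hprod : Integrable (Function.uncurry fun t τ => w t * (ω τ * κ t τ))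
      ((volume.restrict (Ioi (0 : ℝ))).prod (volume.restrict (Ioc (0 : ℝ) 1))) := by
    refine Integrable.mono' ((hw.norm.mul_prod hω.norm).const_mul K) ?_ ?_
    · have h1 := hwm.comp_fst (ν := volume.restrict (Ioc (0 : ℝ) 1))
      have h2 := hω.1.comp_snd (μ := volume.restrict (Ioi (0 : ℝ)))
      exact h1.mul (h2.mul hκ.aestronglyMeasurable)
    · rw [Measure.prod_restrict]
      filter_upwards [ae_restrict_mem (measurableSet_Ioi.prod measurableSet_Ioc)] with y hy
      have := hb y.1 y.2 hy.1 hy.2.1 hy.2.2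
      simp only [Function.uncurry]
      rw [norm_mul, norm_mul, norm_mul, Complex.norm_real, Real.norm_of_nonneg (Real.exp_nonneg _)]
      calc _ ≤ ‖w y.1‖ * (‖ω y.2‖ * (K * Real.exp (δ * y.1))) := by gcongr
        _ = _ := by ring
  constructor
  · refine hprod.integral_prod_left.congr (Eventually.of_forall fun t => ?_)
    simp only [Function.uncurry]
    rw [integral_const_mul]
  · have h := integral_integral_swap hprod
    simp only [integral_const_mul] at h
    rw [h]
    refine integral_congr_ae (Eventually.of_forall fun τ => ?_)
    simp only
    rw [← integral_const_mul]
    congr 1; ext t; ring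

/-! ### Integrals along horizontal rays -/

/-- The half-plane `-π/2 < arg x ≤ π/2`, the range of the principal square root without `0`. -/
def rightHalf : Set ℂ := {x | 0 < x.re ∨ (x.re = 0 ∧ 0 < x.im)}

theorem rightHalf_subset_slitPlane {x : ℂ} (hx : x ∈ rightHalf) : x ∈ Complex.slitPlane := by
  rcases hx with h | h
  · exact Or.inl h
  · exact Or.inr h.2.ne'

theorem rightHalf_ne_zero {x : ℂ} (hx : x ∈ rightHalf) : x ≠ 0 :=
  Complex.slitPlane_ne_zero (rightHalf_subset_slitPlane hx)

theorem rightHalf_re_nonneg {x : ℂ} (hx : x ∈ rightHalf) : 0 ≤ x.re := by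
  rcases hx with h | h
  · exact h.le
  · exact h.1.ge

theorem add_ofReal_mem_rightHalf {x : ℂ} (hx : x ∈ rightHalf) {s : ℝ} (hs : 0 ≤ s) :
    x + s ∈ rightHalf := by
  rcases hx with h | h
  · left; simp; linarith
  · rcases hs.eq_or_lt with rfl | hs
    · right; simpa using h
    · left; simp [h.1, hs]

theorem mem_rightHalf_arg {x : ℂ} (hx : x ∈ rightHalf) :
    -(Real.pi / 2) < x.arg ∧ x.arg ≤ Real.pi / 2 := by
  have h1 : |x.arg| ≤ Real.pi / 2 := Complex.abs_arg_le_pi_div_two_iff.2 (rightHalf_re_nonneg hx)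
  refine ⟨?_, (abs_le.1 h1).2⟩
  rcases hx with h | h
  · exact (abs_lt.1 (Complex.abs_arg_lt_pi_div_two_iff.2 (Or.inl h))).1
  · have : 0 ≤ x.arg := Complex.arg_nonneg_iff.2 h.2.le
    have := Real.pi_pos
    linarith

theorem log_sq_div_two {x : ℂ} (hx : x ∈ rightHalf) :
    Complex.log (x ^ 2 / 2) = 2 * Complex.log x - Complex.log 2 := by
  have hx0 := rightHalf_ne_zero hx
  obtain ⟨h1, h2⟩ := mem_rightHalf_arg hx
  have hl2 : Complex.log 2 = (Real.log 2 : ℂ) := by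
    rw [show (2 : ℂ) = ((2 : ℝ) : ℂ) by norm_num, Complex.ofReal_log (by norm_num)]
  have e : x ^ 2 / 2 = Complex.exp (2 * Complex.log x - Complex.log 2) := by
    rw [Complex.exp_sub, two_mul, Complex.exp_add, Complex.exp_log hx0,
      Complex.exp_log (by norm_num)]; ring
  have him : (2 * Complex.log x - Complex.log 2).im = 2 * x.arg := by
    rw [hl2, Complex.sub_im, Complex.ofReal_im, sub_zero, Complex.mul_im, Complex.log_im]; simp
  rw [e, Complex.log_exp] <;> rw [him] <;> linarith

theorem sq_div_two_ne_zero {x : ℂ} (hx : x ∈ rightHalf) : x ^ 2 / 2 ≠ 0 :=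
  div_ne_zero (pow_ne_zero 2 (rightHalf_ne_zero hx)) two_ne_zero

theorem log_div_two {x : ℂ} (hx : x ≠ 0) : Complex.log (x / 2) = Complex.log x - Complex.log 2 := by
  have h := Complex.log_ofReal_mul (r := 1 / 2) (by norm_num) hx
  rw [show ((1 / 2 : ℝ) : ℂ) * x = x / 2 by push_cast; ring] at h
  rw [h, show (2 : ℂ) = ((2 : ℝ) : ℂ) by norm_num, ← Complex.ofReal_log (by norm_num : (0:ℝ) ≤ 2),
    Real.log_div one_ne_zero two_ne_zero, Real.log_one]
  push_cast; ring

theorem cpow_mul_half_cpow {x : ℂ} (hx : x ∈ rightHalf) (M : ℂ) :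
    x ^ M * (x / 2) ^ (M - 1) = x * (x ^ 2 / 2) ^ (M - 1) := by
  have hx0 := rightHalf_ne_zero hx
  have h2 : x / 2 ≠ 0 := div_ne_zero hx0 two_ne_zero
  conv_rhs => rw [← Complex.exp_log hx0]
  rw [Complex.cpow_def_of_ne_zero hx0, Complex.cpow_def_of_ne_zero h2, Complex.exp_log hx0,
    Complex.cpow_def_of_ne_zero (sq_div_two_ne_zero hx), log_sq_div_two hx, log_div_two hx0,
    ← Complex.exp_add]
  conv_rhs => lhs; rw [← Complex.exp_log hx0]
  rw [← Complex.exp_add]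
  congr 1; ring

theorem sqrt_mem_rightHalf {w : ℂ} (hw : w ≠ 0) : w ^ (1 / 2 : ℂ) ∈ rightHalf := by
  rw [Complex.cpow_def_of_ne_zero hw]
  have him : (Complex.log w * (1 / 2)).im = w.arg / 2 := by
    rw [show Complex.log w * (1 / 2) = ((1 / 2 : ℝ) : ℂ) * Complex.log w by push_cast; ring,
      Complex.im_ofReal_mul, Complex.log_im]; ring
  have h1 := Complex.neg_pi_lt_arg w
  have h2 := Complex.arg_le_pi w
  simp only [rightHalf, mem_ofPred_eq]
  rw [Complex.exp_re, Complex.exp_im, him]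
  rcases h2.eq_or_lt with h | h
  · right
    rw [h, Real.cos_pi_div_two, Real.sin_pi_div_two]
    exact ⟨by ring, by positivity⟩
  · left
    exact mul_pos (Real.exp_pos _) (Real.cos_pos_of_mem_Ioo ⟨by linarith, by linarith⟩)

theorem sqrt_sq (w : ℂ) : (w ^ (1 / 2 : ℂ)) ^ 2 = w := by
  have := Complex.cpow_nat_inv_pow w (n := 2) two_ne_zero
  rwa [show ((2 : ℕ) : ℂ)⁻¹ = 1 / 2 by norm_num] at this

/-- Continuity of `s ↦ ((x+s)²/2)^P` up to the endpoint, where the base may lie on the branch cut: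
it is approached from the side on which the principal value is continuous. -/
theorem continuousOn_sq_div_two_cpow {x : ℂ} (hx : x ∈ rightHalf) (P : ℂ) :
    ContinuousOn (fun s : ℝ => ((x + s) ^ 2 / 2) ^ P) (Ici 0) := by
  have h : ContinuousOn (fun s : ℝ =>
      Complex.exp ((2 * Complex.log (x + s) - Complex.log 2) * P)) (Ici 0) := by
    intro s hs
    have := rightHalf_subset_slitPlane (add_ofReal_mem_rightHalf hx hs)
    refine ContinuousAt.continuousWithinAt ?_
    have hl : ContinuousAt (fun s : ℝ => Complex.log (x + s)) s :=
      ContinuousAt.clog (by fun_prop) this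
    fun_prop
  refine h.congr fun s hs => ?_
  have := add_ofReal_mem_rightHalf hx hs
  simp only
  rw [Complex.cpow_def_of_ne_zero (sq_div_two_ne_zero this), log_sq_div_two this]

theorem sq_div_two_mem_slitPlane {x : ℂ} (hx : 0 < x.re) : x ^ 2 / 2 ∈ Complex.slitPlane := by
  have e : x ^ 2 / 2 = ((1 / 2 : ℝ) : ℂ) * (x * x) := by push_cast; ring
  rw [Complex.mem_slitPlane_iff, e, Complex.re_ofReal_mul, Complex.im_ofReal_mul, Complex.mul_re,
    Complex.mul_im]
  by_cases h : x.im = 0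
  · left; rw [h]; nlinarith [mul_pos hx hx]
  · right
    have : x.re * x.im ≠ 0 := mul_ne_zero hx.ne' h
    intro h'
    apply this
    linarith

/-- If `h = P H + u H'`, then `u^P H(u)` with `u = x²/2` is an antiderivative of
`x (x²/2)^(P-1) h(x²/2)` in the open right half-plane. -/
theorem hasDerivAt_sq_div_two_cpow_mul {P : ℂ} {H H' : ℂ → ℂ} (hH : ∀ u, HasDerivAt H (H' u) u)
    {x : ℂ} (hx : 0 < x.re) :
    HasDerivAt (fun x : ℂ => (x ^ 2 / 2) ^ P * H (x ^ 2 / 2))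
      (x * (x ^ 2 / 2) ^ (P - 1) * (P * H (x ^ 2 / 2) + x ^ 2 / 2 * H' (x ^ 2 / 2))) x := by
  have hu := sq_div_two_mem_slitPlane hx
  have hd : HasDerivAt (fun x : ℂ => x ^ 2 / 2) x x := by
    simpa using (hasDerivAt_pow 2 x).div_const 2
  have h1 := hd.cpow_const (c := P) hu
  have h2 := (hH (x ^ 2 / 2)).comp x hd
  refine (h1.mul h2).congr_deriv ?_
  have : (x ^ 2 / 2) ^ P = (x ^ 2 / 2) ^ (P - 1) * (x ^ 2 / 2) := by
    conv_lhs => rw [← sub_add_cancel P 1]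
    rw [Complex.cpow_add _ _ (Complex.slitPlane_ne_zero hu), Complex.cpow_one]
  simp only [Function.comp]
  rw [this]; ring

/-- Decay of the integrand of the Marcum function along horizontal rays, uniformly for starting
points in a bounded part of the closed right half-plane. -/
theorem exists_norm_sq_div_two_cpow_mul_le (P : ℝ) {h : ℂ → ℂ} {K : ℝ}
    (hK : ∀ u, ‖h u‖ ≤ K * Real.exp (-u.re + ‖u‖ / 4)) (R : ℝ) :
    ∃ K' : ℝ, ∀ x : ℂ, 0 ≤ x.re → ‖x‖ ≤ R → ∀ s : ℝ, 1 ≤ s →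
      ‖(x + s) * ((x + s) ^ 2 / 2) ^ (P : ℂ) * h ((x + s) ^ 2 / 2)‖ ≤ K' * Real.exp (-s) ∧
      ‖((x + s) ^ 2 / 2) ^ (P : ℂ) * h ((x + s) ^ 2 / 2)‖ ≤ K' * Real.exp (-s) := by
  have hK0 : 0 ≤ K := by
    have := (norm_nonneg _).trans (hK 0)
    exact nonneg_of_mul_nonneg_left this (Real.exp_pos _)
  set c : ℝ := 2 * |P| + 1
  refine ⟨K * Real.exp (R ^ 2 + c * R + |P| + (c + 1) ^ 2), fun x hx hxR s hs => ?_⟩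
  have hc : 0 ≤ c := by positivity
  have hR : 0 ≤ R := (norm_nonneg x).trans hxR
  set y : ℂ := x + s
  have hy1 : 1 ≤ ‖y‖ := by
    have h1 : y.re ≤ ‖y‖ := Complex.re_le_norm y
    have h2 : y.re = x.re + s := by simp [y]
    linarith
  have hy2 : ‖y‖ ≤ s + R := by
    calc ‖y‖ ≤ ‖x‖ + ‖(s : ℂ)‖ := norm_add_le _ _
      _ ≤ s + R := by rw [Complex.norm_real, Real.norm_of_nonneg (by linarith)]; linarith
  have hu : ‖y ^ 2 / 2‖ = ‖y‖ ^ 2 / 2 := by simp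
  have hpow : ‖(y ^ 2 / 2) ^ (P : ℂ)‖ ≤ Real.exp (2 * |P| * (s + R) + |P|) := by
    have hpos : 0 < ‖y‖ ^ 2 / 2 := by positivity
    rw [Complex.norm_cpow_real, hu, Real.rpow_def_of_pos hpos]
    refine Real.exp_le_exp.2 ?_
    have hlog : |Real.log (‖y‖ ^ 2 / 2)| ≤ 2 * (s + R) + 1 := by
      rw [Real.log_div (by positivity) two_ne_zero, Real.log_pow]
      have h1 := Real.log_le_sub_one_of_pos (by linarith : 0 < ‖y‖)
      have h2 := Real.log_nonneg hy1
      have h3 := Real.log_le_sub_one_of_pos (by norm_num : (0 : ℝ) < 2)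
      have h4 := Real.log_nonneg (by norm_num : (1 : ℝ) ≤ 2)
      rw [abs_le]
      push_cast
      constructor <;> linarith
    calc _ ≤ |Real.log (‖y‖ ^ 2 / 2) * P| := le_abs_self _
      _ = |P| * |Real.log (‖y‖ ^ 2 / 2)| := by rw [abs_mul, mul_comm]
      _ ≤ |P| * (2 * (s + R) + 1) := by gcongr
      _ = _ := by ring
  have hh : ‖h (y ^ 2 / 2)‖ ≤ K * Real.exp (-(s ^ 2 / 4) + R ^ 2) := by
    refine (hK _).trans (mul_le_mul_of_nonneg_left (Real.exp_le_exp.2 ?_) hK0)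
    rw [hu]
    have e1 : (y ^ 2 / 2).re = ((x.re + s) ^ 2 - x.im ^ 2) / 2 := by
      rw [show y ^ 2 / 2 = ((1 / 2 : ℝ) : ℂ) * (y * y) by push_cast; ring, Complex.re_ofReal_mul,
        Complex.mul_re]
      simp [y]; ring
    have e2 : ‖y‖ ^ 2 = (x.re + s) ^ 2 + x.im ^ 2 := by
      rw [Complex.sq_norm, Complex.normSq_apply]; simp [y]; ring
    have e3 : x.re ^ 2 + x.im ^ 2 ≤ R ^ 2 := by
      have : ‖x‖ ^ 2 = x.re ^ 2 + x.im ^ 2 := by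
        rw [Complex.sq_norm, Complex.normSq_apply]; ring
      rw [← this]; gcongr
    rw [e1, e2]
    nlinarith [mul_nonneg hx (by linarith : 0 ≤ s), sq_nonneg x.re, sq_nonneg x.im]
  have hyexp : ‖y‖ ≤ Real.exp (s + R) := by
    have := Real.add_one_le_exp (s + R)
    linarith
  have hbig : ‖y * (y ^ 2 / 2) ^ (P : ℂ) * h (y ^ 2 / 2)‖ ≤
      K * Real.exp (R ^ 2 + c * R + |P| + (c + 1) ^ 2) * Real.exp (-s) := by
    rw [norm_mul, norm_mul]
    calc _ ≤ Real.exp (s + R) * Real.exp (2 * |P| * (s + R) + |P|) *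
          (K * Real.exp (-(s ^ 2 / 4) + R ^ 2)) := by gcongr
      _ = K * Real.exp ((s + R) + (2 * |P| * (s + R) + |P|) + (-(s ^ 2 / 4) + R ^ 2)) := by
        rw [Real.exp_add (s + R + _), Real.exp_add (s + R)]; ring
      _ ≤ K * Real.exp ((R ^ 2 + c * R + |P| + (c + 1) ^ 2) + -s) := by
        refine mul_le_mul_of_nonneg_left (Real.exp_le_exp.2 ?_) hK0
        simp only [c]
        nlinarith [sq_nonneg (s / 2 - (2 * |P| + 1 + 1))]
      _ = _ := by rw [Real.exp_add]; ring
  refine ⟨hbig, le_trans ?_ hbig⟩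
  rw [mul_assoc, norm_mul y]
  exact le_mul_of_one_le_left (norm_nonneg _) hy1

theorem integrableOn_ray {P : ℝ} {h : ℂ → ℂ} (hh : Continuous h) {K : ℝ}
    (hK : ∀ u, ‖h u‖ ≤ K * Real.exp (-u.re + ‖u‖ / 4)) {x : ℂ}
    (hx : x ∈ rightHalf ∨ (x = 0 ∧ 0 < P)) :
    IntegrableOn (fun s : ℝ => (x + s) * ((x + s) ^ 2 / 2) ^ ((P : ℂ) - 1) *
      h ((x + s) ^ 2 / 2)) (Ioi 0) := by
  have hre : 0 ≤ x.re := by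
    rcases hx with h | h
    · exact rightHalf_re_nonneg h
    · rw [h.1]; simp
  have hpos : ∀ s : ℝ, 0 < s → 0 < (x + s).re := fun s hs => by simp; linarith
  set g : ℝ → ℂ := fun s => (x + s) * ((x + s) ^ 2 / 2) ^ ((P : ℂ) - 1) * h ((x + s) ^ 2 / 2)
  have hgc : ContinuousOn g (Ioi 0) := by
    intro s hs
    have hu := sq_div_two_mem_slitPlane (hpos s hs)
    refine ContinuousAt.continuousWithinAt ?_
    refine ContinuousAt.mul (ContinuousAt.mul (by fun_prop) ?_)
      (Continuous.continuousAt (by fun_prop))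
    exact ContinuousAt.cpow (by fun_prop) (by fun_prop) hu
  rw [← Ioc_union_Ioi_eq_Ioi (zero_le_one (α := ℝ))]
  refine IntegrableOn.union ?_ ?_
  · rcases hx with hx | ⟨rfl, hP⟩
    · have : ContinuousOn g (Icc 0 1) := by
        refine ContinuousOn.mul (ContinuousOn.mul (by fun_prop)
          ((continuousOn_sq_div_two_cpow hx _).mono Icc_subset_Ici_self))
          (Continuous.continuousOn (by fun_prop))
      exact (this.integrableOn_Icc).mono_set Ioc_subset_Icc_self
    · have hb : ContinuousOn (fun s : ℝ => h ((0 + s) ^ 2 / 2)) (Icc 0 1) :=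
        Continuous.continuousOn (by fun_prop)
      obtain ⟨B, hB⟩ := isCompact_Icc.exists_bound_of_continuousOn hb
      have hi : IntegrableOn (fun s : ℝ => s ^ (2 * P - 1)) (Ioc 0 1) :=
        (intervalIntegrable_iff_integrableOn_Ioc_of_le zero_le_one).1
          (intervalIntegral.intervalIntegrable_rpow' (by linarith))
      refine Integrable.mono' (hi.const_mul ((1 / 2) ^ (P - 1) * B))
        ((hgc.mono Ioc_subset_Ioi_self).aestronglyMeasurable measurableSet_Ioc) ?_
      filter_upwards [ae_restrict_mem measurableSet_Ioc] with s hs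
      have hs0 : 0 < s := hs.1
      have hn : ‖(0 + (s : ℂ)) * ((0 + (s : ℂ)) ^ 2 / 2) ^ ((P : ℂ) - 1)‖ =
          (1 / 2) ^ (P - 1) * s ^ (2 * P - 1) := by
        rw [zero_add, norm_mul, show (P : ℂ) - 1 = ((P - 1 : ℝ) : ℂ) by push_cast; rfl,
          Complex.norm_cpow_real, norm_div, norm_pow, Complex.norm_real,
          Real.norm_of_nonneg hs0.le, RCLike.norm_ofNat, div_eq_mul_one_div,
          Real.mul_rpow (by positivity) (by norm_num), ← Real.rpow_natCast_mul hs0.le]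
        push_cast
        rw [show 2 * P - 1 = 1 + 2 * (P - 1) by ring, Real.rpow_add hs0, Real.rpow_one]
        ring
      simp only [g]
      rw [norm_mul, hn]
      calc _ ≤ (1 / 2) ^ (P - 1) * s ^ (2 * P - 1) * B := by
            gcongr; exact hB s ⟨hs0.le, hs.2⟩
        _ = _ := by ring
  · obtain ⟨K', hK'⟩ := exists_norm_sq_div_two_cpow_mul_le (P - 1) hK ‖x‖
    have hi : IntegrableOn (fun s : ℝ => K' * Real.exp (-s)) (Ioi 1) :=
      (integrableOn_exp_neg_Ioi 1).const_mul K'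
    refine Integrable.mono' hi ((hgc.mono (Ioi_subset_Ioi zero_le_one)).aestronglyMeasurable
      measurableSet_Ioi) ?_
    filter_upwards [ae_restrict_mem measurableSet_Ioi] with s hs
    have := (hK' x hre le_rfl s (le_of_lt hs)).1
    push_cast at this
    exact this

/-- The fundamental theorem of calculus along a horizontal ray. -/
theorem integral_ray {P : ℝ} {H H' : ℂ → ℂ} (hH : ∀ u, HasDerivAt H (H' u) u)
    (hH' : Continuous H') {K : ℝ}
    (hK : ∀ u, ‖P * H u + u * H' u‖ ≤ K * Real.exp (-u.re + ‖u‖ / 4)) {x : ℂ}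
    (hx : x ∈ rightHalf ∨ (x = 0 ∧ 0 < P)) {L : ℂ}
    (hL : Tendsto (fun s : ℝ => ((x + s) ^ 2 / 2) ^ (P : ℂ) * H ((x + s) ^ 2 / 2)) atTop (𝓝 L)) :
    ∫ s in Ioi (0 : ℝ), (x + s) * ((x + s) ^ 2 / 2) ^ ((P : ℂ) - 1) *
        (P * H ((x + s) ^ 2 / 2) + (x + s) ^ 2 / 2 * H' ((x + s) ^ 2 / 2)) =
      L - (x ^ 2 / 2) ^ (P : ℂ) * H (x ^ 2 / 2) := by
  have hHc : Continuous H := continuous_iff_continuousAt.2 fun u => (hH u).continuousAt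
  have hre : 0 ≤ x.re := by
    rcases hx with h | h
    · exact rightHalf_re_nonneg h
    · rw [h.1]; simp
  have hpos : ∀ s : ℝ, 0 < s → 0 < (x + s).re := fun s hs => by simp; linarith
  set g : ℝ → ℂ := fun s => (x + s) * ((x + s) ^ 2 / 2) ^ ((P : ℂ) - 1) *
        (P * H ((x + s) ^ 2 / 2) + (x + s) ^ 2 / 2 * H' ((x + s) ^ 2 / 2))
  have hder : ∀ s ∈ Ioi (0 : ℝ), HasDerivAt
      (fun s : ℝ => ((x + s) ^ 2 / 2) ^ (P : ℂ) * H ((x + s) ^ 2 / 2)) (g s) s := by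
    intro s hs
    have h1 := hasDerivAt_sq_div_two_cpow_mul (P := (P : ℂ)) hH (hpos s hs)
    have h2 : HasDerivAt (fun z : ℂ => x + z) 1 (s : ℂ) := (hasDerivAt_id _).const_add x
    exact ((h1.comp (s : ℂ) h2).comp_ofReal).congr_deriv (mul_one _)
  have hcont : ContinuousWithinAt (fun s : ℝ => ((x + s) ^ 2 / 2) ^ (P : ℂ) *
      H ((x + s) ^ 2 / 2)) (Ici 0) 0 := by
    refine ContinuousWithinAt.mul ?_ (Continuous.continuousWithinAt (by fun_prop))
    rcases hx with h | ⟨rfl, hP⟩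
    · exact continuousOn_sq_div_two_cpow h P 0 self_mem_Ici
    · have h1 : ContinuousAt (fun r : ℝ => (r : ℂ) ^ (P : ℂ)) (0 ^ 2 / 2 : ℝ) :=
        Complex.continuousAt_ofReal_cpow_const _ _ (Or.inl (by simpa using hP))
      have h2 : ContinuousAt (fun s : ℝ => s ^ 2 / 2) 0 := by fun_prop
      have h3 := (ContinuousAt.comp (f := fun s : ℝ => s ^ 2 / 2) (x := (0 : ℝ)) h1 h2)
      refine h3.continuousWithinAt.congr (fun s _ => ?_) ?_ <;> simp
  have hint : IntegrableOn g (Ioi 0) :=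
    integrableOn_ray (h := fun u => P * H u + u * H' u) (by fun_prop) hK hx
  have := integral_Ioi_of_hasDerivAt_of_tendsto hcont hder hint hL
  simpa using this

/-! ### The Marcum function -/

theorem integrableOn_cpow_Ioc {P : ℝ} (hP : 0 < P) :
    IntegrableOn (fun τ : ℝ => (τ : ℂ) ^ ((P : ℂ) - 1)) (Ioc 0 1) :=
  (intervalIntegrable_iff_integrableOn_Ioc_of_le zero_le_one).1
    (intervalIntegral.intervalIntegrable_cpow' (by simpa using hP))

theorem integrableOn_cpow_mul_Ioc {P : ℝ} (hP : 0 < P) {g : ℝ → ℂ} (hg : Continuous g) :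
    IntegrableOn (fun τ : ℝ => (τ : ℂ) ^ ((P : ℂ) - 1) * g τ) (Ioc 0 1) := by
  obtain ⟨B, hB⟩ := isCompact_Icc.exists_bound_of_continuousOn (s := Icc (0 : ℝ) 1) hg.continuousOn
  refine Integrable.mono' ((integrableOn_cpow_Ioc hP).norm.mul_const B)
    ((integrableOn_cpow_Ioc hP).1.mul hg.aestronglyMeasurable) ?_
  filter_upwards [ae_restrict_mem measurableSet_Ioc] with τ hτ
  rw [norm_mul]
  gcongr
  exact hB τ ⟨hτ.1.le, hτ.2⟩

/-- The average `∫_0^1 τ^(P-1) h(uτ) dτ`; multiplied by `u^P` it is the integral of `v^(P-1) h(v)`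
along the segment from `0` to `u`. -/
noncomputable def powAvg (P : ℝ) (h : ℂ → ℂ) (u : ℂ) : ℂ :=
  ∫ τ in Ioc (0 : ℝ) 1, (τ : ℂ) ^ ((P : ℂ) - 1) * h (u * τ)

theorem hasDerivAt_powAvg {P : ℝ} (hP : 0 < P) {h : ℂ → ℂ} (hh : Differentiable ℂ h) (u : ℂ) :
    HasDerivAt (powAvg P h) (powAvg (P + 1) (deriv h) u) u := by
  have hc : Continuous h := hh.continuous
  have hc' : Continuous (deriv h) := hh.contDiff.continuous_deriv_one
  have hm := hasDerivAt_integral_mul_comp (m := volume.restrict (Ioc (0 : ℝ) 1))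
    (w := fun τ : ℝ => (τ : ℂ) ^ ((P : ℂ) - 1)) (φ := h) (φ' := deriv h)
    (fun z => (hh z).hasDerivAt) hc' (integrableOn_cpow_Ioc hP).1
    (fun x => integrableOn_cpow_mul_Ioc hP (g := fun τ : ℝ => h (x * τ)) (by fun_prop)) ?_ u
  · refine hm.congr_deriv ?_
    refine setIntegral_congr_fun measurableSet_Ioc fun τ hτ => ?_
    have : (τ : ℂ) ≠ 0 := by exact_mod_cast hτ.1.ne'
    rw [show ((P + 1 : ℝ) : ℂ) - 1 = ((P : ℂ) - 1) + 1 by push_cast; ring,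
      Complex.cpow_add _ _ this,
      Complex.cpow_one]
    ring
  · intro R _
    obtain ⟨B, hB⟩ := (isCompact_closedBall (0 : ℂ) R).exists_bound_of_continuousOn hc'.continuousOn
    refine ⟨fun τ => ‖(τ : ℂ) ^ ((P : ℂ) - 1)‖ * B, (integrableOn_cpow_Ioc hP).norm.mul_const B, ?_⟩
    filter_upwards [ae_restrict_mem measurableSet_Ioc] with τ hτ x hx
    have h1 : ‖(τ : ℂ)‖ ≤ 1 := by
      rw [Complex.norm_real, Real.norm_of_nonneg hτ.1.le]; exact hτ.2
    have h2 : ‖x * τ‖ ≤ R := by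
      rw [norm_mul]
      calc _ ≤ ‖x‖ * 1 := by gcongr
        _ ≤ R := by linarith
    have h3 := hB (x * τ) (by simpa using h2)
    rw [norm_mul, norm_mul]
    refine mul_le_mul_of_nonneg_left ?_ (norm_nonneg _)
    calc _ ≤ 1 * ‖deriv h (x * τ)‖ := by gcongr
      _ ≤ B := by rw [one_mul]; exact h3

theorem powAvg_add_mul_powAvg_deriv {P : ℝ} (hP : 0 < P) {h : ℂ → ℂ} (hh : Differentiable ℂ h)
    (u : ℂ) : P * powAvg P h u + u * powAvg (P + 1) (deriv h) u = h u := by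
  have hc : Continuous h := hh.continuous
  have hc' : Continuous (deriv h) := hh.contDiff.continuous_deriv_one
  have hP1 : 0 < P + 1 := by linarith
  have i1 := integrableOn_cpow_mul_Ioc hP (g := fun τ : ℝ => h (u * τ)) (by fun_prop)
  have i2 := integrableOn_cpow_mul_Ioc hP1 (g := fun τ : ℝ => deriv h (u * τ)) (by fun_prop)
  have hFTC := intervalIntegral.integral_eq_sub_of_hasDerivAt_of_le (a := 0) (b := 1)
    (f := fun τ : ℝ => (τ : ℂ) ^ (P : ℂ) * h (u * τ))
    (f' := fun τ : ℝ => P * ((τ : ℂ) ^ ((P : ℂ) - 1) * h (u * τ)) +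
      u * ((τ : ℂ) ^ (((P + 1 : ℝ) : ℂ) - 1) * deriv h (u * τ))) zero_le_one ?_ ?_ ?_
  · rw [intervalIntegral.integral_of_le zero_le_one,
      integral_add (i1.const_mul _) (i2.const_mul _), integral_const_mul,
      integral_const_mul] at hFTC
    have hP0 : (P : ℂ) ≠ 0 := by exact_mod_cast hP.ne'
    simp only [powAvg]
    rw [hFTC]
    simp [Complex.zero_cpow hP0]
  · refine Continuous.continuousOn (Continuous.mul ?_ (by fun_prop))
    exact Complex.continuous_ofReal_cpow_const (by simpa using hP)
  · intro τ hτ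
    have hτ' : (τ : ℂ) ∈ Complex.slitPlane := Or.inl (by simpa using hτ.1)
    have h1 : HasDerivAt (fun z : ℂ => z ^ (P : ℂ))
        ((P : ℂ) * (τ : ℂ) ^ ((P : ℂ) - 1)) (τ : ℂ) := by
      simpa using (hasDerivAt_id (τ : ℂ)).cpow_const (c := (P : ℂ)) hτ'
    have h2 : HasDerivAt (fun z : ℂ => u * z) u (τ : ℂ) := by
      simpa using (hasDerivAt_id (τ : ℂ)).const_mul u
    have h3 := (hh (u * τ)).hasDerivAt.comp (τ : ℂ) h2
    refine ((h1.mul h3).comp_ofReal).congr_deriv ?_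
    rw [show ((P + 1 : ℝ) : ℂ) - 1 = (P : ℂ) by push_cast; ring]
    simp only [Function.comp]
    ring
  · rw [intervalIntegrable_iff_integrableOn_Ioc_of_le zero_le_one]
    exact (i1.const_mul _).add (i2.const_mul _)

theorem cpow_mul_powAvg_of_pos {P v : ℝ} (hv : 0 < v) (h : ℂ → ℂ) :
    (v : ℂ) ^ (P : ℂ) * powAvg P h v = ∫ u in (0 : ℝ)..v, (u : ℂ) ^ ((P : ℂ) - 1) * h u := by
  have h1 := intervalIntegral.smul_integral_comp_mul_left (a := 0) (b := 1)
    (fun u : ℝ => (u : ℂ) ^ ((P : ℂ) - 1) * h u) v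
  rw [mul_zero, mul_one] at h1
  have hv0 : (v : ℂ) ≠ 0 := by exact_mod_cast hv.ne'
  rw [← h1, powAvg, ← intervalIntegral.integral_of_le zero_le_one,
    ← intervalIntegral.integral_const_mul, Complex.real_smul, ← intervalIntegral.integral_const_mul]
  refine intervalIntegral.integral_congr fun τ hτ => ?_
  rw [uIcc_of_le zero_le_one] at hτ
  rw [Complex.ofReal_mul, Complex.mul_cpow_ofReal_nonneg hv.le hτ.1]
  conv_lhs => rw [← sub_add_cancel (P : ℂ) 1]
  rw [Complex.cpow_add _ _ hv0, Complex.cpow_one, add_sub_cancel_right]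
  ring

theorem tendsto_mul_exp_neg (K : ℝ) : Tendsto (fun s : ℝ => K * Real.exp (-s)) atTop (𝓝 0) := by
  simpa using (Real.tendsto_exp_neg_atTop_nhds_zero).const_mul K

theorem integrableOn_cpow_mul_of_norm_le {P : ℝ} (hP : 0 < P) {h : ℂ → ℂ} (hc : Continuous h)
    {K : ℝ} (hK : ∀ u, ‖h u‖ ≤ K * Real.exp (-u.re + ‖u‖ / 4)) :
    IntegrableOn (fun u : ℝ => (u : ℂ) ^ ((P : ℂ) - 1) * h u) (Ioi 0) := by
  have := integrableOn_expPow_mul (s := 1 / 2) (N := P - 1) (δ := 0) (K := K) (by linarith)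
    (by norm_num) (g := fun u : ℝ => Complex.exp (((1 / 2 : ℝ) : ℂ) * u) * h u)
    (Continuous.continuousOn (by fun_prop)) (fun t ht => ?_)
  · refine this.congr_fun (fun u _ => ?_) measurableSet_Ioi
    simp only [expPow]
    rw [show ∀ a b c d : ℂ, a * b * (c * d) = (a * c) * (b * d) by intros; ring, ← Complex.exp_add,
      show -((1 / 2 : ℝ) : ℂ) * u + ((1 / 2 : ℝ) : ℂ) * u = 0 by ring, Complex.exp_zero, one_mul]
    push_cast
    rfl
  · have hK0 : 0 ≤ K := nonneg_of_mul_nonneg_left ((norm_nonneg _).trans (hK 0)) (Real.exp_pos _)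
    rw [norm_mul, Complex.norm_exp]
    have h1 : (((1 / 2 : ℝ) : ℂ) * t).re = t / 2 := by
      rw [← Complex.ofReal_mul, Complex.ofReal_re]; ring
    have h2 := hK t
    rw [Complex.ofReal_re, Complex.norm_real, Real.norm_of_nonneg ht.le] at h2
    rw [h1]
    calc _ ≤ Real.exp (t / 2) * (K * Real.exp (-t + t / 4)) := by gcongr
      _ = K * Real.exp (t / 2 + (-t + t / 4)) := by rw [Real.exp_add (t / 2)]; ring
      _ ≤ K * Real.exp (0 * t) := by gcongr; linarith

/-- Deformation of the horizontal ray from `x` into the segment from `u = x²/2` to `0` followed by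
the positive real axis.  Along the ray the antiderivative `u^P ∫_0^1 τ^(P-1) h(uτ) dτ` has the same
limit as along the real axis, because the integrand is small far to the right. -/
theorem integral_ray_eq {P : ℝ} (hP : 0 < P) {h : ℂ → ℂ} (hh : Differentiable ℂ h) {K : ℝ}
    (hK : ∀ u, ‖h u‖ ≤ K * Real.exp (-u.re + ‖u‖ / 4)) {x : ℂ} (hx : x ∈ rightHalf ∨ x = 0) :
    ∫ s in Ioi (0 : ℝ), (x + s) * ((x + s) ^ 2 / 2) ^ ((P : ℂ) - 1) * h ((x + s) ^ 2 / 2) =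
      (∫ u in Ioi (0 : ℝ), (u : ℂ) ^ ((P : ℂ) - 1) * h u) -
        (x ^ 2 / 2) ^ (P : ℂ) * powAvg P h (x ^ 2 / 2) := by
  have hre : 0 ≤ x.re := by
    rcases hx with h | h
    · exact rightHalf_re_nonneg h
    · rw [h]; simp
  have hP1 : 0 < P + 1 := by linarith
  have hd : Differentiable ℂ (deriv h) :=
    (hh.contDiff (n := 2)).differentiable_deriv_two
  have hH := hasDerivAt_powAvg hP hh
  have hHc' : Continuous (powAvg (P + 1) (deriv h)) :=
    continuous_iff_continuousAt.2 fun u => (hasDerivAt_powAvg hP1 hd u).continuousAt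
  have hPH := powAvg_add_mul_powAvg_deriv hP hh
  set J : ℂ := ∫ u in Ioi (0 : ℝ), (u : ℂ) ^ ((P : ℂ) - 1) * h u
  set Φ : ℂ → ℂ := fun z => (z ^ 2 / 2) ^ (P : ℂ) * powAvg P h (z ^ 2 / 2)
  have hreal : Tendsto (fun r : ℝ => Φ r) atTop (𝓝 J) := by
    have h1 : Tendsto (fun r : ℝ => r ^ 2 / 2) atTop atTop :=
      (tendsto_pow_atTop two_ne_zero).atTop_div_const (by norm_num)
    have h2 := intervalIntegral_tendsto_integral_Ioi 0
      (integrableOn_cpow_mul_of_norm_le hP hh.continuous hK) h1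
    refine h2.congr' ?_
    filter_upwards [eventually_gt_atTop 0] with r hr
    rw [← cpow_mul_powAvg_of_pos (by positivity : 0 < r ^ 2 / 2)]
    simp [Φ]
  have hL : Tendsto (fun s : ℝ => Φ (x + s)) atTop (𝓝 J) := by
    obtain ⟨K', hK'⟩ := exists_norm_sq_div_two_cpow_mul_le (P - 1) hK ‖x‖
    have hdiff : Tendsto (fun s : ℝ => Φ (x + s) - Φ ((s + x.re : ℝ) : ℂ)) atTop (𝓝 0) := by
      have hz := tendsto_mul_exp_neg (K' * |x.im|)
      refine squeeze_zero_norm' ?_ hz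
      filter_upwards [eventually_ge_atTop 1] with s hs
      have hseg : ∀ θ : ℝ, θ ∈ Icc (0 : ℝ) 1 →
          0 ≤ ((x.re : ℂ) + θ * x.im * Complex.I).re ∧
          ‖(x.re : ℂ) + θ * x.im * Complex.I‖ ≤ ‖x‖ := by
        intro θ hθ
        constructor
        · simpa using hre
        · rw [← sq_le_sq₀ (norm_nonneg _) (norm_nonneg _), Complex.sq_norm, Complex.sq_norm,
            Complex.normSq_apply, Complex.normSq_apply]
          simp
          nlinarith [sq_nonneg x.im, mul_nonneg hθ.1 (sq_nonneg x.im), hθ.1, hθ.2,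
            mul_nonneg (mul_nonneg hθ.1 (sub_nonneg.2 hθ.2)) (sq_nonneg x.im),
            mul_nonneg (sub_nonneg.2 hθ.2) (sq_nonneg x.im)]
      have hmv := norm_image_sub_le_of_norm_deriv_le_segment_01'
        (f := fun θ : ℝ => Φ ((x.re : ℂ) + θ * x.im * Complex.I + s))
        (f' := fun θ : ℝ => (((x.re : ℂ) + θ * x.im * Complex.I + s) *
          (((x.re : ℂ) + θ * x.im * Complex.I + s) ^ 2 / 2) ^ ((P : ℂ) - 1) *
          h (((x.re : ℂ) + θ * x.im * Complex.I + s) ^ 2 / 2)) * (x.im * Complex.I))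
        (C := K' * |x.im| * Real.exp (-s)) ?_ ?_
      · have e1 : (x.re : ℂ) + (1 : ℝ) * x.im * Complex.I + s = x + s := by
          rw [Complex.ofReal_one, one_mul, Complex.re_add_im]
        have e0 : (x.re : ℂ) + (0 : ℝ) * x.im * Complex.I + s = ((s + x.re : ℝ) : ℂ) := by
          push_cast; ring
        rw [e1, e0] at hmv
        exact hmv
      · intro θ hθ
        have hp : 0 < ((x.re : ℂ) + θ * x.im * Complex.I + s).re := by
          have := (hseg θ hθ).1
          rw [Complex.add_re, Complex.ofReal_re]
          linarith
        have h1 := hasDerivAt_sq_div_two_cpow_mul (P := (P : ℂ)) hH hp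
        rw [hPH] at h1
        have h2 : HasDerivAt (fun z : ℂ => (x.re : ℂ) + z * x.im * Complex.I + s)
            (x.im * Complex.I) (θ : ℂ) := by
          simpa using ((((hasDerivAt_id (θ : ℂ)).mul_const (x.im : ℂ)).mul_const
            Complex.I).const_add (x.re : ℂ)).add_const (s : ℂ)
        exact (h1.comp (θ : ℂ) h2).comp_ofReal.hasDerivWithinAt
      · intro θ hθ
        obtain ⟨h1, h2⟩ := hseg θ (Ico_subset_Icc_self hθ)
        have h3 := (hK' _ h1 h2 s hs).1
        push_cast at h3
        rw [norm_mul, norm_mul (x.im : ℂ), Complex.norm_I, mul_one, Complex.norm_real,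
          Real.norm_eq_abs]
        calc _ ≤ K' * Real.exp (-s) * |x.im| := by gcongr
          _ = _ := by ring
    have h2 : Tendsto (fun s : ℝ => Φ ((s + x.re : ℝ) : ℂ)) atTop (𝓝 J) :=
      hreal.comp (tendsto_atTop_add_const_right _ _ tendsto_id)
    simpa using hdiff.add h2
  have key := integral_ray (P := P) hH hHc' (K := K) (by simpa only [hPH] using hK)
    (x := x) (hx.imp id fun h => ⟨h, hP⟩) hL
  simp only [hPH] at key
  exact key

theorem exists_norm_exp_neg_mul_cliffordF_le (ν : ℝ) (a : ℂ) {ε : ℝ} (hε : 0 < ε) :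
    ∃ K : ℝ, 0 < K ∧ ∀ u : ℂ, ‖Complex.exp (-u) * cliffordF ν (a * u)‖ ≤
      K * Real.exp (-u.re + ε * ‖u‖) := by
  obtain ⟨K, hK, h⟩ := exists_norm_cliffordF_le ν (ε := ε / (‖a‖ + 1)) (by positivity)
  refine ⟨K, hK, fun u => ?_⟩
  rw [norm_mul, Complex.norm_exp, Complex.neg_re, Real.exp_add]
  have h1 : ε / (‖a‖ + 1) * ‖a * u‖ ≤ ε * ‖u‖ := by
    rw [norm_mul]
    calc _ = ε * ‖u‖ * (‖a‖ / (‖a‖ + 1)) := by field_simp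
      _ ≤ ε * ‖u‖ * 1 := by
        gcongr
        rw [div_le_one (by positivity)]; linarith
      _ = _ := mul_one _
  calc _ ≤ Real.exp (-u.re) * (K * Real.exp (ε * ‖u‖)) := by
        gcongr
        exact (h _).trans (by gcongr)
    _ = _ := by ring

theorem exists_norm_exp_neg_mul_cliffordF_le_quarter (ν : ℝ) (a : ℂ) :
    ∃ K : ℝ, 0 < K ∧ ∀ u : ℂ, ‖Complex.exp (-u) * cliffordF ν (a * u)‖ ≤
      K * Real.exp (-u.re + ‖u‖ / 4) := by
  obtain ⟨K, hK, h⟩ := exists_norm_exp_neg_mul_cliffordF_le ν a (ε := 1 / 4) (by norm_num)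
  refine ⟨K, hK, fun u => (h u).trans (le_of_eq ?_)⟩
  ring_nf

theorem exists_norm_mul_exp_neg_mul_cliffordF_le_quarter (ν : ℝ) (a : ℂ) :
    ∃ K : ℝ, 0 < K ∧ ∀ u : ℂ, ‖u * (Complex.exp (-u) * cliffordF ν (a * u))‖ ≤
      K * Real.exp (-u.re + ‖u‖ / 4) := by
  obtain ⟨K, hK, h⟩ := exists_norm_exp_neg_mul_cliffordF_le ν a (ε := 1 / 8) (by norm_num)
  refine ⟨8 * K, by positivity, fun u => ?_⟩
  rw [norm_mul]
  have h1 : ‖u‖ ≤ 8 * Real.exp (‖u‖ / 8) := by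
    have := Real.add_one_le_exp (‖u‖ / 8)
    linarith
  calc _ ≤ (8 * Real.exp (‖u‖ / 8)) * (K * Real.exp (-u.re + 1 / 8 * ‖u‖)) := by
        gcongr; exact h u
    _ = 8 * K * Real.exp (‖u‖ / 8 + (-u.re + 1 / 8 * ‖u‖)) := by rw [Real.exp_add (‖u‖ / 8)]; ring
    _ = _ := by ring_nf

theorem sqrt_mem_rightHalf_or (w : ℂ) : w ^ (1 / 2 : ℂ) ∈ rightHalf ∨ w ^ (1 / 2 : ℂ) = 0 := by
  by_cases hw : w = 0
  · right; rw [hw, Complex.zero_cpow (by norm_num)]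
  · exact Or.inl (sqrt_mem_rightHalf hw)

/-- The Marcum function in terms of `a = α²/2` and the variable `u = x²/2`. -/
theorem marcumQ_eq_ray (M : ℝ) {α β a : ℂ} (hα : α ^ 2 = 2 * a) :
    marcumQ M α β = Complex.exp (-a) * ∫ s in Ioi (0 : ℝ),
      ((β ^ 2) ^ (1 / 2 : ℂ) + s) * (((β ^ 2) ^ (1 / 2 : ℂ) + s) ^ 2 / 2) ^ ((M : ℂ) - 1) *
        (Complex.exp (-(((β ^ 2) ^ (1 / 2 : ℂ) + s) ^ 2 / 2)) *
          cliffordF (M - 1) (a * (((β ^ 2) ^ (1 / 2 : ℂ) + s) ^ 2 / 2))) := by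
  rw [marcumQ, ← integral_const_mul]
  refine setIntegral_congr_fun measurableSet_Ioi fun s hs => ?_
  set x : ℂ := (β ^ 2) ^ (1 / 2 : ℂ) + s with hxdef
  have hx : x ∈ rightHalf := by
    rcases sqrt_mem_rightHalf_or (β ^ 2) with h | h
    · exact add_ofReal_mem_rightHalf h (mem_Ioi.1 hs).le
    · rw [hxdef, h]; left; simpa using hs
  simp only
  rw [besselE_eq_cliffordF, show (α * x) ^ 2 / 4 = a * (x ^ 2 / 2) by rw [mul_pow, hα]; ring, hα,
    show -(2 * a + x ^ 2) / 2 = -a + -(x ^ 2 / 2) by ring, Complex.exp_add]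
  linear_combination (Complex.exp (-a) * Complex.exp (-(x ^ 2 / 2)) *
    cliffordF (M - 1) (a * (x ^ 2 / 2))) * cpow_mul_half_cpow hx M

theorem differentiable_exp_neg_mul_cliffordF (ν : ℝ) (a : ℂ) :
    Differentiable ℂ fun u : ℂ => Complex.exp (-u) * cliffordF ν (a * u) := by
  have := differentiable_cliffordF ν
  fun_prop

/-- For positive order, `1 - Q_M` is an integral over the finite segment from `0` to `b = β²/2`. -/
theorem marcumQ_of_pos {M : ℝ} (hM : 0 < M) {α β a b : ℂ} (hα : α ^ 2 = 2 * a)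
    (hβ : β ^ 2 = 2 * b) :
    marcumQ M α β = 1 - Complex.exp (-a) * (b ^ (M : ℂ) * ∫ τ in Ioc (0 : ℝ) 1,
      (τ : ℂ) ^ ((M : ℂ) - 1) * (Complex.exp (-(b * τ)) * cliffordF (M - 1) (a * (b * τ)))) := by
  obtain ⟨K, -, hK⟩ := exists_norm_exp_neg_mul_cliffordF_le_quarter (M - 1) a
  have h := integral_ray_eq hM (differentiable_exp_neg_mul_cliffordF (M - 1) a) hK
    (sqrt_mem_rightHalf_or (β ^ 2))
  have hJ : ∫ u in Ioi (0 : ℝ), (u : ℂ) ^ ((M : ℂ) - 1) *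
      (Complex.exp (-u) * cliffordF (M - 1) (a * u)) = Complex.exp a := by
    have h1 := integral_expPow_mul_cliffordF (s := 1) (N := M - 1) one_pos (by linarith) a
    rw [Complex.ofReal_one, Complex.one_cpow, one_mul, div_one] at h1
    rw [← h1]
    refine setIntegral_congr_fun measurableSet_Ioi fun u _ => ?_
    simp only [expPow]
    push_cast
    ring_nf
  rw [marcumQ_eq_ray M hα, h, hJ, sqrt_sq, hβ, mul_div_cancel_left₀ _ two_ne_zero, mul_sub,
    ← Complex.exp_add, neg_add_cancel, Complex.exp_zero]
  rfl

theorem integral_exp_neg_mul_cliffordF (m : ℕ) (a : ℂ) :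
    ∫ u in Ioi (0 : ℝ), Complex.exp (-(u : ℂ)) * cliffordF (m + 1) (a * u) =
      ((m.factorial : ℂ))⁻¹ * ∫ τ in Ioc (0 : ℝ) 1, (1 - (τ : ℂ)) ^ m * Complex.exp (a * τ) := by
  have hm : (m.factorial : ℂ) ≠ 0 := by exact_mod_cast m.factorial_ne_zero
  have hw := integrableOn_expPow_mul_cliffordF_mul_exp (s := 1) (N := 0) (δ := 1 / 2) (by norm_num)
    (by norm_num) 0 0
  obtain ⟨K, hK, hb⟩ := exists_norm_cliffordF_mul_le 0 (ε := 1 / 2) (by norm_num)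
    (R := ‖a‖ + 1) (by positivity)
  have hswap := (integral_mul_intervalIntegral_swap (ω := fun τ : ℝ => (1 - (τ : ℂ)) ^ m)
    (κ := fun t τ => cliffordF 0 (a * (τ * t))) (K := K) hw
    ((Continuous.integrableOn_Icc (by fun_prop)).mono_set Ioc_subset_Icc_self)
    (by unfold Function.uncurry; fun_prop) ?_).2
  · have hl : ∫ u in Ioi (0 : ℝ), Complex.exp (-(u : ℂ)) * cliffordF (m + 1) (a * u) =
        (m.factorial : ℂ)⁻¹ * ∫ t in Ioi (0 : ℝ), expPow 1 0 t * cliffordF 0 (0 * t) *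
          ∫ τ in Ioc (0 : ℝ) 1, (1 - (τ : ℂ)) ^ m * cliffordF 0 (a * (τ * t)) := by
      rw [← integral_const_mul]
      refine setIntegral_congr_fun measurableSet_Ioi fun t _ => ?_
      have h1 := integral_beta_mul_cliffordF (μ := 1) one_pos m (a * t)
      have h2 : ∫ τ in Ioc (0 : ℝ) 1, (1 - (τ : ℂ)) ^ m * cliffordF 0 (a * (τ * t)) =
          (m.factorial : ℂ) * cliffordF (m + 1) (a * t) := by
        rw [add_comm (m : ℝ) 1, ← h1]
        refine setIntegral_congr_fun measurableSet_Ioc fun τ _ => ?_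
        simp only [Complex.ofReal_one, sub_self, Complex.cpow_zero, one_mul]
        ring_nf
      rw [h2, zero_mul, cliffordF_zero]
      simp [expPow]
      field_simp
    rw [hl, hswap]
    congr 1
    refine setIntegral_congr_fun measurableSet_Ioc fun τ _ => ?_
    have h3 := integral_weber (s := 1) (N := 0) one_pos (by norm_num) 0 (a * τ)
    simp only [mul_assoc] at h3 ⊢
    simp only [mul_comm (τ : ℂ)]  at h3 ⊢
    rw [h3]
    simp [cliffordF_zero]
  · intro t τ ht h0 h1
    rw [← mul_assoc]
    refine hb _ ?_ t ht.le
    rw [norm_mul, Complex.norm_real, Real.norm_of_nonneg h0.le]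
    nlinarith [norm_nonneg a]

/-- The Marcum function of order `-m`, in which `u^(-m-1) F_{-m-1}(au) = a^(m+1) F_{m+1}(au)`. -/
theorem marcumQ_neg_natCast (m : ℕ) {α β a b : ℂ} (hα : α ^ 2 = 2 * a) (hβ : β ^ 2 = 2 * b) :
    marcumQ (-(m : ℝ)) α β = Complex.exp (-a) * a ^ (m + 1) *
      (((m.factorial : ℂ))⁻¹ * (∫ τ in Ioc (0 : ℝ) 1, (1 - (τ : ℂ)) ^ m * Complex.exp (a * τ)) -
        b * ∫ τ in Ioc (0 : ℝ) 1, Complex.exp (-(b * τ)) * cliffordF (m + 1) (a * (b * τ))) := by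
  obtain ⟨K, -, hK⟩ := exists_norm_exp_neg_mul_cliffordF_le_quarter (m + 1) a
  have h := integral_ray_eq one_pos (differentiable_exp_neg_mul_cliffordF (m + 1) a) hK
    (sqrt_mem_rightHalf_or (β ^ 2))
  simp only [powAvg, Complex.ofReal_one, sub_self, Complex.cpow_zero, one_mul, mul_one,
    Complex.cpow_one] at h
  rw [integral_exp_neg_mul_cliffordF, sqrt_sq, hβ, mul_div_cancel_left₀ _ two_ne_zero] at h
  rw [marcumQ_eq_ray _ hα, mul_assoc, ← h, ← integral_const_mul (a ^ (m + 1))]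
  refine congrArg (fun I => Complex.exp (-a) * I)
    (setIntegral_congr_fun measurableSet_Ioi fun s hs => ?_)
  rw [← hβ]
  set x : ℂ := (β ^ 2) ^ (1 / 2 : ℂ) + s with hxdef
  have hx : x ∈ rightHalf := by
    rcases sqrt_mem_rightHalf_or (β ^ 2) with h | h
    · exact add_ofReal_mem_rightHalf h (mem_Ioi.1 hs).le
    · rw [hxdef, h]; left; simpa using hs
  have hu := sq_div_two_ne_zero hx
  have e1 : -(m : ℝ) - 1 = -((m + 1 : ℕ) : ℝ) := by push_cast; ring
  have e2 : ((-(m : ℝ) : ℝ) : ℂ) - 1 = -((m + 1 : ℕ) : ℂ) := by push_cast; ring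
  rw [e1, e2, cliffordF_neg_natCast, Complex.cpow_neg, Complex.cpow_natCast, mul_pow]
  push_cast
  generalize cliffordF (m + 1) (a * (x ^ 2 / 2)) = F
  field_simp

/-- The recurrence `Q_{M+1} - Q_M = e^{-a-b} b^M F_M(ab)` away from the singularity `b = 0`. -/
theorem marcumQ_add_one_sub_of_ne_zero (M : ℝ) {α β a b : ℂ} (hα : α ^ 2 = 2 * a)
    (hβ : β ^ 2 = 2 * b) (hb : b ≠ 0) :
    marcumQ (M + 1) α β - marcumQ M α β =
      Complex.exp (-a - b) * b ^ (M : ℂ) * cliffordF M (a * b) := by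
  have hx : (β ^ 2) ^ (1 / 2 : ℂ) ∈ rightHalf :=
    sqrt_mem_rightHalf (by rw [hβ]; exact mul_ne_zero two_ne_zero hb)
  have hx2 : ((β ^ 2) ^ (1 / 2 : ℂ)) ^ 2 / 2 = b := by
    rw [sqrt_sq, hβ, mul_div_cancel_left₀ _ two_ne_zero]
  rw [marcumQ_eq_ray M hα, marcumQ_eq_ray (M + 1) hα]
  set x : ℂ := (β ^ 2) ^ (1 / 2 : ℂ)
  obtain ⟨K₁, hK₁, h₁⟩ := exists_norm_exp_neg_mul_cliffordF_le_quarter (M - 1) a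
  obtain ⟨K₂, hK₂, h₂⟩ := exists_norm_exp_neg_mul_cliffordF_le_quarter M a
  obtain ⟨K₃, hK₃, h₃⟩ := exists_norm_mul_exp_neg_mul_cliffordF_le_quarter M a
  have i1 := integrableOn_ray (P := M) (differentiable_exp_neg_mul_cliffordF (M - 1) a).continuous
    h₁ (Or.inl hx)
  have i2 := integrableOn_ray (P := M + 1) (differentiable_exp_neg_mul_cliffordF M a).continuous
    h₂ (Or.inl hx)
  have hH : ∀ u, HasDerivAt (fun u : ℂ => Complex.exp (-u) * cliffordF M (a * u))
      (Complex.exp (-u) * (-1) * cliffordF M (a * u) +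
        Complex.exp (-u) * (cliffordF (M + 1) (a * u) * a)) u := by
    intro u
    have d1 : HasDerivAt (fun u : ℂ => Complex.exp (-u)) (Complex.exp (-u) * (-1)) u :=
      (hasDerivAt_id u).neg.cexp
    have d2 : HasDerivAt (fun u : ℂ => a * u) a u := by
      simpa using (hasDerivAt_id u).const_mul a
    exact d1.mul ((hasDerivAt_cliffordF M (a * u)).comp u d2)
  have hPH : ∀ u : ℂ, M * (Complex.exp (-u) * cliffordF M (a * u)) +
      u * (Complex.exp (-u) * (-1) * cliffordF M (a * u) +
        Complex.exp (-u) * (cliffordF (M + 1) (a * u) * a)) =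
      Complex.exp (-u) * cliffordF (M - 1) (a * u) -
        u * (Complex.exp (-u) * cliffordF M (a * u)) := by
    intro u
    rw [cliffordF_sub_one M (a * u)]; ring
  have hlim : Tendsto (fun s : ℝ => ((x + s) ^ 2 / 2) ^ (M : ℂ) *
      (Complex.exp (-((x + s) ^ 2 / 2)) * cliffordF M (a * ((x + s) ^ 2 / 2)))) atTop (𝓝 0) := by
    obtain ⟨K', hK'⟩ := exists_norm_sq_div_two_cpow_mul_le M h₂ ‖x‖
    refine squeeze_zero_norm' ?_ (tendsto_mul_exp_neg K')
    filter_upwards [eventually_ge_atTop 1] with s hs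
    exact (hK' x (rightHalf_re_nonneg hx) le_rfl s hs).2
  have key := integral_ray (P := M) hH (by fun_prop) (K := K₁ + K₃) (fun u => by
    rw [hPH, add_mul]
    exact (norm_sub_le _ _).trans (add_le_add (h₁ u) (h₃ u))) (Or.inl hx) hlim
  rw [hx2] at key
  have hsplit : (∫ s in Ioi (0 : ℝ), (x + s) * ((x + s) ^ 2 / 2) ^ ((M : ℂ) - 1) *
      (Complex.exp (-((x + s) ^ 2 / 2)) * cliffordF (M - 1) (a * ((x + s) ^ 2 / 2)))) -
      (∫ s in Ioi (0 : ℝ), (x + s) * ((x + s) ^ 2 / 2) ^ (((M + 1 : ℝ) : ℂ) - 1) *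
      (Complex.exp (-((x + s) ^ 2 / 2)) * cliffordF M (a * ((x + s) ^ 2 / 2)))) =
      0 - b ^ (M : ℂ) * (Complex.exp (-b) * cliffordF M (a * b)) := by
    rw [← key, ← integral_sub i1 i2]
    refine setIntegral_congr_fun measurableSet_Ioi fun s hs => ?_
    have hu := sq_div_two_ne_zero (add_ofReal_mem_rightHalf hx (mem_Ioi.1 hs).le)
    simp only [hPH]
    rw [show ((M + 1 : ℝ) : ℂ) - 1 = ((M : ℂ) - 1) + 1 by push_cast; ring, Complex.cpow_add _ _ hu,
      Complex.cpow_one]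
    ring
  rw [add_sub_cancel_right M 1, sub_eq_add_neg (-a) b, Complex.exp_add]
  linear_combination (-Complex.exp (-a)) * hsplit

theorem marcumQ_one_sub_zero_of_eq_zero {α β a : ℂ} (hα : α ^ 2 = 2 * a) (hβ : β = 0) :
    marcumQ 1 α β - marcumQ 0 α β = Complex.exp (-a) := by
  have hβ2 : β ^ 2 = 2 * 0 := by rw [hβ]; ring
  have h1 := marcumQ_of_pos one_pos hα hβ2
  have h0 := marcumQ_neg_natCast 0 hα hβ2
  have hI : a * ∫ τ in Ioc (0 : ℝ) 1, Complex.exp (a * τ) = Complex.exp a - 1 := by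
    rcases eq_or_ne a 0 with rfl | ha
    · simp
    · rw [← intervalIntegral.integral_of_le zero_le_one, integral_exp_mul_complex ha]
      field_simp
      simp
  simp only [Nat.cast_zero, neg_zero, Nat.factorial_zero, Nat.cast_one, inv_one, one_mul, pow_zero,
    zero_mul, sub_zero, zero_add, pow_one] at h0
  rw [h1, h0, mul_assoc, hI, mul_sub, ← Complex.exp_add]
  simp

theorem marcumQ_add_one_sub (M : ℝ) {α β a b : ℂ} (hα : α ^ 2 = 2 * a) (hβ : β ^ 2 = 2 * b)
    (hb : b ≠ 0 ∨ 0 ≤ M) :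
    marcumQ (M + 1) α β - marcumQ M α β =
      Complex.exp (-a - b) * b ^ (M : ℂ) * cliffordF M (a * b) := by
  by_cases hb0 : b = 0
  · have hM : 0 ≤ M := hb.resolve_left (by simpa using hb0)
    have hβ0 : β = 0 := by
      have : β ^ 2 = 0 := by rw [hβ, hb0, mul_zero]
      exact pow_eq_zero_iff two_ne_zero |>.1 this
    subst hb0
    rcases hM.eq_or_lt with rfl | hM
    · rw [zero_add, marcumQ_one_sub_zero_of_eq_zero hα hβ0]
      simp [cliffordF_zero]
    · have h1 : ((M + 1 : ℝ) : ℂ) ≠ 0 := by rw [Ne, Complex.ofReal_eq_zero]; linarith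
      have h2 : (M : ℂ) ≠ 0 := by rw [Ne, Complex.ofReal_eq_zero]; linarith
      rw [marcumQ_of_pos hM hα hβ, marcumQ_of_pos (by linarith : 0 < M + 1) hα hβ,
        Complex.zero_cpow h1, Complex.zero_cpow h2]
      ring
  · exact marcumQ_add_one_sub_of_ne_zero M hα hβ hb0

theorem marcumQ_add_natCast (M : ℝ) {α β a b : ℂ} (hα : α ^ 2 = 2 * a) (hβ : β ^ 2 = 2 * b)
    (hb : b ≠ 0 ∨ 0 ≤ M) (n : ℕ) :
    marcumQ (M + n) α β = marcumQ M α β + ∑ k ∈ Finset.range n,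
      Complex.exp (-a - b) * b ^ ((M + k : ℝ) : ℂ) * cliffordF (M + k) (a * b) := by
  induction n with
  | zero => simp
  | succ n ih =>
    have h := marcumQ_add_one_sub (M + n) hα hβ
      (hb.imp id fun h => add_nonneg h n.cast_nonneg)
    rw [Finset.sum_range_succ, ← add_assoc, ← ih, ← h]
    push_cast
    rw [← add_assoc]; ring

/-! ### The transform for equal orders -/

theorem ofReal_mul_cpow {r : ℝ} (hr : 0 < r) (z w : ℂ) :
    ((r : ℂ) * z) ^ w = (r : ℂ) ^ w * z ^ w := by
  have hr' : (r : ℂ) ≠ 0 := by exact_mod_cast hr.ne'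
  rcases eq_or_ne z 0 with rfl | hz
  · rcases eq_or_ne w 0 with rfl | hw
    · simp
    · rw [mul_zero, Complex.zero_cpow hw, mul_zero]
  · rw [Complex.cpow_def_of_ne_zero (mul_ne_zero hr' hz), Complex.cpow_def_of_ne_zero hr',
      Complex.cpow_def_of_ne_zero hz, Complex.log_ofReal_mul hr hz, ← Complex.exp_add,
      Complex.ofReal_log hr.le]
    congr 1; ring

theorem mul_ofReal_sqrt_sq {α a : ℂ} (hα : α ^ 2 = 2 * a) {t : ℝ} (ht : 0 ≤ t) :
    (α * (Real.sqrt t : ℂ)) ^ 2 = 2 * (a * t) := by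
  rw [mul_pow, hα, ← Complex.ofReal_pow, Real.sq_sqrt ht]; ring

theorem integrand_eq (α β : ℂ) (c p μ₁ μ₂ : ℝ) {t : ℝ} (ht : 0 < t) :
    integrand α β c p μ₁ μ₂ t = ((c : ℂ) / 2) ^ ((μ₂ : ℂ) - 1) *
      (expPow p (μ₂ - 1) t * cliffordF (μ₂ - 1) ((c : ℂ) ^ 2 / 4 * t) *
        marcumQ μ₁ (α * (Real.sqrt t : ℂ)) β) := by
  have hs : 0 < Real.sqrt t := Real.sqrt_pos.2 ht
  have ht' : (t : ℂ) ≠ 0 := by exact_mod_cast ht.ne'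
  have e1 : (c : ℂ) * (Real.sqrt t : ℂ) / 2 = (Real.sqrt t : ℂ) * (c / 2) := by ring
  have e2 : ((c : ℂ) * (Real.sqrt t : ℂ)) ^ 2 / 4 = (c : ℂ) ^ 2 / 4 * t := by
    rw [mul_pow, ← Complex.ofReal_pow (Real.sqrt t), Real.sq_sqrt ht.le]; ring
  have e3 : (t : ℂ) ^ (((μ₂ : ℂ) - 1) / 2) * (Real.sqrt t : ℂ) ^ ((μ₂ : ℂ) - 1) =
      (t : ℂ) ^ ((μ₂ : ℂ) - 1) := by
    have hlog : Complex.log (Real.sqrt t : ℂ) = Complex.log t / 2 := by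
      rw [← Complex.ofReal_log hs.le, ← Complex.ofReal_log ht.le, Real.log_sqrt ht.le]
      push_cast; rfl
    rw [Complex.cpow_def_of_ne_zero ht', Complex.cpow_def_of_ne_zero ht',
      Complex.cpow_def_of_ne_zero (by exact_mod_cast hs.ne'), hlog, ← Complex.exp_add]
    congr 1; ring
  rw [integrand, besselI, besselE_eq_cliffordF, e1, e2, ofReal_mul_cpow hs, expPow]
  push_cast
  rw [← e3]; ring

/-- The transform `In` without the constant factor `(c/2)^(μ₂-1)`. -/
theorem inConverges_and_laplaceIn_eq {α β : ℂ} {c p μ₁ μ₂ : ℝ} {g : ℝ → ℂ} {I : ℂ}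
    (h : ∀ t, 0 < t → expPow p (μ₂ - 1) t * cliffordF (μ₂ - 1) ((c : ℂ) ^ 2 / 4 * t) *
        marcumQ μ₁ (α * (Real.sqrt t : ℂ)) β = g t)
    (hg : IntegrableOn g (Ioi 0)) (hI : ∫ t in Ioi (0 : ℝ), g t = I) :
    InConverges α β c p μ₁ μ₂ ∧
      laplaceIn α β c p μ₁ μ₂ = ((c : ℂ) / 2) ^ ((μ₂ : ℂ) - 1) * I := by
  have he : EqOn (fun t => ((c : ℂ) / 2) ^ ((μ₂ : ℂ) - 1) * g t) (integrand α β c p μ₁ μ₂)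
      (Ioi 0) := fun t ht => by rw [integrand_eq _ _ _ _ _ _ ht, h t ht]
  refine ⟨IntegrableOn.congr_fun (hg.const_mul _) he measurableSet_Ioi, ?_⟩
  rw [laplaceIn, ← setIntegral_congr_fun measurableSet_Ioi he, integral_const_mul, hI]

theorem expPow_mul_exp (p a N t : ℝ) :
    expPow p N t * Complex.exp (-((a : ℂ) * t)) = expPow (p + a) N t := by
  rw [expPow, expPow, mul_right_comm, ← Complex.exp_add]
  push_cast; ring_nf

/-- Laplace transform of an average of Bessel functions, by Fubini. -/
theorem integral_expPow_mul_avg {s N : ℝ} (hs : 0 < s) (hN : -1 < N) (C y : ℂ) {ω : ℝ → ℂ}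
    (hω : IntegrableOn ω (Ioc 0 1)) :
    IntegrableOn (fun t : ℝ => expPow s N t * cliffordF N (C * t) *
      ∫ τ in Ioc (0 : ℝ) 1, ω τ * cliffordF N (y * τ * t)) (Ioi 0) ∧
    ∫ t in Ioi (0 : ℝ), expPow s N t * cliffordF N (C * t) *
        ∫ τ in Ioc (0 : ℝ) 1, ω τ * cliffordF N (y * τ * t) =
      (s : ℂ) ^ (-((N : ℂ) + 1)) * ∫ τ in Ioc (0 : ℝ) 1, ω τ *
        (Complex.exp ((C + y * τ) / s) * cliffordF N (y * τ * C / s ^ 2)) := by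
  obtain ⟨K, hK, hb⟩ := exists_norm_cliffordF_mul_le N (half_pos hs) (R := ‖y‖ + 1) (by positivity)
  have h := integral_mul_intervalIntegral_swap (κ := fun t τ => cliffordF N (y * τ * t)) (K := K)
    (integrableOn_expPow_mul_cliffordF_mul_exp (half_lt_self hs) hN N C) hω
    (by unfold Function.uncurry; fun_prop) (fun t τ ht h0 h1 => hb _ (by
      rw [norm_mul, Complex.norm_real, Real.norm_of_nonneg h0.le]
      nlinarith [norm_nonneg y]) t ht.le)
  refine ⟨h.1, h.2.trans ?_⟩
  rw [← integral_const_mul]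
  refine setIntegral_congr_fun measurableSet_Ioc fun τ _ => ?_
  have := integral_weber hs hN C (y * τ)
  rw [this]; ring

theorem cpow_neg_sub_one_add_one (s μ : ℝ) :
    (s : ℂ) ^ (-(((μ - 1 : ℝ) : ℂ) + 1)) = ((s : ℂ) ^ (μ : ℂ))⁻¹ := by
  rw [← Complex.cpow_neg]; push_cast; ring_nf

/-- The transform with equal positive orders: `1 - Q_μ` is an average of Bessel functions over
`[0,1]`, whose transform is Weber's integral. -/
theorem laplaceIn_self_of_pos {α β : ℂ} {c p a μ : ℝ} {b : ℂ} (hα : α ^ 2 = 2 * (a : ℂ))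
    (hβ : β ^ 2 = 2 * b) (hp : 0 < p) (hs : 0 < p + a) (hμ : 0 < μ) {α' β' : ℂ}
    (hα' : α' ^ 2 = 2 * (a * ((c : ℂ) ^ 2 / 4) / ((p + a : ℝ) * p)))
    (hβ' : β' ^ 2 = 2 * (((p / (p + a) : ℝ) : ℂ) * b)) :
    InConverges α β c p μ μ ∧
      laplaceIn α β c p μ μ = ((c : ℂ) / 2) ^ ((μ : ℂ) - 1) *
        (((p : ℂ) ^ (μ : ℂ))⁻¹ * Complex.exp ((c : ℂ) ^ 2 / 4 / p) * marcumQ μ α' β') := by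
  set s : ℝ := p + a
  set C : ℂ := (c : ℂ) ^ 2 / 4
  have hN : -1 < μ - 1 := by linarith
  have hs' : (s : ℂ) ≠ 0 := by exact_mod_cast hs.ne'
  have hp' : (p : ℂ) ≠ 0 := by exact_mod_cast hp.ne'
  have hω : IntegrableOn (fun τ : ℝ => (τ : ℂ) ^ ((μ : ℂ) - 1) * Complex.exp (-(b * τ)))
      (Ioc 0 1) := integrableOn_cpow_mul_Ioc hμ (by fun_prop)
  have hA := integral_expPow_mul_avg hs hN C (a * b) hω
  have i0 := integrableOn_expPow_mul_cliffordF hp hN (μ - 1) C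
  refine inConverges_and_laplaceIn_eq (g := fun t =>
    expPow p (μ - 1) t * cliffordF (μ - 1) (C * t) -
    b ^ (μ : ℂ) * (expPow s (μ - 1) t * cliffordF (μ - 1) (C * t) *
      ∫ τ in Ioc (0 : ℝ) 1, (τ : ℂ) ^ ((μ : ℂ) - 1) * Complex.exp (-(b * τ)) *
        cliffordF (μ - 1) (a * b * τ * t))) (fun t ht => ?_) (i0.sub (hA.1.const_mul _)) ?_
  · rw [marcumQ_of_pos hμ (mul_ofReal_sqrt_sq hα ht.le) hβ]
    have e : ∫ τ in Ioc (0 : ℝ) 1, (τ : ℂ) ^ ((μ : ℂ) - 1) *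
        (Complex.exp (-(b * τ)) * cliffordF (μ - 1) (a * t * (b * τ))) =
        ∫ τ in Ioc (0 : ℝ) 1, (τ : ℂ) ^ ((μ : ℂ) - 1) * Complex.exp (-(b * τ)) *
        cliffordF (μ - 1) (a * b * τ * t) := by
      refine setIntegral_congr_fun measurableSet_Ioc fun τ _ => ?_
      rw [mul_assoc]; ring_nf
    rw [e, ← expPow_mul_exp p a]
    ring
  · rw [integral_sub i0 (hA.1.const_mul _), integral_const_mul, hA.2,
      integral_expPow_mul_cliffordF hp hN, marcumQ_of_pos hμ hα' hβ', cpow_neg_sub_one_add_one,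
      cpow_neg_sub_one_add_one, ofReal_mul_cpow (div_pos hp hs)]
    have hps : ((p / s : ℝ) : ℂ) ^ (μ : ℂ) = (p : ℂ) ^ (μ : ℂ) * ((s : ℂ) ^ (μ : ℂ))⁻¹ := by
      have h1 := ofReal_mul_cpow (r := p / s) (div_pos hp hs) s (μ : ℂ)
      rw [← Complex.ofReal_mul, div_mul_cancel₀ _ hs.ne'] at h1
      have : (s : ℂ) ^ (μ : ℂ) ≠ 0 := by simp [Complex.cpow_eq_zero_iff, hs']
      rw [h1]; field_simp
    have hpμ : (p : ℂ) ^ (μ : ℂ) ≠ 0 := by simp [Complex.cpow_eq_zero_iff, hp']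
    set a' : ℂ := a * C / (s * p) with ha'
    have hexp : Complex.exp (C / p) * Complex.exp (-a') = Complex.exp (C / s) := by
      rw [← Complex.exp_add]; congr 1
      have : (a : ℂ) = s - p := by simp only [s]; push_cast; ring
      rw [ha', this]; field_simp; ring
    have e : ∫ τ in Ioc (0 : ℝ) 1, (τ : ℂ) ^ ((μ : ℂ) - 1) * Complex.exp (-(b * τ)) *
        (Complex.exp ((C + a * b * τ) / s) * cliffordF (μ - 1) (a * b * τ * C / s ^ 2)) =
        Complex.exp (C / s) * ∫ τ in Ioc (0 : ℝ) 1, (τ : ℂ) ^ ((μ : ℂ) - 1) *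
          (Complex.exp (-(((p / s : ℝ) : ℂ) * b * τ)) *
            cliffordF (μ - 1) (a' * (((p / s : ℝ) : ℂ) * b * τ))) := by
      rw [← integral_const_mul]
      refine setIntegral_congr_fun measurableSet_Ioc fun τ _ => ?_
      have e1 : a' * (((p / s : ℝ) : ℂ) * b * τ) = a * b * τ * C / s ^ 2 := by
        rw [ha']; push_cast; field_simp
      have e2 : Complex.exp (-(b * τ)) * Complex.exp ((C + a * b * τ) / s) =
          Complex.exp (C / s) * Complex.exp (-(((p / s : ℝ) : ℂ) * b * τ)) := by
        rw [← Complex.exp_add, ← Complex.exp_add]; congr 1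
        have : (a : ℂ) = s - p := by simp only [s]; push_cast; ring
        rw [this]; push_cast; field_simp; ring
      rw [e1]
      linear_combination ((τ : ℂ) ^ ((μ : ℂ) - 1) * cliffordF (μ - 1) (a * b * τ * C / s ^ 2)) * e2
    rw [e, hps, ← hexp]
    field_simp

/-- The Möbius substitution `σ = pτ/(s-aτ)`, `p = s - a`, of `[0,1]` onto itself. -/
theorem integral_moebius {s p : ℝ} (hs : 0 < s) (hp : 0 < p) (m : ℕ) (C : ℂ) :
    ∫ τ in Ioc (0 : ℝ) 1, (1 - (τ : ℂ)) ^ m * (((s - (s - p) * τ : ℝ) : ℂ) ^ (m + 2))⁻¹ *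
        Complex.exp (C / ((s - (s - p) * τ : ℝ) : ℂ)) =
      ((s : ℂ) ^ (m + 1))⁻¹ * (p : ℂ)⁻¹ * Complex.exp (C / s) *
        ∫ σ in Ioc (0 : ℝ) 1, (1 - (σ : ℂ)) ^ m *
          Complex.exp (((s - p : ℝ) : ℂ) * C / (s * p) * σ) := by
  have hpos : ∀ τ ∈ Icc (0 : ℝ) 1, 0 < s - (s - p) * τ := by
    intro τ hτ
    nlinarith [hτ.1, hτ.2, mul_nonneg hτ.1 hp.le, mul_nonneg (sub_nonneg.2 hτ.2) hs.le]
  have hs' : (s : ℂ) ≠ 0 := by exact_mod_cast hs.ne'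
  have hp' : (p : ℂ) ≠ 0 := by exact_mod_cast hp.ne'
  have hd : ∀ τ ∈ uIcc (0 : ℝ) 1, HasDerivAt (fun τ : ℝ => p * τ / (s - (s - p) * τ))
      (p * s / (s - (s - p) * τ) ^ 2) τ := by
    intro τ hτ
    rw [uIcc_of_le zero_le_one] at hτ
    have h0 := (hpos τ hτ).ne'
    have h1 : HasDerivAt (fun τ : ℝ => p * τ) p τ := by
      simpa using (hasDerivAt_id τ).const_mul p
    have h2 : HasDerivAt (fun τ : ℝ => s - (s - p) * τ) (-(s - p)) τ := by
      simpa using ((hasDerivAt_id τ).const_mul (s - p)).const_sub s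
    refine (h1.div h2 h0).congr_deriv ?_
    congr 1; ring
  have hcv := intervalIntegral.integral_deriv_smul_comp
    (g := fun σ : ℝ => (1 - (σ : ℂ)) ^ m * Complex.exp (((s - p : ℝ) : ℂ) * C / (s * p) * σ)) hd
    (by
      refine ContinuousOn.div (by fun_prop) (by fun_prop) fun τ hτ => ?_
      rw [uIcc_of_le zero_le_one] at hτ
      exact pow_ne_zero 2 (hpos τ hτ).ne') (by fun_prop)
  rw [mul_zero, zero_div, mul_one, mul_one, sub_sub_cancel, div_self hp.ne',
    intervalIntegral.integral_of_le zero_le_one, intervalIntegral.integral_of_le zero_le_one] at hcv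
  rw [← hcv, ← integral_const_mul]
  refine setIntegral_congr_fun measurableSet_Ioc fun τ hτ => ?_
  have h0 := (hpos τ (Ioc_subset_Icc_self hτ)).ne'
  have h0' : ((s - (s - p) * τ : ℝ) : ℂ) ≠ 0 := by exact_mod_cast h0
  simp only [Function.comp, Complex.real_smul]
  set D : ℂ := ((s - (s - p) * τ : ℝ) : ℂ) with hD
  have hDe : D = s - (s - p) * τ := by rw [hD]; push_cast; ring
  have e1 : ((p * τ / (s - (s - p) * τ) : ℝ) : ℂ) = p * τ / D := by rw [hD]; push_cast; ring
  have e2 : ((p * s / (s - (s - p) * τ) ^ 2 : ℝ) : ℂ) = p * s / D ^ 2 := by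
    rw [hD]; push_cast; ring
  have e3 : 1 - (p : ℂ) * τ / D = s * (1 - τ) / D := by
    rw [eq_div_iff h0', sub_mul, div_mul_cancel₀ _ h0', hDe]; ring
  have e4 : Complex.exp (C / D) =
      Complex.exp (C / s) * Complex.exp (((s - p : ℝ) : ℂ) * C / (s * p) * (p * τ / D)) := by
    rw [← Complex.exp_add]; congr 1
    have : C / D = C * (D + (s - p) * τ) / (s * D) := by
      rw [hDe, sub_add_cancel, ← hDe]; field_simp
    rw [this]; push_cast; field_simp
  rw [e1, e2, e3, e4, div_pow, mul_pow]
  field_simp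
  ring

/-- The transform of the first of the two averages in the Marcum function of order `-m`: Fubini
gives an average over `τ` with a `τ`-dependent rate `s - (s-p)τ`, and the Möbius substitution
restores the original form. -/
theorem integral_expPow_mul_cliffordF_mul_exp {s p : ℝ} (hs : 0 < s) (hp : 0 < p) (m : ℕ) (C : ℂ) :
    IntegrableOn (fun t : ℝ => expPow s (m + 1) t * cliffordF (m + 1) (C * t) *
      ∫ τ in Ioc (0 : ℝ) 1, (1 - (τ : ℂ)) ^ m * Complex.exp (((s - p : ℝ) : ℂ) * t * τ)) (Ioi 0) ∧
    ∫ t in Ioi (0 : ℝ), expPow s (m + 1) t * cliffordF (m + 1) (C * t) *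
        ∫ τ in Ioc (0 : ℝ) 1, (1 - (τ : ℂ)) ^ m * Complex.exp (((s - p : ℝ) : ℂ) * t * τ) =
      ((s : ℂ) ^ (m + 1))⁻¹ * (p : ℂ)⁻¹ * Complex.exp (C / s) *
        ∫ σ in Ioc (0 : ℝ) 1, (1 - (σ : ℂ)) ^ m *
          Complex.exp (((s - p : ℝ) : ℂ) * C / (s * p) * σ) := by
  have hN : -1 < (m : ℝ) + 1 := by linarith [(m.cast_nonneg : (0 : ℝ) ≤ m)]
  have hδ : max (s - p) 0 < s := by
    rw [max_lt_iff]; constructor <;> linarith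
  have h := integral_mul_intervalIntegral_swap (ω := fun τ : ℝ => (1 - (τ : ℂ)) ^ m)
    (κ := fun t τ => Complex.exp (((s - p : ℝ) : ℂ) * t * τ)) (K := 1)
    (integrableOn_expPow_mul_cliffordF_mul_exp hδ hN (m + 1) C)
    ((Continuous.integrableOn_Icc (by fun_prop)).mono_set Ioc_subset_Icc_self)
    (by unfold Function.uncurry; fun_prop) (fun t τ ht h0 h1 => by
      rw [Complex.norm_exp, one_mul, ← Complex.ofReal_mul, ← Complex.ofReal_mul, Complex.ofReal_re]
      refine Real.exp_le_exp.2 ?_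
      calc (s - p) * t * τ ≤ max (s - p) 0 * t * τ := by gcongr; exact le_max_left _ _
        _ ≤ max (s - p) 0 * t * 1 := by gcongr
        _ = _ := mul_one _)
  refine ⟨h.1, h.2.trans ?_⟩
  rw [← integral_moebius hs hp]
  refine setIntegral_congr_fun measurableSet_Ioc fun τ hτ => ?_
  have hD : 0 < s - (s - p) * τ := by
    nlinarith [hτ.1, hτ.2, mul_nonneg hτ.1.le hp.le, mul_nonneg (sub_nonneg.2 hτ.2) hs.le]
  have e : ∫ t in Ioi (0 : ℝ), expPow s (m + 1) t * cliffordF (m + 1) (C * t) *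
      Complex.exp (((s - p : ℝ) : ℂ) * t * τ) = ∫ t in Ioi (0 : ℝ),
        expPow (s - (s - p) * τ) (m + 1) t * cliffordF (m + 1) (C * t) := by
    refine setIntegral_congr_fun measurableSet_Ioi fun t _ => ?_
    have := expPow_mul_exp s (-((s - p) * τ)) (m + 1) t
    rw [← sub_eq_add_neg] at this
    rw [← this, mul_right_comm]
    push_cast
    ring_nf
  have e2 : -((((m : ℝ) + 1 : ℝ) : ℂ) + 1) = -((m + 2 : ℕ) : ℂ) := by push_cast; ring
  rw [e, integral_expPow_mul_cliffordF hD hN, e2, Complex.cpow_neg, Complex.cpow_natCast, mul_assoc]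

theorem integrableOn_exp_neg_mul_Ioc (b : ℂ) :
    IntegrableOn (fun τ : ℝ => Complex.exp (-(b * τ))) (Ioc 0 1) :=
  (Continuous.integrableOn_Icc (by fun_prop)).mono_set Ioc_subset_Icc_self

/-- The transform with equal orders `-m`, a non-positive integer.  By reflection the orders become
`m + 1`, and the two integrals over `[0,1]` in the Marcum function are transformed separately. -/
theorem laplaceIn_self_neg_natCast {α β : ℂ} {c p a : ℝ} {b : ℂ} (m : ℕ)
    (hα : α ^ 2 = 2 * (a : ℂ)) (hβ : β ^ 2 = 2 * b) (hp : 0 < p) (hs : 0 < p + a) {α' β' : ℂ}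
    (hα' : α' ^ 2 = 2 * (a * ((c : ℂ) ^ 2 / 4) / ((p + a : ℝ) * p)))
    (hβ' : β' ^ 2 = 2 * (((p / (p + a) : ℝ) : ℂ) * b)) :
    InConverges α β c p (-(m : ℝ)) (-(m : ℝ)) ∧
      laplaceIn α β c p (-(m : ℝ)) (-(m : ℝ)) = ((c : ℂ) / 2) ^ (((-(m : ℝ) : ℝ) : ℂ) - 1) *
        (((p : ℂ) ^ ((-(m : ℝ) : ℝ) : ℂ))⁻¹ * Complex.exp ((c : ℂ) ^ 2 / 4 / p) *
          marcumQ (-(m : ℝ)) α' β') := by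
  set s : ℝ := p + a
  set C : ℂ := (c : ℂ) ^ 2 / 4
  have hsa : s - p = a := by simp only [s]; ring
  have hN : -1 < (m : ℝ) + 1 := by linarith [(m.cast_nonneg : (0 : ℝ) ≤ m)]
  have hs' : (s : ℂ) ≠ 0 := by exact_mod_cast hs.ne'
  have hp' : (p : ℂ) ≠ 0 := by exact_mod_cast hp.ne'
  have hm : (m.factorial : ℂ) ≠ 0 := by exact_mod_cast m.factorial_ne_zero
  have hA := integral_expPow_mul_avg hs hN C (a * b) (integrableOn_exp_neg_mul_Ioc b)
  have hB := integral_expPow_mul_cliffordF_mul_exp hs hp m C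
  rw [hsa] at hB
  refine inConverges_and_laplaceIn_eq (g := fun t => (C * a) ^ (m + 1) *
    ((m.factorial : ℂ)⁻¹ * (expPow s (m + 1) t * cliffordF (m + 1) (C * t) *
      ∫ τ in Ioc (0 : ℝ) 1, (1 - (τ : ℂ)) ^ m * Complex.exp ((a : ℂ) * t * τ)) -
    b * (expPow s (m + 1) t * cliffordF (m + 1) (C * t) *
      ∫ τ in Ioc (0 : ℝ) 1, Complex.exp (-(b * τ)) * cliffordF (m + 1) (a * b * τ * t))))
    (fun t ht => ?_) (((hB.1.const_mul _).sub (hA.1.const_mul _)).const_mul _) ?_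
  · rw [marcumQ_neg_natCast m (mul_ofReal_sqrt_sq hα ht.le) hβ]
    have e : ∫ τ in Ioc (0 : ℝ) 1, Complex.exp (-(b * τ)) *
        cliffordF (m + 1) (a * t * (b * τ)) =
        ∫ τ in Ioc (0 : ℝ) 1, Complex.exp (-(b * τ)) * cliffordF (m + 1) (a * b * τ * t) := by
      refine setIntegral_congr_fun measurableSet_Ioc fun τ _ => ?_
      ring_nf
    have e1 : -(m : ℝ) - 1 = -((m + 1 : ℕ) : ℝ) := by push_cast; ring
    have ht' : (t : ℂ) ≠ 0 := by exact_mod_cast ht.ne'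
    have e2 : expPow p (-((m + 1 : ℕ) : ℝ)) t * cliffordF (-((m + 1 : ℕ) : ℝ)) (C * t) =
        C ^ (m + 1) * Complex.exp (-(p : ℂ) * t) * cliffordF (m + 1) (C * t) := by
      rw [cliffordF_neg_natCast, expPow, mul_pow]
      push_cast
      rw [show -((m : ℂ) + 1) = -((m + 1 : ℕ) : ℂ) by push_cast; ring, Complex.cpow_neg,
        Complex.cpow_natCast]
      field_simp
    have e3 : expPow s (m + 1) t =
        Complex.exp (-(p : ℂ) * t) * Complex.exp (-((a : ℂ) * t)) * (t : ℂ) ^ (m + 1) := by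
      rw [expPow, ← Complex.exp_add,
        show (((m : ℝ) + 1 : ℝ) : ℂ) = ((m + 1 : ℕ) : ℂ) by push_cast; ring,
        Complex.cpow_natCast]
      simp only [s]; push_cast; ring_nf
    rw [e, e1, e2, e3]
    ring
  · rw [integral_const_mul, integral_sub (hB.1.const_mul _) (hA.1.const_mul _), integral_const_mul,
      integral_const_mul, hA.2, hB.2, marcumQ_neg_natCast m hα' hβ']
    set a' : ℂ := a * C / (s * p) with ha'
    have hexp : Complex.exp (C / p) * Complex.exp (-a') = Complex.exp (C / s) := by
      rw [← Complex.exp_add]; congr 1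
      have : (a : ℂ) = s - p := by simp only [s]; push_cast; ring
      rw [ha', this]; field_simp; ring
    have e : ∫ τ in Ioc (0 : ℝ) 1, Complex.exp (-(b * τ)) *
        (Complex.exp ((C + a * b * τ) / s) * cliffordF (m + 1) (a * b * τ * C / s ^ 2)) =
        Complex.exp (C / s) * ∫ τ in Ioc (0 : ℝ) 1,
          Complex.exp (-(((p / s : ℝ) : ℂ) * b * τ)) *
            cliffordF (m + 1) (a' * (((p / s : ℝ) : ℂ) * b * τ)) := by
      rw [← integral_const_mul]
      refine setIntegral_congr_fun measurableSet_Ioc fun τ _ => ?_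
      have e1 : a' * (((p / s : ℝ) : ℂ) * b * τ) = a * b * τ * C / s ^ 2 := by
        rw [ha']; push_cast; field_simp
      have e2 : Complex.exp (-(b * τ)) * Complex.exp ((C + a * b * τ) / s) =
          Complex.exp (C / s) * Complex.exp (-(((p / s : ℝ) : ℂ) * b * τ)) := by
        rw [← Complex.exp_add, ← Complex.exp_add]; congr 1
        have : (a : ℂ) = s - p := by simp only [s]; push_cast; ring
        rw [this]; push_cast; field_simp; ring
      rw [e1]
      linear_combination (cliffordF (m + 1) (a * b * τ * C / s ^ 2)) * e2
    have e4 : (s : ℂ) ^ (-((((m : ℝ) + 1 : ℝ) : ℂ) + 1)) = ((s : ℂ) ^ (m + 2))⁻¹ := by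
      rw [show -((((m : ℝ) + 1 : ℝ) : ℂ) + 1) = -((m + 2 : ℕ) : ℂ) by push_cast; ring,
        Complex.cpow_neg, Complex.cpow_natCast]
    have e5 : ((p : ℂ) ^ ((-(m : ℝ) : ℝ) : ℂ))⁻¹ = (p : ℂ) ^ m := by
      push_cast
      rw [Complex.cpow_neg, inv_inv, Complex.cpow_natCast]
    have e6 : a' ^ (m + 1) = (C * a) ^ (m + 1) * ((s : ℂ) ^ (m + 1))⁻¹ * ((p : ℂ) ^ (m + 1))⁻¹ := by
      rw [ha', div_pow, mul_pow (s : ℂ), mul_comm (a : ℂ) C]; field_simp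
    rw [e, e4, e5, ← hexp, e6]
    push_cast
    field_simp
    ring

/-! ### Orders differing by an integer -/

theorem integrableOn_weber {s N : ℝ} (hs : 0 < s) (hN : -1 < N ∨ ∃ q : ℕ, N = -(q : ℝ)) (ν : ℝ)
    (C x : ℂ) :
    IntegrableOn (fun t : ℝ => expPow s N t * cliffordF N (C * t) * cliffordF ν (x * t))
      (Ioi 0) := by
  rcases hN with hN | ⟨q, rfl⟩
  · exact integrableOn_expPow_mul_cliffordF_mul_cliffordF hs hN N ν C x
  · refine IntegrableOn.congr_fun ((integrableOn_expPow_mul_cliffordF_mul_cliffordF hs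
      (N := 0) (by norm_num) q ν C x).const_mul (C ^ q)) (fun t ht => ?_) measurableSet_Ioi
    have ht' : (t : ℂ) ≠ 0 := by exact_mod_cast (mem_Ioi.1 ht).ne'
    rw [cliffordF_neg_natCast, expPow, expPow, mul_pow]
    push_cast
    rw [Complex.cpow_neg, Complex.cpow_natCast, Complex.cpow_zero]
    field_simp

/-- Raising the order of the Marcum function by `n` adds `n` integrals of products of two Bessel
functions to the transform. -/
theorem integrand_add_natCast {α β b : ℂ} {a c p M μ : ℝ} (hα : α ^ 2 = 2 * (a : ℂ))
    (hβ : β ^ 2 = 2 * b) (hb : b ≠ 0 ∨ 0 ≤ M) (n : ℕ) {t : ℝ} (ht : 0 < t) :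
    integrand α β c p (M + n) μ t = integrand α β c p M μ t +
      ∑ k ∈ Finset.range n, ((c : ℂ) / 2) ^ ((μ : ℂ) - 1) * Complex.exp (-b) *
        b ^ ((M + k : ℝ) : ℂ) * (expPow (p + a) (μ - 1) t *
          cliffordF (μ - 1) ((c : ℂ) ^ 2 / 4 * t) * cliffordF (M + k) (a * b * t)) := by
  rw [integrand_eq _ _ _ _ _ _ ht, integrand_eq _ _ _ _ _ _ ht,
    marcumQ_add_natCast M (mul_ofReal_sqrt_sq hα ht.le) hβ hb n, mul_add, mul_add, Finset.mul_sum,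
    Finset.mul_sum, ← expPow_mul_exp]
  congr 1
  refine Finset.sum_congr rfl fun k _ => ?_
  rw [sub_eq_add_neg (-((a : ℂ) * t)) b, Complex.exp_add,
    show (a : ℂ) * t * b = a * b * t by ring]
  ring

theorem laplaceIn_add_natCast {α β b : ℂ} {a c p M μ : ℝ} (hα : α ^ 2 = 2 * (a : ℂ))
    (hβ : β ^ 2 = 2 * b) (hs : 0 < p + a) (hb : b ≠ 0 ∨ 0 ≤ M) (n : ℕ)
    (hμ : -1 < μ - 1 ∨ ∃ q : ℕ, μ - 1 = -(q : ℝ)) :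
    (InConverges α β c p M μ ↔ InConverges α β c p (M + n) μ) ∧
    (InConverges α β c p M μ → laplaceIn α β c p (M + n) μ = laplaceIn α β c p M μ +
      ∑ k ∈ Finset.range n, ((c : ℂ) / 2) ^ ((μ : ℂ) - 1) * Complex.exp (-b) *
        b ^ ((M + k : ℝ) : ℂ) * ∫ t in Ioi (0 : ℝ), expPow (p + a) (μ - 1) t *
          cliffordF (μ - 1) ((c : ℂ) ^ 2 / 4 * t) * cliffordF (M + k) (a * b * t)) := by
  have hk : ∀ k ∈ Finset.range n, IntegrableOn (fun t : ℝ => ((c : ℂ) / 2) ^ ((μ : ℂ) - 1) *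
      Complex.exp (-b) * b ^ ((M + k : ℝ) : ℂ) * (expPow (p + a) (μ - 1) t *
          cliffordF (μ - 1) ((c : ℂ) ^ 2 / 4 * t) * cliffordF (M + k) (a * b * t))) (Ioi 0) :=
    fun k _ => (integrableOn_weber hs hμ (M + k) _ _).const_mul _
  have hsum := integrable_finsetSum _ hk
  have he : EqOn (integrand α β c p (M + n) μ) (fun t => integrand α β c p M μ t +
      ∑ k ∈ Finset.range n, ((c : ℂ) / 2) ^ ((μ : ℂ) - 1) * Complex.exp (-b) *
        b ^ ((M + k : ℝ) : ℂ) * (expPow (p + a) (μ - 1) t *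
          cliffordF (μ - 1) ((c : ℂ) ^ 2 / 4 * t) * cliffordF (M + k) (a * b * t))) (Ioi 0) :=
    fun t ht => integrand_add_natCast hα hβ hb n ht
  refine ⟨⟨fun h => ?_, fun h => ?_⟩, fun h => ?_⟩
  · exact IntegrableOn.congr_fun (h.add hsum) he.symm measurableSet_Ioi
  · refine IntegrableOn.congr_fun (h.sub hsum) (fun t ht => ?_) measurableSet_Ioi
    simp only [Pi.sub_apply]
    rw [he ht, add_sub_cancel_right]
  · rw [laplaceIn, setIntegral_congr_fun measurableSet_Ioi he, integral_add h hsum,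
      integral_finsetSum _ hk]
    simp only [integral_const_mul, laplaceIn]

/-- The integral of the product of Bessel functions of orders `μ-1` and `μ+k`, as an average over
`[0,1]`. -/
theorem integral_weber_add {s μ : ℝ} (hs : 0 < s) (hμ : 0 < μ) (k : ℕ) (C x : ℂ) :
    ∫ t in Ioi (0 : ℝ), expPow s (μ - 1) t * cliffordF (μ - 1) (C * t) * cliffordF (μ + k) (x * t) =
      (k.factorial : ℂ)⁻¹ * ((s : ℂ) ^ (μ : ℂ))⁻¹ * ∫ τ in Ioc (0 : ℝ) 1,
        (τ : ℂ) ^ ((μ : ℂ) - 1) * (1 - (τ : ℂ)) ^ k *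
        (Complex.exp ((C + x * τ) / s) * cliffordF (μ - 1) (x * τ * C / s ^ 2)) := by
  have hk : (k.factorial : ℂ) ≠ 0 := by exact_mod_cast k.factorial_ne_zero
  have hA := (integral_expPow_mul_avg hs (by linarith : -1 < μ - 1) C x
    (integrableOn_cpow_mul_Ioc hμ (g := fun τ : ℝ => (1 - (τ : ℂ)) ^ k) (by fun_prop))).2
  rw [cpow_neg_sub_one_add_one] at hA
  rw [mul_assoc, ← hA, ← integral_const_mul]
  refine setIntegral_congr_fun measurableSet_Ioi fun t _ => ?_
  have h := integral_beta_mul_cliffordF hμ k (x * t)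
  have e : ∫ τ in Ioc (0 : ℝ) 1, (τ : ℂ) ^ ((μ : ℂ) - 1) * (1 - (τ : ℂ)) ^ k *
      cliffordF (μ - 1) (x * τ * t) = (k.factorial : ℂ) * cliffordF (μ + k) (x * t) := by
    rw [← h]
    refine setIntegral_congr_fun measurableSet_Ioc fun τ _ => ?_
    rw [mul_right_comm x]
  rw [e]
  field_simp

/-! ### Pochhammer symbols and the function `₀F₁` -/

theorem poch_zero (x : ℂ) : poch x 0 = 1 := by simp [poch]

theorem poch_succ (x : ℂ) (m : ℕ) : poch x (m + 1) = poch x m * (x + m) := by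
  rw [poch, poch, ascPochhammer_succ_eval]

theorem Gamma_add_natCast {x : ℝ} (hx : 0 < x) (k : ℕ) :
    Complex.Gamma ((x : ℂ) + k) = poch x k * Complex.Gamma x := by
  induction k with
  | zero => simp [poch_zero]
  | succ k ih =>
    have h : (x : ℂ) + k ≠ 0 := by
      exact_mod_cast (add_pos_of_pos_of_nonneg hx k.cast_nonneg).ne'
    rw [poch_succ, Nat.cast_succ, ← add_assoc, Complex.Gamma_add_one _ h, ih]
    ring

theorem poch_neg_natCast (m j : ℕ) :
    poch (-(m : ℂ)) j = (-1) ^ j * ((j.factorial : ℂ) * (m.choose j : ℂ)) := by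
  rw [poch, ascPochhammer_eval_neg_eq_descPochhammer, descPochhammer_eval_eq_descFactorial,
    Nat.descFactorial_eq_factorial_mul_choose, Nat.cast_mul]

theorem hyp0F1_eq_cliffordF {μ : ℝ} (hμ : 0 < μ) (z : ℂ) :
    hyp0F1 μ z = Complex.Gamma μ * cliffordF (μ - 1) z := by
  have hΓ : Complex.Gamma μ ≠ 0 := Complex.Gamma_ne_zero_of_re_pos (by simpa using hμ)
  rw [hyp0F1, cliffordF, ← tsum_mul_left]
  refine tsum_congr fun k => ?_
  rw [show ((μ - 1 : ℝ) : ℂ) + k + 1 = μ + k by push_cast; ring, Gamma_add_natCast hμ, mul_inv,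
    div_eq_mul_inv, mul_inv, div_eq_mul_inv]
  field_simp

/-! ### Equal orders in terms of the original parameters -/

theorem pTilde_eq {α : ℂ} {a : ℝ} (hα : α ^ 2 = 2 * (a : ℂ)) (p : ℝ) :
    pTilde p α = 2 * (p + a) := by
  rw [pTilde, hα]; simp; ring

theorem exists_sq_eq_two_mul_ofReal {α : ℂ} (hα : α.im = 0 ∨ α.re = 0) :
    ∃ a : ℝ, α ^ 2 = 2 * (a : ℂ) := by
  refine ⟨(α ^ 2).re / 2, ?_⟩
  apply Complex.ext
  · simp; ring
  · rcases hα with h | h <;> simp [pow_two, h]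

theorem cpow_sub_one_mul_self {z : ℂ} (hz : z ≠ 0) (w : ℂ) : z ^ (w - 1) * z = z ^ w := by
  rw [Complex.cpow_sub _ _ hz, Complex.cpow_one, div_mul_cancel₀ _ hz]

theorem laplaceIn_self {α β : ℂ} {c p a μ : ℝ} (hα : α ^ 2 = 2 * (a : ℂ)) (hp : 0 < p)
    (hs : 0 < p + a) (hμ : 0 < μ ∨ ∃ m : ℕ, μ = -(m : ℝ)) :
    InConverges α β c p μ μ ∧
      laplaceIn α β c p μ μ =
        1 / (p : ℂ) * ((c : ℂ) / (2 * p)) ^ ((μ : ℂ) - 1) * Complex.exp ((c : ℂ) ^ 2 / (4 * p)) *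
          marcumQ μ (α * c / (Real.sqrt (2 * p * pTilde p α) : ℂ))
            (β * (Real.sqrt (2 * p / pTilde p α) : ℂ)) := by
  have hp' : (p : ℂ) ≠ 0 := by exact_mod_cast hp.ne'
  have hs' : ((p + a : ℝ) : ℂ) ≠ 0 := by exact_mod_cast hs.ne'
  have hα' : (α * c / (Real.sqrt (2 * p * pTilde p α) : ℂ)) ^ 2 =
      2 * (a * ((c : ℂ) ^ 2 / 4) / ((p + a : ℝ) * p)) := by
    rw [div_pow, mul_pow, hα, ← Complex.ofReal_pow (Real.sqrt _), Real.sq_sqrt, pTilde_eq hα]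
    · rw [show ((2 * p * (2 * (p + a)) : ℝ) : ℂ) = 4 * (((p + a : ℝ) : ℂ) * p) by push_cast; ring]
      field_simp
    · rw [pTilde_eq hα]; positivity
  have hβ' : (β * (Real.sqrt (2 * p / pTilde p α) : ℂ)) ^ 2 =
      2 * (((p / (p + a) : ℝ) : ℂ) * (β ^ 2 / 2)) := by
    rw [mul_pow, ← Complex.ofReal_pow (Real.sqrt _), Real.sq_sqrt, pTilde_eq hα,
      mul_div_mul_left _ _ two_ne_zero]
    · ring
    · rw [pTilde_eq hα]; positivity
  have hβ : β ^ 2 = 2 * (β ^ 2 / 2) := by ring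
  have hpμ : (p : ℂ) ^ (μ : ℂ) ≠ 0 := by simp [Complex.cpow_eq_zero_iff, hp']
  have e : ((c : ℂ) / 2) ^ ((μ : ℂ) - 1) * ((p : ℂ) ^ (μ : ℂ))⁻¹ =
      1 / (p : ℂ) * ((c : ℂ) / (2 * p)) ^ ((μ : ℂ) - 1) := by
    rw [show (c : ℂ) / 2 = p * (c / (2 * p)) by field_simp, ofReal_mul_cpow hp,
      ← cpow_sub_one_mul_self hp' (μ : ℂ)]
    have : (p : ℂ) ^ ((μ : ℂ) - 1) ≠ 0 := by simp [Complex.cpow_eq_zero_iff, hp']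
    field_simp
  have e' : (c : ℂ) ^ 2 / 4 / p = (c : ℂ) ^ 2 / (4 * p) := by rw [div_div]
  rcases hμ with hμ | ⟨m, rfl⟩
  · have h := laplaceIn_self_of_pos hα hβ hp hs hμ hα' hβ'
    refine ⟨h.1, ?_⟩
    rw [h.2, ← e, e']; ring
  · have h := laplaceIn_self_neg_natCast m hα hβ hp hs hα' hβ'
    refine ⟨h.1, ?_⟩
    rw [h.2, ← e, e']; ring

/-! ### Larger first order: integrals over `[0,1]` -/

theorem cpow_add_natCast_eq {μ : ℝ} (hμ : 0 < μ) (b : ℂ) (k : ℕ) :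
    b ^ ((μ + k : ℝ) : ℂ) = b ^ ((μ : ℂ) - 1) * b ^ (k + 1) := by
  rcases eq_or_ne b 0 with rfl | hb
  · have : ((μ + k : ℝ) : ℂ) ≠ 0 := by
      exact_mod_cast (add_pos_of_pos_of_nonneg hμ k.cast_nonneg).ne'
    rw [Complex.zero_cpow this]; simp
  · rw [← Complex.cpow_natCast, ← Complex.cpow_add _ _ hb]
    push_cast; congr 1; ring

/-- The difference of the transforms with first orders `μ + n` and `μ`, as `n` integrals over
`[0,1]`; both closed forms of it are read off from these. -/
theorem laplaceIn_add_eq_sum_average {α β : ℂ} {c p a μ : ℝ} (hα : α ^ 2 = 2 * (a : ℂ))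
    (hp : 0 < p) (hs : 0 < p + a) (hμ : 0 < μ) (n : ℕ) :
    InConverges α β c p (μ + n) μ ∧ laplaceIn α β c p (μ + n) μ = laplaceIn α β c p μ μ +
      ∑ k ∈ Finset.range n, ((c : ℂ) / 2) ^ ((μ : ℂ) - 1) * (((p + a : ℝ) : ℂ) ^ (μ : ℂ))⁻¹ *
        Complex.exp (-(β ^ 2 / 2) + (c : ℂ) ^ 2 / 4 / ((p + a : ℝ) : ℂ)) *
        (β ^ 2 / 2) ^ ((μ + k : ℝ) : ℂ) * ((k.factorial : ℂ)⁻¹ *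
        ∫ τ in Ioc (0 : ℝ) 1, (τ : ℂ) ^ ((μ : ℂ) - 1) * (1 - (τ : ℂ)) ^ k *
          (Complex.exp (a * (β ^ 2 / 2) / ((p + a : ℝ) : ℂ) * τ) * cliffordF (μ - 1)
            (a * (β ^ 2 / 2) * ((c : ℂ) ^ 2 / 4) / ((p + a : ℝ) : ℂ) ^ 2 * τ))) := by
  have h := laplaceIn_add_natCast (c := c) (M := μ) (μ := μ) hα
    (show β ^ 2 = 2 * (β ^ 2 / 2) by ring) hs (Or.inr hμ.le) n (Or.inl (by linarith))
  have h0 := (laplaceIn_self (β := β) (c := c) hα hp hs (Or.inl hμ)).1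
  refine ⟨h.1.1 h0, (h.2 h0).trans ?_⟩
  congr 1
  refine Finset.sum_congr rfl fun k _ => ?_
  rw [integral_weber_add hs hμ, Complex.exp_add]
  have e : ∫ τ in Ioc (0 : ℝ) 1, (τ : ℂ) ^ ((μ : ℂ) - 1) * (1 - (τ : ℂ)) ^ k *
        (Complex.exp (((c : ℂ) ^ 2 / 4 + a * (β ^ 2 / 2) * τ) / ((p + a : ℝ) : ℂ)) *
          cliffordF (μ - 1) (a * (β ^ 2 / 2) * τ * ((c : ℂ) ^ 2 / 4) / ((p + a : ℝ) : ℂ) ^ 2)) =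
      Complex.exp ((c : ℂ) ^ 2 / 4 / ((p + a : ℝ) : ℂ)) * ∫ τ in Ioc (0 : ℝ) 1,
        (τ : ℂ) ^ ((μ : ℂ) - 1) * (1 - (τ : ℂ)) ^ k *
          (Complex.exp (a * (β ^ 2 / 2) / ((p + a : ℝ) : ℂ) * τ) * cliffordF (μ - 1)
            (a * (β ^ 2 / 2) * ((c : ℂ) ^ 2 / 4) / ((p + a : ℝ) : ℂ) ^ 2 * τ)) := by
    rw [← integral_const_mul]
    refine setIntegral_congr_fun measurableSet_Ioc fun τ _ => ?_
    rw [add_div, Complex.exp_add, mul_div_right_comm _ (τ : ℂ)]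
    rw [show (a : ℂ) * (β ^ 2 / 2) * τ * ((c : ℂ) ^ 2 / 4) / ((p + a : ℝ) : ℂ) ^ 2 =
      a * (β ^ 2 / 2) * ((c : ℂ) ^ 2 / 4) / ((p + a : ℝ) : ℂ) ^ 2 * τ by ring]
    ring
  rw [e]
  ring

theorem sum_Icc_one_eq_sum_range {M : Type*} [AddCommMonoid M] (f : ℕ → M) (n : ℕ) :
    ∑ j ∈ Finset.Icc 1 n, f j = ∑ k ∈ Finset.range n, f (k + 1) := by
  rw [Finset.range_eq_Ico, Finset.sum_Ico_add' f 0 n 1, zero_add,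
    Finset.Ico_add_one_right_eq_Icc]

theorem laplaceIn_add_eq_sum_integral {α β : ℂ} {c p a μ : ℝ} (hα : α ^ 2 = 2 * (a : ℂ))
    (hp : 0 < p) (hs : 0 < p + a) (hμ : 0 < μ) (n : ℕ) :
    laplaceIn α β c p (μ + n) μ = laplaceIn α β c p μ μ +
      2 / (pTilde p α : ℂ) *
        ((β ^ 2) ^ ((μ : ℂ) - 1) * ((c : ℂ) / (2 * (pTilde p α : ℂ))) ^ ((μ : ℂ) - 1)) *
        (Complex.exp (-β ^ 2 / 2 + (c : ℂ) ^ 2 / (2 * (pTilde p α : ℂ))) / Complex.Gamma μ) *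
        ∑ j ∈ Finset.Icc 1 n, (β ^ 2 / 2) ^ j / ((j - 1).factorial : ℂ) *
          ∫ t in (0 : ℝ)..1, (t : ℂ) ^ ((μ : ℂ) - 1) * (1 - (t : ℂ)) ^ (j - 1) *
            Complex.exp (α ^ 2 * β ^ 2 / (2 * (pTilde p α : ℂ)) * t) *
            hyp0F1 μ (α ^ 2 * β ^ 2 * (c : ℂ) ^ 2 / (4 * (pTilde p α : ℂ) ^ 2) * t) := by
  rw [(laplaceIn_add_eq_sum_average hα hp hs hμ n).2, sum_Icc_one_eq_sum_range, Finset.mul_sum,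
    pTilde_eq hα]
  congr 1
  refine Finset.sum_congr rfl fun k _ => ?_
  have hΓ : Complex.Gamma μ ≠ 0 := Complex.Gamma_ne_zero_of_re_pos (by simpa using hμ)
  set s : ℝ := p + a
  set b : ℂ := β ^ 2 / 2 with hb
  have hβ : β ^ 2 = 2 * b := by rw [hb]; ring
  have hs' : (s : ℂ) ≠ 0 := by exact_mod_cast hs.ne'
  have hsμ : (s : ℂ) ^ ((μ : ℂ) - 1) ≠ 0 := by simp [Complex.cpow_eq_zero_iff, hs']
  have e1 : ∫ t in (0 : ℝ)..1, (t : ℂ) ^ ((μ : ℂ) - 1) * (1 - (t : ℂ)) ^ (k + 1 - 1) *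
            Complex.exp (α ^ 2 * β ^ 2 / (2 * ((2 * s : ℝ) : ℂ)) * t) *
            hyp0F1 μ (α ^ 2 * β ^ 2 * (c : ℂ) ^ 2 / (4 * ((2 * s : ℝ) : ℂ) ^ 2) * t) =
      Complex.Gamma μ * ∫ τ in Ioc (0 : ℝ) 1, (τ : ℂ) ^ ((μ : ℂ) - 1) * (1 - (τ : ℂ)) ^ k *
          (Complex.exp (a * b / (s : ℂ) * τ) * cliffordF (μ - 1)
            (a * b * ((c : ℂ) ^ 2 / 4) / (s : ℂ) ^ 2 * τ)) := by
    rw [intervalIntegral.integral_of_le zero_le_one, ← integral_const_mul]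
    refine setIntegral_congr_fun measurableSet_Ioc fun τ _ => ?_
    have h1 : α ^ 2 * β ^ 2 / (2 * ((2 * s : ℝ) : ℂ)) = a * b / s := by
      rw [hα, hβ]; push_cast; field_simp
    have h2 : α ^ 2 * β ^ 2 * (c : ℂ) ^ 2 / (4 * ((2 * s : ℝ) : ℂ) ^ 2) =
        a * b * ((c : ℂ) ^ 2 / 4) / (s : ℂ) ^ 2 := by
      rw [hα, hβ]; push_cast; field_simp
    rw [h1, h2, hyp0F1_eq_cliffordF hμ, Nat.add_sub_cancel]
    ring
  have e2 : ((c : ℂ) / 2) ^ ((μ : ℂ) - 1) * ((s : ℂ) ^ (μ : ℂ))⁻¹ * b ^ ((μ : ℂ) - 1) =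
      2 / ((2 * s : ℝ) : ℂ) *
        ((2 * b) ^ ((μ : ℂ) - 1) * ((c : ℂ) / (2 * ((2 * s : ℝ) : ℂ))) ^ ((μ : ℂ) - 1)) := by
    have h1 : (2 * b) ^ ((μ : ℂ) - 1) = 2 ^ ((μ : ℂ) - 1) * b ^ ((μ : ℂ) - 1) := by
      simpa using ofReal_mul_cpow two_pos b ((μ : ℂ) - 1)
    have h2 : ((c : ℂ) / 2) ^ ((μ : ℂ) - 1) = (s : ℂ) ^ ((μ : ℂ) - 1) * (2 ^ ((μ : ℂ) - 1) *
        ((c : ℂ) / (2 * ((2 * s : ℝ) : ℂ))) ^ ((μ : ℂ) - 1)) := by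
      have h3 := ofReal_mul_cpow two_pos ((c : ℂ) / (2 * ((2 * s : ℝ) : ℂ))) ((μ : ℂ) - 1)
      rw [Complex.ofReal_ofNat] at h3
      rw [← h3, ← ofReal_mul_cpow hs]
      congr 1
      push_cast; field_simp
    rw [h1, h2, ← cpow_sub_one_mul_self hs' (μ : ℂ)]
    push_cast
    field_simp
  have e3 : -β ^ 2 / 2 + (c : ℂ) ^ 2 / (2 * ((2 * s : ℝ) : ℂ)) = -b + (c : ℂ) ^ 2 / 4 / s := by
    rw [hb]; push_cast; field_simp; ring
  have hk : (k.factorial : ℂ) ≠ 0 := by exact_mod_cast k.factorial_ne_zero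
  have e4 : ∀ A B E J : ℂ, A * E * (B * b ^ (k + 1)) * ((k.factorial : ℂ)⁻¹ * J) =
      A * B * (E / Complex.Gamma μ) *
        (b ^ (k + 1) / (k.factorial : ℂ) * (Complex.Gamma μ * J)) := by
    intro A B E J; field_simp
  rw [e1, e3, cpow_add_natCast_eq hμ, hβ, ← e2, Nat.add_sub_cancel]
  exact e4 _ _ _ _

theorem integrableOn_cpow_mul_exp_mul_hyp0F1 {μ : ℝ} (hμ : 0 < μ) (k : ℕ) (y z : ℂ) :
    IntegrableOn (fun t : ℝ => (t : ℂ) ^ ((μ : ℂ) - 1) * (1 - (t : ℂ)) ^ k *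
      Complex.exp (y * t) * hyp0F1 μ (z * t)) (Ioc 0 1) := by
  simp only [hyp0F1_eq_cliffordF hμ]
  refine (integrableOn_cpow_mul_Ioc hμ (g := fun t : ℝ => (1 - (t : ℂ)) ^ k *
    Complex.exp (y * t) * (Complex.Gamma μ * cliffordF (μ - 1) (z * t))) ?_).congr_fun
    (fun t _ => ?_) measurableSet_Ioc
  · fun_prop
  · simp only [mul_assoc]

/-! ### Smaller first order -/

theorem integral_weber_sub_of_or {s N : ℝ} (hs : 0 < s) (hN : -1 < N ∨ ∃ q : ℕ, N = -(q : ℝ))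
    (m : ℕ) (C x : ℂ) :
    ∫ t in Ioi (0 : ℝ), expPow s N t * cliffordF N (C * t) * cliffordF (N - m) (x * t) =
      (s : ℂ) ^ (-((N : ℂ) + 1)) * Complex.exp ((C + x) / s) *
        ∑ j ∈ Finset.range (m + 1), (m.choose j : ℂ) * (x / s) ^ j *
          cliffordF (N - m + j) (x * C / s ^ 2) := by
  rcases hN with hN | ⟨q, rfl⟩
  · exact integral_weber_sub hs hN m C x
  · exact integral_weber_sub_neg hs q m C x

/-- The powers of `β/α` and of the argument of the Bessel function combine to a single principal
value. -/
theorem divPow_mul_cpow {α β : ℂ} {c s ν : ℝ} (hα : α ≠ 0) (hc : c ≠ 0) (hs : 0 < s)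
    (hβ : β ≠ 0 ∨ 0 ≤ ν) (k j : ℕ) :
    divPow α β c (2 * s) ν * ((β / c) ^ (j + k) * (((2 * s : ℝ) : ℂ) / α) ^ k * (-α) ^ j) *
      ((c : ℂ) * (α * β / ((2 * s : ℝ) : ℂ)) / 2) ^ ((ν + k + j : ℝ) : ℂ) =
    ((c : ℂ) / (2 * s)) ^ (ν : ℂ) * (β ^ 2 / 2) ^ ((ν + k : ℝ) : ℂ) *
      (-(α ^ 2 / 2 * (β ^ 2 / 2)) / s) ^ j := by
  have hs' : (s : ℂ) ≠ 0 := by exact_mod_cast hs.ne'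
  have hc' : (c : ℂ) ≠ 0 := by exact_mod_cast hc
  rcases eq_or_ne β 0 with rfl | hβ0
  · have hν : 0 ≤ ν := hβ.resolve_left (by simp)
    rcases hν.eq_or_lt with rfl | hν
    · rcases k with _ | k
      · rcases j with _ | j
        · simp [divPow]
        · simp
      · have : ((0 + (k + 1 : ℕ) : ℝ) : ℂ) ≠ 0 := by
          push_cast; rw [zero_add]; exact k.cast_add_one_ne_zero
        rw [show (0 : ℂ) ^ 2 / 2 = 0 by simp, Complex.zero_cpow this]
        simp
    · have h1 : ((ν + k : ℝ) : ℂ) ≠ 0 := by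
        exact_mod_cast (add_pos_of_pos_of_nonneg hν k.cast_nonneg).ne'
      have h2 : (ν : ℂ) ≠ 0 := by exact_mod_cast hν.ne'
      rw [show (0 : ℂ) ^ 2 / 2 = 0 by simp, Complex.zero_cpow h1]
      simp [divPow, h2]
  · set y : ℂ := (c : ℂ) * (α * β / ((2 * s : ℝ) : ℂ)) with hy
    have hP : ((2 * s : ℝ) : ℂ) ≠ 0 := by push_cast; exact mul_ne_zero two_ne_zero hs'
    have hy0 : y ≠ 0 := mul_ne_zero hc' (div_ne_zero (mul_ne_zero hα hβ0) hP)
    have hyν : y ^ (ν : ℂ) ≠ 0 := by simp [Complex.cpow_eq_zero_iff, hy0]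
    have hb0 : β ^ 2 / 2 ≠ 0 := div_ne_zero (pow_ne_zero 2 hβ0) two_ne_zero
    have h2ν : (2 : ℂ) ^ (ν : ℂ) ≠ 0 := by simp [Complex.cpow_eq_zero_iff]
    have e1 : y ^ (ν : ℂ) = 2 ^ (ν : ℂ) * (y / 2) ^ (ν : ℂ) := by
      have := ofReal_mul_cpow two_pos (y / 2) (ν : ℂ)
      rw [Complex.ofReal_ofNat] at this
      rw [← this]; congr 1; ring
    have e2 : (β ^ 2) ^ (ν : ℂ) = 2 ^ (ν : ℂ) * (β ^ 2 / 2) ^ (ν : ℂ) := by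
      have := ofReal_mul_cpow two_pos (β ^ 2 / 2) (ν : ℂ)
      rw [Complex.ofReal_ofNat] at this
      rw [← this]; congr 1; ring
    have hyν2 : (y / 2) ^ (ν : ℂ) ≠ 0 := by simp [Complex.cpow_eq_zero_iff, hy0]
    have e3 : (y / 2) ^ ((ν + k + j : ℝ) : ℂ) = (y / 2) ^ (ν : ℂ) * (y / 2) ^ (k + j) := by
      rw [← Complex.cpow_natCast, ← Complex.cpow_add _ _ (div_ne_zero hy0 two_ne_zero)]
      push_cast; congr 1; ring
    have e4 : (β ^ 2 / 2) ^ ((ν + k : ℝ) : ℂ) = (β ^ 2 / 2) ^ (ν : ℂ) * (β ^ 2 / 2) ^ k := by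
      rw [← Complex.cpow_natCast (β ^ 2 / 2) k, ← Complex.cpow_add _ _ hb0]
      push_cast; congr 1
    have e5 : (β / c) ^ (j + k) * (((2 * s : ℝ) : ℂ) / α) ^ k * (-α) ^ j * (y / 2) ^ (k + j) =
        (β ^ 2 / 2) ^ k * (-(α ^ 2 / 2 * (β ^ 2 / 2)) / s) ^ j := by
      have h1 : (β / c) * (((2 * s : ℝ) : ℂ) / α) * (y / 2) = β ^ 2 / 2 := by
        rw [hy]; field_simp
      have h2 : (β / c) * (-α) * (y / 2) = -(α ^ 2 / 2 * (β ^ 2 / 2)) / s := by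
        rw [hy]; push_cast; field_simp
      rw [← h2, ← h1]
      generalize -α = α', y / 2 = z
      ring
    have e6 : ((c / (2 * s) : ℝ) : ℂ) = (c : ℂ) / (2 * s) := by push_cast; ring
    have e7 : ((c : ℂ) / (2 * s)) ^ (ν : ℂ) * (2 ^ (ν : ℂ) * (β ^ 2 / 2) ^ (ν : ℂ)) /
        (2 ^ (ν : ℂ) * (y / 2) ^ (ν : ℂ)) * (y / 2) ^ (ν : ℂ) =
        ((c : ℂ) / (2 * s)) ^ (ν : ℂ) * (β ^ 2 / 2) ^ (ν : ℂ) := by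
      rw [mul_left_comm, mul_div_mul_left _ _ h2ν, div_mul_cancel₀ _ hyν2]
    rw [e3, e4, divPow, ← hy, e1, e2, e6]
    linear_combination (((β / c) ^ (j + k) * (((2 * s : ℝ) : ℂ) / α) ^ k * (-α) ^ j) *
      (y / 2) ^ (k + j)) * e7 +
      ((c : ℂ) / (2 * s)) ^ (ν : ℂ) * (β ^ 2 / 2) ^ (ν : ℂ) * e5

/-- The difference of the transforms with first orders `ν + n` and `ν` is a sum of Weber integrals
in which the order of one Bessel function is lowered by `n - 1 - k`. -/
theorem laplaceIn_sub_eq_sum_besselI {α β : ℂ} {c p a ν : ℝ} (hα : α ^ 2 = 2 * (a : ℂ))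
    (hp : 0 < p) (hs : 0 < p + a) (n : ℕ) (hμ : 0 < ν + n ∨ ∃ m : ℕ, ν + n = -(m : ℝ))
    (hα0 : α ≠ 0) (hβ : β ≠ 0 ∨ 0 ≤ ν) (hc : c ≠ 0) :
    InConverges α β c p ν (ν + n) ∧
      laplaceIn α β c p ν (ν + n) = laplaceIn α β c p (ν + n) (ν + n) -
        2 / (c : ℂ) * ((c : ℂ) / (pTilde p α : ℂ)) ^ n * divPow α β c (pTilde p α) ν *
          Complex.exp (((c : ℂ) ^ 2 / 2 - p * β ^ 2) / (pTilde p α : ℂ)) *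
          ∑ k ∈ Finset.range n, ∑ j ∈ Finset.range (n - k),
            (β / (c : ℂ)) ^ (j + k) * ((pTilde p α : ℂ) / α) ^ k * (-α) ^ j *
              (poch (-(n : ℂ) + k + 1) j / (j.factorial : ℂ)) *
              besselI (ν + k + j) ((c : ℂ) * (α * β / (pTilde p α : ℂ))) := by
  have hN : -1 < ν + n - 1 ∨ ∃ q : ℕ, ν + n - 1 = -(q : ℝ) := by
    rcases hμ with h | ⟨m, h⟩
    · left; linarith
    · right; refine ⟨m + 1, ?_⟩; rw [h]; push_cast; ring
  have hb : β ^ 2 / 2 ≠ 0 ∨ 0 ≤ ν :=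
    hβ.imp_left fun h => div_ne_zero (pow_ne_zero 2 h) two_ne_zero
  have h := laplaceIn_add_natCast (c := c) (M := ν) (μ := ν + n) hα
    (show β ^ 2 = 2 * (β ^ 2 / 2) by ring) hs hb n hN
  have h1 := h.1.2 (laplaceIn_self hα hp hs hμ).1
  refine ⟨h1, ?_⟩
  rw [h.2 h1, eq_sub_iff_add_eq]
  congr 1
  rw [Finset.mul_sum, pTilde_eq hα]
  refine Finset.sum_congr rfl fun k hk => ?_
  rw [Finset.mem_range] at hk
  obtain ⟨m, rfl⟩ : ∃ m, n = k + (m + 1) := ⟨n - k - 1, by omega⟩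
  have ek : ν + k = ν + (k + (m + 1) : ℕ) - 1 - m := by push_cast; ring
  have hW := integral_weber_sub_of_or hs hN m ((c : ℂ) ^ 2 / 4) (a * (β ^ 2 / 2))
  rw [← ek] at hW
  rw [hW, Nat.add_sub_cancel_left, Finset.mul_sum, Finset.mul_sum, Finset.mul_sum]
  refine Finset.sum_congr rfl fun j _ => ?_
  set s : ℝ := p + a with hsdef
  have hs' : (s : ℂ) ≠ 0 := by exact_mod_cast hs.ne'
  have hc' : (c : ℂ) ≠ 0 := by exact_mod_cast hc
  have hj : (j.factorial : ℂ) ≠ 0 := by exact_mod_cast j.factorial_ne_zero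
  have ep : poch (-((k + (m + 1) : ℕ) : ℂ) + k + 1) j / (j.factorial : ℂ) =
      (-1) ^ j * (m.choose j : ℂ) := by
    rw [show -((k + (m + 1) : ℕ) : ℂ) + k + 1 = -(m : ℂ) by push_cast; ring, poch_neg_natCast]
    field_simp
  have hP : ((2 * s : ℝ) : ℂ) = 2 * s := by push_cast; ring
  have eF : ((c : ℂ) * (α * β / ((2 * s : ℝ) : ℂ))) ^ 2 / 4 =
      a * (β ^ 2 / 2) * ((c : ℂ) ^ 2 / 4) / (s : ℂ) ^ 2 := by
    have : ((c : ℂ) * (α * β / ((2 * s : ℝ) : ℂ))) ^ 2 / 4 =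
      α ^ 2 * β ^ 2 * c ^ 2 / (16 * s ^ 2) := by rw [hP]; field_simp; ring
    rw [this, hα]; field_simp; ring
  have eE : Complex.exp (-(β ^ 2 / 2)) *
      Complex.exp (((c : ℂ) ^ 2 / 4 + a * (β ^ 2 / 2)) / s) =
      Complex.exp (((c : ℂ) ^ 2 / 2 - p * β ^ 2) / ((2 * s : ℝ) : ℂ)) := by
    rw [← Complex.exp_add]; congr 1
    have : (a : ℂ) = s - p := by rw [hsdef]; push_cast; ring
    rw [this, hP]; field_simp; ring
  have hc2 : (c : ℂ) / 2 ≠ 0 := div_ne_zero hc' two_ne_zero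
  have hsp : (s : ℂ) ^ (((ν + (k + (m + 1) : ℕ) : ℝ)) : ℂ) ≠ 0 := by
    simp [Complex.cpow_eq_zero_iff, hs']
  have eC : ((c : ℂ) / 2) ^ (((ν + (k + (m + 1) : ℕ) : ℝ) : ℂ) - 1) *
      (s : ℂ) ^ (-(((ν + (k + (m + 1) : ℕ) - 1 : ℝ) : ℂ) + 1)) =
      2 / (c : ℂ) * ((c : ℂ) / ((2 * s : ℝ) : ℂ)) ^ (k + (m + 1)) *
        ((c : ℂ) / (2 * s)) ^ (ν : ℂ) := by
    have h1 : ((c : ℂ) / 2) ^ ((ν + (k + (m + 1) : ℕ) : ℝ) : ℂ) =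
        (s : ℂ) ^ ((ν + (k + (m + 1) : ℕ) : ℝ) : ℂ) *
          (((c : ℂ) / (2 * s)) ^ (ν : ℂ) * ((c : ℂ) / (2 * s)) ^ (k + (m + 1))) := by
      rw [show (c : ℂ) / 2 = s * (c / (2 * s)) by field_simp, ofReal_mul_cpow hs]
      congr 1
      rw [← Complex.cpow_natCast, ← Complex.cpow_add _ _ (div_ne_zero hc'
        (mul_ne_zero two_ne_zero hs'))]
      congr 1
      simp
    have h2 := cpow_neg_sub_one_add_one s (ν + (k + (m + 1) : ℕ))
    have h3 := cpow_sub_one_mul_self hc2 ((ν + (k + (m + 1) : ℕ) : ℝ) : ℂ)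
    rw [h2, hP]
    have h4 : ((c : ℂ) / 2) ^ (((ν + (k + (m + 1) : ℕ) : ℝ) : ℂ) - 1) =
        2 / c * ((c : ℂ) / 2) ^ ((ν + (k + (m + 1) : ℕ) : ℝ) : ℂ) := by
      rw [← h3]; field_simp
    rw [h4, h1]
    field_simp
  have hd := divPow_mul_cpow (ν := ν) hα0 hc hs hβ k j
  have ex : (-(α ^ 2 / 2 * (β ^ 2 / 2)) / (s : ℂ)) ^ j =
      (-1) ^ j * (a * (β ^ 2 / 2) / (s : ℂ)) ^ j := by
    rw [hα, ← mul_pow]; congr 1; ring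
  have hone : ((-1 : ℂ) ^ j) * (-1) ^ j = 1 := by rw [← mul_pow]; simp
  rw [besselI, besselE_eq_cliffordF, ep, eF, ← eE]
  set F := cliffordF (ν + k + j) (a * (β ^ 2 / 2) * ((c : ℂ) ^ 2 / 4) / (s : ℂ) ^ 2)
  set E1 := Complex.exp (-(β ^ 2 / 2))
  set E2 := Complex.exp (((c : ℂ) ^ 2 / 4 + a * (β ^ 2 / 2)) / s)
  rw [ex] at hd
  symm
  calc _ = (((c : ℂ) / 2) ^ (((ν + (k + (m + 1) : ℕ) : ℝ) : ℂ) - 1) *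
      (s : ℂ) ^ (-(((ν + (k + (m + 1) : ℕ) - 1 : ℝ) : ℂ) + 1))) * (E1 * E2) *
        (m.choose j : ℂ) * ((-1) ^ j * (-1) ^ j) * (β ^ 2 / 2) ^ ((ν + k : ℝ) : ℂ) *
        (a * (β ^ 2 / 2) / (s : ℂ)) ^ j * F := by rw [hone]; ring
    _ = 2 / (c : ℂ) * ((c : ℂ) / ((2 * s : ℝ) : ℂ)) ^ (k + (m + 1)) * (E1 * E2) *
        (m.choose j : ℂ) * (-1) ^ j * F * (((c : ℂ) / (2 * s)) ^ (ν : ℂ) *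
        (β ^ 2 / 2) ^ ((ν + k : ℝ) : ℂ) *
        ((-1) ^ j * (a * (β ^ 2 / 2) / (s : ℂ)) ^ j)) := by rw [eC]; ring
    _ = _ := by rw [← hd]; ring

/-! ### Solving a contiguity recursion -/

/-- The sequence of functions `Z_0 = Y`, `Z_{k+1} = (T + k) Z_k` with the three-term operator
`(T f)(μ) = a f(μ+1) + μ f(μ) - b f(μ-1)`. -/
noncomputable def contigSeq (a b : ℂ) (Y : ℝ → ℂ) : ℕ → ℝ → ℂ
  | 0 => Y
  | k + 1 => fun μ => a * contigSeq a b Y k (μ + 1) + (μ + k) * contigSeq a b Y k μ -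
      b * contigSeq a b Y k (μ - 1)

theorem contigSeq_succ (a b : ℂ) (Y : ℝ → ℂ) (k : ℕ) (μ : ℝ) :
    contigSeq a b Y (k + 1) μ = a * contigSeq a b Y k (μ + 1) + (μ + k) * contigSeq a b Y k μ -
      b * contigSeq a b Y k (μ - 1) := rfl

/-- If `S Y = T Y` for the operator `(S f)(μ) = μ f(μ+1) + a f(μ+2) - b f(μ)`, then
`S Z_k = (T + k) Z_k = Z_{k+1}` for all `k`, because `S (T + k) = (T + k + 1) S`. -/
theorem contigSeq_succ_eq {a b : ℂ} {Y : ℝ → ℂ}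
    (hY : ∀ μ : ℝ, μ * Y (μ + 1) + a * Y (μ + 2) - b * Y μ =
      a * Y (μ + 1) + μ * Y μ - b * Y (μ - 1)) (k : ℕ) (μ : ℝ) :
    μ * contigSeq a b Y k (μ + 1) + a * contigSeq a b Y k (μ + 2) - b * contigSeq a b Y k μ =
      contigSeq a b Y (k + 1) μ := by
  induction k generalizing μ with
  | zero => simpa [contigSeq] using hY μ
  | succ k ih =>
    have i1 := ih (μ + 1)
    have i0 := ih μ
    have im := ih (μ - 1)
    have d2 : contigSeq a b Y (k + 1) (μ + 2) = a * contigSeq a b Y k (μ + 3) +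
        (μ + 2 + k) * contigSeq a b Y k (μ + 2) - b * contigSeq a b Y k (μ + 1) := by
      rw [contigSeq_succ, show μ + 2 + 1 = μ + 3 by ring, show μ + 2 - 1 = μ + 1 by ring]
      push_cast; ring
    have d1 : contigSeq a b Y (k + 1) (μ + 1) = a * contigSeq a b Y k (μ + 2) +
        (μ + 1 + k) * contigSeq a b Y k (μ + 1) - b * contigSeq a b Y k μ := by
      rw [contigSeq_succ, show μ + 1 + 1 = μ + 2 by ring, show μ + 1 - 1 = μ by ring]
      push_cast; ring
    have d0 := contigSeq_succ a b Y k μ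
    rw [show μ + 1 + 1 = μ + 2 by ring, show μ + 1 + 2 = μ + 3 by ring] at i1
    rw [show μ - 1 + 1 = μ by ring, show μ - 1 + 2 = μ + 1 by ring] at im
    rw [contigSeq_succ _ _ _ (k + 1)]
    push_cast at i1 im ⊢
    linear_combination (μ : ℂ) * d1 + a * d2 - b * d0 + a * i1 + (μ + (k + 1)) * i0 - b * im

/-- The coefficient of `a^(κ-l-i) b^i Y(x+κ-l-2i)` in the explicit form of `contigSeq`, for `κ = k`
and `x = μ`.  It equals `(-1)^i κ!/((κ-l-i)! l! i!) (x+κ-l-i)_l` when `l + i ≤ κ`; the Pochhammer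
symbol in place of the quotient of factorials makes it a polynomial in `κ` that vanishes when
`κ < l + i` is a natural number. -/
noncomputable def contigCoeff (κ x : ℂ) (l i : ℕ) : ℂ :=
  (-1) ^ i * poch (κ + 1 - l - i) (l + i) * poch (x + κ - l - i) l /
    ((l.factorial : ℂ) * (i.factorial : ℂ))

theorem poch_succ' (x : ℂ) (m : ℕ) : poch x (m + 1) = x * poch (x + 1) m := by
  simp [poch, ascPochhammer_succ_left]

theorem contigCoeff_eq_zero {k l i : ℕ} (h : k < l + i) (x : ℂ) : contigCoeff k x l i = 0 := by
  obtain ⟨m, hm⟩ : ∃ m, l + i = k + 1 + m := ⟨l + i - (k + 1), by omega⟩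
  have e : (k : ℂ) + 1 - l - i = -(m : ℂ) := by
    have : (l : ℂ) + i = k + 1 + m := by exact_mod_cast hm
    linear_combination -this
  rw [contigCoeff, e, poch_neg_natCast, Nat.choose_eq_zero_of_lt (by omega)]
  simp

/-- The recursion of the coefficients, which is that of `contigSeq`. -/
theorem contigCoeff_add_one (κ x : ℂ) (l i : ℕ) :
    contigCoeff (κ + 1) x l i = contigCoeff κ (x + 1) l i +
      (if l = 0 then 0 else (x + κ) * contigCoeff κ x (l - 1) i) -
      (if i = 0 then 0 else contigCoeff κ (x - 1) l (i - 1)) := by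
  rcases l with _ | l <;> rcases i with _ | i
  · simp [contigCoeff, poch_zero]
  · have hi : ((i : ℂ) + 1) ≠ 0 := i.cast_add_one_ne_zero
    have hi' : (i.factorial : ℂ) ≠ 0 := by exact_mod_cast i.factorial_ne_zero
    have e1 : poch (κ + 1 + 1 - (0 : ℕ) - (i + 1 : ℕ)) (0 + (i + 1)) =
        poch (κ + 1 - i) i * (κ + 1) := by
      rw [zero_add, poch_succ]; push_cast; ring_nf
    have e2 : poch (κ + 1 - (0 : ℕ) - (i + 1 : ℕ)) (0 + (i + 1)) =
        (κ - i) * poch (κ + 1 - i) i := by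
      rw [zero_add, poch_succ']; push_cast; ring_nf
    have e3 : poch (κ + 1 - (0 : ℕ) - (i : ℕ)) (0 + i) = poch (κ + 1 - i) i := by
      rw [zero_add]; push_cast; ring_nf
    simp only [contigCoeff, if_true, Nat.add_sub_cancel, i.succ_ne_zero, if_false, e1, e2, e3,
      poch_zero, Nat.factorial_succ, Nat.factorial_zero]
    push_cast
    field_simp
    ring
  · have hl : ((l : ℂ) + 1) ≠ 0 := l.cast_add_one_ne_zero
    have hl' : (l.factorial : ℂ) ≠ 0 := by exact_mod_cast l.factorial_ne_zero
    have e1 : poch (κ + 1 + 1 - (l + 1 : ℕ) - (0 : ℕ)) (l + 1 + 0) =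
        poch (κ + 1 - l) l * (κ + 1) := by
      rw [add_zero, poch_succ]; push_cast; ring_nf
    have e2 : poch (κ + 1 - (l + 1 : ℕ) - (0 : ℕ)) (l + 1 + 0) =
        (κ - l) * poch (κ + 1 - l) l := by
      rw [add_zero, poch_succ']; push_cast; ring_nf
    have e3 : poch (κ + 1 - (l : ℕ) - (0 : ℕ)) (l + 0) = poch (κ + 1 - l) l := by
      rw [add_zero]; push_cast; ring_nf
    have e4 : poch (x + (κ + 1) - (l + 1 : ℕ) - (0 : ℕ)) (l + 1) =
        poch (x + κ - l) l * (x + κ) := by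
      rw [poch_succ]; push_cast; ring_nf
    have e5 : poch (x + 1 + κ - (l + 1 : ℕ) - (0 : ℕ)) (l + 1) =
        poch (x + κ - l) l * (x + κ) := by
      rw [poch_succ]; push_cast; ring_nf
    have e6 : poch (x + κ - (l : ℕ) - (0 : ℕ)) l = poch (x + κ - l) l := by
      push_cast; ring_nf
    simp only [contigCoeff, if_true, Nat.add_sub_cancel, l.succ_ne_zero, if_false, e1, e2, e3, e4,
      e5, e6, Nat.factorial_succ, Nat.factorial_zero]
    push_cast
    field_simp
    ring
  · have hl : ((l : ℂ) + 1) ≠ 0 := l.cast_add_one_ne_zero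
    have hl' : (l.factorial : ℂ) ≠ 0 := by exact_mod_cast l.factorial_ne_zero
    have hi : ((i : ℂ) + 1) ≠ 0 := i.cast_add_one_ne_zero
    have hi' : (i.factorial : ℂ) ≠ 0 := by exact_mod_cast i.factorial_ne_zero
    have e1 : poch (κ + 1 + 1 - (l + 1 : ℕ) - (i + 1 : ℕ)) (l + 1 + (i + 1)) =
        poch (κ - l - i) (l + i + 1) * (κ + 1) := by
      rw [show l + 1 + (i + 1) = l + i + 1 + 1 by ring, poch_succ]; push_cast; ring_nf
    have e2 : poch (κ + 1 - (l + 1 : ℕ) - (i + 1 : ℕ)) (l + 1 + (i + 1)) =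
        (κ - l - i - 1) * poch (κ - l - i) (l + i + 1) := by
      rw [show l + 1 + (i + 1) = l + i + 1 + 1 by ring, poch_succ']; push_cast; ring_nf
    have e3 : poch (κ + 1 - (l : ℕ) - (i + 1 : ℕ)) (l + (i + 1)) =
        poch (κ - l - i) (l + i + 1) := by
      rw [← add_assoc]; push_cast; ring_nf
    have e3' : poch (κ + 1 - (l + 1 : ℕ) - (i : ℕ)) (l + 1 + i) =
        poch (κ - l - i) (l + i + 1) := by
      rw [show l + 1 + i = l + i + 1 by ring]; push_cast; ring_nf
    have e4 : poch (x + (κ + 1) - (l + 1 : ℕ) - (i + 1 : ℕ)) (l + 1) =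
        poch (x + κ - l - i - 1) l * (x + κ - i - 1) := by
      rw [poch_succ]; push_cast; ring_nf
    have e5 : poch (x + 1 + κ - (l + 1 : ℕ) - (i + 1 : ℕ)) (l + 1) =
        poch (x + κ - l - i - 1) l * (x + κ - i - 1) := by
      rw [poch_succ]; push_cast; ring_nf
    have e6 : poch (x + κ - (l : ℕ) - (i + 1 : ℕ)) l = poch (x + κ - l - i - 1) l := by
      push_cast; ring_nf
    have e7 : poch (x - 1 + κ - (l + 1 : ℕ) - (i : ℕ)) (l + 1) =
        (x + κ - l - i - 2) * poch (x + κ - l - i - 1) l := by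
      rw [poch_succ']; push_cast; ring_nf
    simp only [contigCoeff, Nat.add_sub_cancel, l.succ_ne_zero, i.succ_ne_zero, if_false, e1, e2,
      e3, e3', e4, e5, e6, e7, Nat.factorial_succ]
    push_cast
    field_simp
    ring

theorem sum_range_shift {M : Type*} [AddCommMonoid M] {G : ℕ → M} {N : ℕ}
    (h : ∀ l, N ≤ l + 1 → G l = 0) :
    ∑ l ∈ Finset.range N, (if l = 0 then 0 else G (l - 1)) = ∑ l ∈ Finset.range N, G l := by
  rcases N with _ | N
  · simp
  · rw [Finset.sum_range_succ', Finset.sum_range_succ, h N le_rfl]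
    simp

/-- Explicit form of `contigSeq`; the terms with `k < l + i` vanish. -/
theorem contigSeq_eq_sum {a : ℂ} (ha : a ≠ 0) (b : ℂ) (Y : ℝ → ℂ) {k N : ℕ} (hN : k < N) (μ : ℝ) :
    contigSeq a b Y k μ = ∑ l ∈ Finset.range N, ∑ i ∈ Finset.range N,
      contigCoeff k μ l i * (a ^ ((k : ℤ) - l - i) * b ^ i * Y (μ + k - l - 2 * i)) := by
  induction k generalizing μ with
  | zero =>
    rw [Finset.sum_eq_single 0, Finset.sum_eq_single 0]
    · simp [contigSeq, contigCoeff, poch_zero]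
    · intro i _ hi
      rw [contigCoeff_eq_zero (by omega), zero_mul]
    · intro h; exact absurd (Finset.mem_range.2 hN) h
    · intro l _ hl
      exact Finset.sum_eq_zero fun i _ => by rw [contigCoeff_eq_zero (by omega), zero_mul]
    · intro h; exact absurd (Finset.mem_range.2 hN) h
  | succ k ih =>
    have hk : k < N := by omega
    have h1 : a * contigSeq a b Y k (μ + 1) = ∑ l ∈ Finset.range N, ∑ i ∈ Finset.range N,
        contigCoeff k (μ + 1) l i *
          (a ^ (((k + 1 : ℕ) : ℤ) - l - i) * b ^ i * Y (μ + (k + 1 : ℕ) - l - 2 * i)) := by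
      rw [ih hk, Finset.mul_sum]
      refine Finset.sum_congr rfl fun l _ => ?_
      rw [Finset.mul_sum]
      refine Finset.sum_congr rfl fun i _ => ?_
      rw [show ((k + 1 : ℕ) : ℤ) - l - i = (k : ℤ) - l - i + 1 by push_cast; ring,
        zpow_add_one₀ ha, show μ + 1 + k - l - 2 * i = μ + (k + 1 : ℕ) - l - 2 * i by
          push_cast; ring]
      push_cast
      ring
    have h2 : (μ + k) * contigSeq a b Y k μ = ∑ l ∈ Finset.range N, ∑ i ∈ Finset.range N,
        (if l = 0 then 0 else (μ + k) * contigCoeff k μ (l - 1) i) *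
          (a ^ (((k + 1 : ℕ) : ℤ) - l - i) * b ^ i * Y (μ + (k + 1 : ℕ) - l - 2 * i)) := by
      rw [ih hk, Finset.mul_sum, ← sum_range_shift]
      · refine Finset.sum_congr rfl fun l _ => ?_
        rcases l with _ | l
        · simp
        · rw [if_neg l.succ_ne_zero, Nat.add_sub_cancel, Finset.mul_sum]
          refine Finset.sum_congr rfl fun i _ => ?_
          rw [if_neg l.succ_ne_zero,
            show ((k + 1 : ℕ) : ℤ) - (l + 1 : ℕ) - i = (k : ℤ) - l - i by push_cast; ring,
            show μ + (k + 1 : ℕ) - (l + 1 : ℕ) - 2 * i = μ + k - l - 2 * i by push_cast; ring]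
          ring
      · intro l hl
        rw [Finset.sum_eq_zero fun i _ => by rw [contigCoeff_eq_zero (by omega), zero_mul],
          mul_zero]
    have h3 : b * contigSeq a b Y k (μ - 1) = ∑ l ∈ Finset.range N, ∑ i ∈ Finset.range N,
        (if i = 0 then 0 else contigCoeff k (μ - 1) l (i - 1)) *
          (a ^ (((k + 1 : ℕ) : ℤ) - l - i) * b ^ i * Y (μ + (k + 1 : ℕ) - l - 2 * i)) := by
      rw [ih hk, Finset.mul_sum]
      refine Finset.sum_congr rfl fun l _ => ?_
      rw [Finset.mul_sum, ← sum_range_shift]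
      · refine Finset.sum_congr rfl fun i _ => ?_
        rcases i with _ | i
        · simp
        · rw [if_neg i.succ_ne_zero, if_neg i.succ_ne_zero, Nat.add_sub_cancel,
            show ((k + 1 : ℕ) : ℤ) - l - (i + 1 : ℕ) = (k : ℤ) - l - i by push_cast; ring,
            show μ + (k + 1 : ℕ) - l - 2 * (i + 1 : ℕ) = μ - 1 + k - l - 2 * i by
              push_cast; ring]
          push_cast
          ring
      · intro i hi
        rw [contigCoeff_eq_zero (by omega), zero_mul, mul_zero]
    rw [contigSeq_succ, h1, h2, h3, ← Finset.sum_add_distrib, ← Finset.sum_sub_distrib]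
    refine Finset.sum_congr rfl fun l _ => ?_
    rw [← Finset.sum_add_distrib, ← Finset.sum_sub_distrib]
    refine Finset.sum_congr rfl fun i _ => ?_
    rw [show ((k + 1 : ℕ) : ℂ) = (k : ℂ) + 1 from Nat.cast_succ k, contigCoeff_add_one]
    ring

/-- The sum over `l` and `i` arranged by `j = l + 2 i`. -/
theorem sum_sum_eq_sum_sum_div_two {M : Type*} [AddCommMonoid M] (k : ℕ) {G : ℕ → ℕ → M}
    (hG : ∀ l i, k < l + i → G l i = 0) :
    ∑ l ∈ Finset.range (2 * k + 1), ∑ i ∈ Finset.range (2 * k + 1), G l i =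
      ∑ j ∈ Finset.range (2 * k + 1), ∑ i ∈ Finset.range (j / 2 + 1), G (j - 2 * i) i := by
  rw [← Finset.sum_product', Finset.sum_sigma',
    ← Finset.sum_filter_of_ne (p := fun x : ℕ × ℕ => x.1 + 2 * x.2 < 2 * k + 1)]
  · refine Finset.sum_nbij' (fun x => ⟨x.1 + 2 * x.2, x.2⟩) (fun y => (y.1 - 2 * y.2, y.2))
      ?_ ?_ ?_ ?_ ?_
    · rintro ⟨l, i⟩ h
      simp only [Finset.mem_filter, Finset.mem_product, Finset.mem_range, Finset.mem_sigma] at h ⊢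
      omega
    · rintro ⟨j, i⟩ h
      simp only [Finset.mem_filter, Finset.mem_product, Finset.mem_range, Finset.mem_sigma] at h ⊢
      omega
    · rintro ⟨l, i⟩ _
      simp
    · rintro ⟨j, i⟩ h
      simp only [Finset.mem_range, Finset.mem_sigma] at h
      simp only [Sigma.mk.injEq, heq_eq_eq, and_true]
      omega
    · rintro ⟨l, i⟩ _
      simp
  · rintro ⟨l, i⟩ _ h
    by_contra hc
    exact h (hG l i (by simp only at hc; omega))

/-! ### Larger first order: modified Marcum functions -/

/-- `b^(μ+k) ∫_0^1 τ^(μ-1) (τ-1)^k e^{-bτ} F_{μ-1}(abτ) dτ`, which for `k = 0` is `e^a (1 - Q_μ)`.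
The power of `b` is chosen so that the contiguity relation `besselAvg_succ` does not depend on `k`.
-/
noncomputable def besselAvg (a b : ℂ) (k : ℕ) (μ : ℝ) : ℂ :=
  b ^ ((μ + k : ℝ) : ℂ) * ∫ τ in Ioc (0 : ℝ) 1, (τ : ℂ) ^ ((μ : ℂ) - 1) * ((τ - 1 : ℂ) ^ k *
    (Complex.exp (-(b * τ)) * cliffordF (μ - 1) (a * b * τ)))

/-- Raising `k` by one is the operator `S` of `contigSeq_succ_eq`: in the factor `τ - 1` the term
`τ` is absorbed by `F_{μ-1} = μ F_μ + w F_{μ+1}`. -/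
theorem besselAvg_succ {a b : ℂ} (hb : b ≠ 0) (k : ℕ) {μ : ℝ} (hμ : 0 < μ) :
    besselAvg a b (k + 1) μ = μ * besselAvg a b k (μ + 1) + a * besselAvg a b k (μ + 2) -
      b * besselAvg a b k μ := by
  have i1 : IntegrableOn (fun τ : ℝ => (τ : ℂ) ^ (((μ + 1 : ℝ) : ℂ) - 1) * ((τ - 1 : ℂ) ^ k *
      (Complex.exp (-(b * τ)) * cliffordF (μ + 1 - 1) (a * b * τ)))) (Ioc 0 1) :=
    integrableOn_cpow_mul_Ioc (by linarith) (by fun_prop)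
  have i2 : IntegrableOn (fun τ : ℝ => (τ : ℂ) ^ (((μ + 2 : ℝ) : ℂ) - 1) * ((τ - 1 : ℂ) ^ k *
      (Complex.exp (-(b * τ)) * cliffordF (μ + 2 - 1) (a * b * τ)))) (Ioc 0 1) :=
    integrableOn_cpow_mul_Ioc (by linarith) (by fun_prop)
  have i0 : IntegrableOn (fun τ : ℝ => (τ : ℂ) ^ ((μ : ℂ) - 1) * ((τ - 1 : ℂ) ^ k *
      (Complex.exp (-(b * τ)) * cliffordF (μ - 1) (a * b * τ)))) (Ioc 0 1) :=
    integrableOn_cpow_mul_Ioc hμ (by fun_prop)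
  have h : ∫ τ in Ioc (0 : ℝ) 1, (τ : ℂ) ^ ((μ : ℂ) - 1) * ((τ - 1 : ℂ) ^ (k + 1) *
      (Complex.exp (-(b * τ)) * cliffordF (μ - 1) (a * b * τ))) =
      (μ : ℂ) * (∫ τ in Ioc (0 : ℝ) 1, (τ : ℂ) ^ (((μ + 1 : ℝ) : ℂ) - 1) * ((τ - 1 : ℂ) ^ k *
        (Complex.exp (-(b * τ)) * cliffordF (μ + 1 - 1) (a * b * τ)))) +
      a * b * (∫ τ in Ioc (0 : ℝ) 1, (τ : ℂ) ^ (((μ + 2 : ℝ) : ℂ) - 1) * ((τ - 1 : ℂ) ^ k *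
        (Complex.exp (-(b * τ)) * cliffordF (μ + 2 - 1) (a * b * τ)))) -
      ∫ τ in Ioc (0 : ℝ) 1, (τ : ℂ) ^ ((μ : ℂ) - 1) * ((τ - 1 : ℂ) ^ k *
        (Complex.exp (-(b * τ)) * cliffordF (μ - 1) (a * b * τ))) := by
    have i3 : IntegrableOn (fun τ : ℝ => (τ : ℂ) ^ ((μ : ℂ) - 1) * ((τ - 1 : ℂ) ^ (k + 1) *
        (Complex.exp (-(b * τ)) * cliffordF (μ - 1) (a * b * τ)))) (Ioc 0 1) :=
      integrableOn_cpow_mul_Ioc hμ (by fun_prop)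
    rw [eq_sub_iff_add_eq, ← integral_const_mul, ← integral_const_mul,
      ← integral_add (i1.const_mul _) (i2.const_mul _), ← integral_add i3 i0]
    refine setIntegral_congr_fun measurableSet_Ioc fun τ hτ => ?_
    have hτ' : (τ : ℂ) ≠ 0 := by exact_mod_cast hτ.1.ne'
    have e1 : (τ : ℂ) ^ (((μ + 1 : ℝ) : ℂ) - 1) = (τ : ℂ) ^ ((μ : ℂ) - 1) * τ := by
      rw [cpow_sub_one_mul_self hτ']; push_cast; ring_nf
    have e2 : (τ : ℂ) ^ (((μ + 2 : ℝ) : ℂ) - 1) = (τ : ℂ) ^ ((μ : ℂ) - 1) * τ * τ := by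
      rw [cpow_sub_one_mul_self hτ', show ((μ + 2 : ℝ) : ℂ) - 1 = μ + 1 by push_cast; ring,
        Complex.cpow_add _ _ hτ', Complex.cpow_one]
    rw [e1, e2, add_sub_cancel_right, show μ + 2 - 1 = μ + 1 by ring, cliffordF_sub_one]
    ring
  have b1 : b ^ ((μ + (k + 1 : ℕ) : ℝ) : ℂ) = b ^ ((μ + k : ℝ) : ℂ) * b := by
    rw [show ((μ + (k + 1 : ℕ) : ℝ) : ℂ) = ((μ + k : ℝ) : ℂ) + 1 by push_cast; ring,
      Complex.cpow_add _ _ hb, Complex.cpow_one]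
  have b1' : b ^ ((μ + 1 + k : ℝ) : ℂ) = b ^ ((μ + k : ℝ) : ℂ) * b := by
    rw [← b1]; push_cast; ring_nf
  have b2 : b ^ ((μ + 2 + k : ℝ) : ℂ) = b ^ ((μ + k : ℝ) : ℂ) * b * b := by
    rw [show ((μ + 2 + k : ℝ) : ℂ) = ((μ + (k + 1 : ℕ) : ℝ) : ℂ) + 1 by push_cast; ring,
      Complex.cpow_add _ _ hb, Complex.cpow_one, b1]
  rw [besselAvg, besselAvg, besselAvg, besselAvg, h, b1, b1', b2]
  ring

/-- The four-term recursion of `exp(a) (1 - Q_μ)`, from the three-term recursion of the Bessel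
functions. -/
theorem one_sub_marcumQ_contiguous {α β a b : ℂ} (hα : α ^ 2 = 2 * a) (hβ : β ^ 2 = 2 * b)
    (hb : b ≠ 0) (μ : ℝ) :
    μ * (Complex.exp a * (1 - marcumQ (μ + 1) α β)) +
      a * (Complex.exp a * (1 - marcumQ (μ + 2) α β)) - b * (Complex.exp a * (1 - marcumQ μ α β)) =
    a * (Complex.exp a * (1 - marcumQ (μ + 1) α β)) + μ * (Complex.exp a * (1 - marcumQ μ α β))
      - b * (Complex.exp a * (1 - marcumQ (μ - 1) α β)) := by
  have h0 := marcumQ_add_one_sub μ hα hβ (Or.inl hb)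
  have h1 := marcumQ_add_one_sub (μ + 1) hα hβ (Or.inl hb)
  have hm := marcumQ_add_one_sub (μ - 1) hα hβ (Or.inl hb)
  rw [show μ + 1 + 1 = μ + 2 by ring] at h1
  rw [sub_add_cancel, Complex.ofReal_sub, Complex.ofReal_one] at hm
  have e1 : b ^ ((μ + 1 : ℝ) : ℂ) = b ^ (μ : ℂ) * b := by
    rw [Complex.ofReal_add, Complex.ofReal_one, Complex.cpow_add _ _ hb, Complex.cpow_one]
  have e0 := cpow_sub_one_mul_self hb (μ : ℂ)
  have hF := cliffordF_sub_one μ (a * b)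
  rw [e1] at h1
  linear_combination (-Complex.exp a) * (μ * h0 + a * h1 - b * hm) +
    Complex.exp a * Complex.exp (-a - b) * (b ^ (μ : ℂ) * hF + cliffordF (μ - 1) (a * b) * e0)

/-- The operator `S` involves only the orders `μ`, `μ + 1`, `μ + 2` and so stays among the
convergent integrals, whereas the sequence on the right also involves Marcum functions of negative
order. -/
theorem besselAvg_eq_contigSeq {α β a b : ℂ} (hα : α ^ 2 = 2 * a) (hβ : β ^ 2 = 2 * b)
    (hb : b ≠ 0) (k : ℕ) {μ : ℝ} (hμ : 0 < μ) :
    besselAvg a b k μ = contigSeq a b (fun ν => Complex.exp a * (1 - marcumQ ν α β)) k μ := by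
  induction k generalizing μ with
  | zero =>
    rw [contigSeq, marcumQ_of_pos hμ hα hβ, sub_sub_cancel, ← mul_assoc, ← Complex.exp_add,
      add_neg_cancel, Complex.exp_zero, one_mul, besselAvg, Nat.cast_zero, add_zero]
    simp only [pow_zero, one_mul, mul_assoc]
  | succ k ih =>
    rw [besselAvg_succ hb k hμ, ih hμ, ih (by linarith), ih (by linarith),
      contigSeq_succ_eq (one_sub_marcumQ_contiguous hα hβ hb)]

theorem besselAvg_eq_sum {α β a b : ℂ} (hα : α ^ 2 = 2 * a) (hβ : β ^ 2 = 2 * b) (ha : a ≠ 0)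
    (hb : b ≠ 0) (k : ℕ) {μ : ℝ} (hμ : 0 < μ) :
    besselAvg a b k μ = Complex.exp a * ∑ j ∈ Finset.range (2 * k + 1), a ^ ((k : ℤ) - j) *
      (∑ i ∈ Finset.range (j / 2 + 1), contigCoeff k μ (j - 2 * i) i * (a * b) ^ i) *
        (1 - marcumQ (μ + k - j) α β) := by
  rw [besselAvg_eq_contigSeq hα hβ hb k hμ, contigSeq_eq_sum ha b _ (by omega : k < 2 * k + 1),
    sum_sum_eq_sum_sum_div_two k (G := fun l i => contigCoeff k μ l i * (a ^ ((k : ℤ) - l - i) *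
      b ^ i * (Complex.exp a * (1 - marcumQ (μ + k - l - 2 * i) α β))))
      (fun l i h => by rw [contigCoeff_eq_zero h, zero_mul]), Finset.mul_sum]
  refine Finset.sum_congr rfl fun j _ => ?_
  rw [Finset.mul_sum, Finset.sum_mul, Finset.mul_sum]
  refine Finset.sum_congr rfl fun i hi => ?_
  have hij : 2 * i ≤ j := by rw [Finset.mem_range] at hi; omega
  obtain ⟨l, rfl⟩ : ∃ l, j = l + 2 * i := ⟨j - 2 * i, by omega⟩
  rw [Nat.add_sub_cancel, show (k : ℤ) - l - i = (k : ℤ) - (l + 2 * i : ℕ) + i by push_cast; ring,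
    zpow_add₀ ha, zpow_natCast, mul_pow,
    show μ + k - l - 2 * i = μ + k - (l + 2 * i : ℕ) by push_cast; ring]
  ring

theorem deltaCoeff_eq (a b : ℂ) (j k : ℕ) (μ : ℝ) :
    deltaCoeff j (k + 1) (μ + k + 1) b (a * b) =
      (-1) ^ k * (a * b) ^ ((k : ℤ) - j) / (b ^ k * (k.factorial : ℂ)) *
        ∑ i ∈ Finset.range (j / 2 + 1), contigCoeff k μ (j - 2 * i) i * (a * b) ^ i := by
  rw [deltaCoeff, Nat.add_sub_cancel, Nat.cast_succ, Nat.cast_succ, add_sub_cancel_right,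
    Complex.Gamma_nat_eq_factorial]
  congr 1
  refine Finset.sum_congr rfl fun i hi => ?_
  have hij : 2 * i ≤ j := by rw [Finset.mem_range] at hi; omega
  obtain ⟨l, rfl⟩ : ∃ l, j = l + 2 * i := ⟨j - 2 * i, by omega⟩
  rw [Nat.add_sub_cancel, show l + 2 * i - i = l + i by omega, contigCoeff,
    show (k : ℂ) + 1 - (l + 2 * i : ℕ) + i = k + 1 - l - i by push_cast; ring,
    show ((μ + k + 1 : ℝ) : ℂ) - (l + 2 * i : ℕ) - 1 + i = μ + k - l - i by push_cast; ring]

/-- The integrals over `[0,1]` of `laplaceIn_add_eq_sum_average` are `besselAvg` at the parameters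
`a' = -c²/(4s)` and `b' = -aB/s`, where `s = p + a` and `B = β²/2`. -/
theorem laplaceIn_add_eq_sum_marcumQ {α β : ℂ} {c p a μ : ℝ} (hα : α ^ 2 = 2 * (a : ℂ))
    (hp : 0 < p) (hs : 0 < p + a) (hμ : 0 < μ) (n : ℕ) (hα0 : α ≠ 0) (hβ0 : β ≠ 0) (hc : c ≠ 0) :
    laplaceIn α β c p (μ + n) μ = laplaceIn α β c p μ μ +
      2 / (c : ℂ) * negSqDivPow α β c (pTilde p α) μ * Complex.exp (-β ^ 2 / 2) *
        ∑ k ∈ Finset.range n, ∑ j ∈ Finset.range (2 * k + 1),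
          (β ^ 2 / 2) ^ j * (-α ^ 2 / (pTilde p α : ℂ)) ^ (-(k : ℤ) + (j : ℤ)) *
            deltaCoeff j (k + 1) (μ + k + 1) (-(α ^ 2 * β ^ 2) / (2 * (pTilde p α : ℂ)))
              (α ^ 2 * β ^ 2 * (c : ℂ) ^ 2 / (4 * (pTilde p α : ℂ) ^ 2)) *
            (1 - marcumQ (μ + k - j)
              (Complex.I * ((c : ℂ) / (Real.sqrt (pTilde p α) : ℂ)))
              (Complex.I * (α * β / (Real.sqrt (pTilde p α) : ℂ)))) := by
  rw [(laplaceIn_add_eq_sum_average hα hp hs hμ n).2, Finset.mul_sum, pTilde_eq hα]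
  congr 1
  refine Finset.sum_congr rfl fun k _ => ?_
  set s : ℝ := p + a
  set B : ℂ := β ^ 2 / 2 with hB
  have hβ : β ^ 2 = 2 * B := by rw [hB]; ring
  have hs' : (s : ℂ) ≠ 0 := by exact_mod_cast hs.ne'
  have hc' : (c : ℂ) ≠ 0 := by exact_mod_cast hc
  have hB0 : B ≠ 0 := div_ne_zero (pow_ne_zero 2 hβ0) two_ne_zero
  have ha0 : (a : ℂ) ≠ 0 := fun h => hα0 (by simpa [h] using hα)
  set a' : ℂ := -((c : ℂ) ^ 2 / 4 / s) with ha'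
  set b' : ℂ := -(a * B / s) with hb'
  have ha'0 : a' ≠ 0 :=
    neg_ne_zero.2 (div_ne_zero (div_ne_zero (pow_ne_zero 2 hc') (by norm_num)) hs')
  have hb'0 : b' ≠ 0 := neg_ne_zero.2 (div_ne_zero (mul_ne_zero ha0 hB0) hs')
  have hP : ((2 * s : ℝ) : ℂ) = 2 * s := by push_cast; ring
  have hsq : (Real.sqrt (2 * s) : ℂ) ^ 2 = 2 * s := by
    rw [← Complex.ofReal_pow, Real.sq_sqrt (by positivity), hP]
  have hα' : (Complex.I * ((c : ℂ) / (Real.sqrt (2 * s) : ℂ))) ^ 2 = 2 * a' := by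
    rw [mul_pow, Complex.I_sq, div_pow, hsq, ha']; field_simp; ring
  have hβ' : (Complex.I * (α * β / (Real.sqrt (2 * s) : ℂ))) ^ 2 = 2 * b' := by
    rw [mul_pow, Complex.I_sq, div_pow, mul_pow, hsq, hα, hβ, hb']; field_simp
  have hw : -(α ^ 2 * β ^ 2) / (2 * ((2 * s : ℝ) : ℂ)) = b' := by
    rw [hP, hα, hβ, hb']; field_simp
  have hz : α ^ 2 * β ^ 2 * (c : ℂ) ^ 2 / (4 * ((2 * s : ℝ) : ℂ) ^ 2) = a' * b' := by
    rw [hP, hα, hβ, ha', hb']; field_simp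
  have hρ : -α ^ 2 / ((2 * s : ℝ) : ℂ) = b' / B := by
    rw [hP, hα, hb']; field_simp
  have hcpow : ∀ z : ℂ, z ≠ 0 → z ^ ((μ + k : ℝ) : ℂ) = z ^ (μ : ℂ) * z ^ k := by
    intro z hz
    rw [Complex.ofReal_add, Complex.ofReal_natCast, Complex.cpow_add _ _ hz, Complex.cpow_natCast]
  have hbμ : b' ^ (μ : ℂ) ≠ 0 := by simp [Complex.cpow_eq_zero_iff, hb'0]
  have h2μ : (2 : ℂ) ^ (μ : ℂ) ≠ 0 := by simp [Complex.cpow_eq_zero_iff]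
  have hsμ : (s : ℂ) ^ (μ : ℂ) ≠ 0 := by simp [Complex.cpow_eq_zero_iff, hs']
  have h2 : ∀ z : ℂ, (2 * z) ^ (μ : ℂ) = 2 ^ (μ : ℂ) * z ^ (μ : ℂ) := by
    intro z
    simpa using ofReal_mul_cpow two_pos z (μ : ℂ)
  have hpre : 2 / (c : ℂ) * negSqDivPow α β c (2 * s) μ =
      ((c : ℂ) / 2) ^ ((μ : ℂ) - 1) * ((s : ℂ) ^ (μ : ℂ))⁻¹ * (B ^ (μ : ℂ) / b' ^ (μ : ℂ)) := by
    have h3 := cpow_sub_one_mul_self (div_ne_zero hc' two_ne_zero) (μ : ℂ)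
    have h4 : ((c : ℂ) / 2) ^ (μ : ℂ) = (s : ℂ) ^ (μ : ℂ) * ((c / (2 * s) : ℝ) : ℂ) ^ (μ : ℂ) := by
      rw [← ofReal_mul_cpow hs]; congr 1; push_cast; field_simp
    have h5 : -(α ^ 2 * β ^ 2) / ((2 * s : ℝ) : ℂ) = 2 * b' := by
      rw [hP, hα, hβ, hb']; field_simp
    have h6 : ((c : ℂ) / 2) ^ ((μ : ℂ) - 1) = 2 / c * ((c : ℂ) / 2) ^ (μ : ℂ) := by
      rw [← h3]; field_simp
    rw [negSqDivPow, h5, hβ, h2, h2, h6, h4]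
    field_simp
  have hJ : ∫ τ in Ioc (0 : ℝ) 1, (τ : ℂ) ^ ((μ : ℂ) - 1) * (1 - (τ : ℂ)) ^ k *
      (Complex.exp (a * B / s * τ) *
        cliffordF (μ - 1) (a * B * ((c : ℂ) ^ 2 / 4) / (s : ℂ) ^ 2 * τ)) =
      (-1) ^ k * (b' ^ ((μ + k : ℝ) : ℂ))⁻¹ * besselAvg a' b' k μ := by
    have hbμk : b' ^ ((μ + k : ℝ) : ℂ) ≠ 0 := by simp [Complex.cpow_eq_zero_iff, hb'0]
    rw [besselAvg, mul_assoc ((-1 : ℂ) ^ k), inv_mul_cancel_left₀ hbμk, ← integral_const_mul]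
    refine setIntegral_congr_fun measurableSet_Ioc fun τ _ => ?_
    have e1 : a * B * ((c : ℂ) ^ 2 / 4) / (s : ℂ) ^ 2 = a' * b' := by
      rw [ha', hb']; field_simp
    have e2 : (a : ℂ) * B / s * τ = -(b' * τ) := by rw [hb']; ring
    have e3 : (1 - (τ : ℂ)) ^ k = (-1) ^ k * (τ - 1 : ℂ) ^ k := by
      rw [← mul_pow]; congr 1; ring
    rw [e1, e2, e3]
    ring
  have hE : Complex.exp (-B + (c : ℂ) ^ 2 / 4 / s) * Complex.exp a' = Complex.exp (-β ^ 2 / 2) := by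
    rw [← Complex.exp_add, ha', hβ]; congr 1; ring
  rw [hJ, hw, hz, hρ, hpre, besselAvg_eq_sum hα' hβ' ha'0 hb'0 k hμ, hcpow B hB0, hcpow b' hb'0,
    ← hE, Finset.mul_sum, Finset.mul_sum, Finset.mul_sum, Finset.mul_sum, Finset.mul_sum]
  refine Finset.sum_congr rfl fun j _ => ?_
  rw [deltaCoeff_eq]
  have hzp : B ^ j * (b' / B) ^ (-(k : ℤ) + (j : ℤ)) * (a' * b') ^ ((k : ℤ) - j) =
      B ^ k * a' ^ ((k : ℤ) - j) := by
    have e : B ^ k = B ^ j * B ^ ((k : ℤ) - j) := by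
      rw [← zpow_natCast B j, ← zpow_add₀ hB0, ← zpow_natCast B k]; congr 1; ring
    rw [show -(k : ℤ) + (j : ℤ) = -((k : ℤ) - j) by ring, zpow_neg, div_zpow, mul_zpow, e]
    have h3 : b' ^ ((k : ℤ) - j) ≠ 0 := zpow_ne_zero _ hb'0
    have h4 : B ^ ((k : ℤ) - j) ≠ 0 := zpow_ne_zero _ hB0
    field_simp
  have hk : (k.factorial : ℂ) ≠ 0 := by exact_mod_cast k.factorial_ne_zero
  generalize (∑ i ∈ Finset.range (j / 2 + 1), contigCoeff k μ (j - 2 * i) i * (a' * b') ^ i) = S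
  generalize 1 - marcumQ (μ + k - j) _ _ = D
  generalize ((c : ℂ) / 2) ^ ((μ : ℂ) - 1) * ((s : ℂ) ^ (μ : ℂ))⁻¹ = K
  generalize Complex.exp (-B + (c : ℂ) ^ 2 / 4 / s) = E1
  generalize Complex.exp a' = E2
  have hb'k : b' ^ k ≠ 0 := pow_ne_zero _ hb'0
  calc _ = K * (B ^ (μ : ℂ) / b' ^ (μ : ℂ)) * (E1 * E2) * ((-1) ^ k / (b' ^ k * k.factorial)) *
      (B ^ k * a' ^ ((k : ℤ) - j)) * S * D := by field_simp
    _ = _ := by rw [← hzp]; field_simp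

end MarcumLaplace

theorem proposition1 (α β : ℂ) (c p : ℝ)
    (hα : α.im = 0 ∨ α.re = 0) (hβ : β.im = 0 ∨ β.re = 0)
    (hp : 0 < p) (hpt : 0 < MarcumLaplace.pTilde p α) :
    -- equal orders
    (∀ μ : ℝ, (0 < μ ∨ ∃ m : ℕ, μ = -(m : ℝ)) → (c ≠ 0 ∨ 1 ≤ μ) →
      MarcumLaplace.InConverges α β c p μ μ ∧
      MarcumLaplace.laplaceIn α β c p μ μ =
        1 / (p : ℂ) * ((c : ℂ) / (2 * p)) ^ ((μ : ℂ) - 1) * Complex.exp ((c : ℂ) ^ 2 / (4 * p)) *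
          MarcumLaplace.marcumQ μ
            (α * c / (Real.sqrt (2 * p * MarcumLaplace.pTilde p α) : ℂ))
            (β * (Real.sqrt (2 * p / MarcumLaplace.pTilde p α) : ℂ))) ∧
    -- first order larger, modified Marcum Q functions
    (∀ (μ₂ : ℝ) (n : ℕ), 0 < μ₂ → 1 ≤ n → α ≠ 0 → β ≠ 0 → c ≠ 0 →
      MarcumLaplace.InConverges α β c p (μ₂ + n) μ₂ ∧
      MarcumLaplace.laplaceIn α β c p (μ₂ + n) μ₂ =
        MarcumLaplace.laplaceIn α β c p μ₂ μ₂ +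
        2 / (c : ℂ) * MarcumLaplace.negSqDivPow α β c (MarcumLaplace.pTilde p α) μ₂ *
          Complex.exp (-β ^ 2 / 2) *
          ∑ k ∈ Finset.range n, ∑ j ∈ Finset.range (2 * k + 1),
            (β ^ 2 / 2) ^ j *
              (-α ^ 2 / (MarcumLaplace.pTilde p α : ℂ)) ^ (-(k : ℤ) + (j : ℤ)) *
              MarcumLaplace.deltaCoeff j (k + 1) (μ₂ + k + 1)
                (-(α ^ 2 * β ^ 2) / (2 * (MarcumLaplace.pTilde p α : ℂ)))
                (α ^ 2 * β ^ 2 * (c : ℂ) ^ 2 / (4 * (MarcumLaplace.pTilde p α : ℂ) ^ 2)) *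
              (1 - MarcumLaplace.marcumQ (μ₂ + k - j)
                (Complex.I * ((c : ℂ) / (Real.sqrt (MarcumLaplace.pTilde p α) : ℂ)))
                (Complex.I * (α * β / (Real.sqrt (MarcumLaplace.pTilde p α) : ℂ))))) ∧
    -- first order larger, finite-range integrals
    (∀ (μ₂ : ℝ) (n : ℕ), 0 < μ₂ → 1 ≤ n → (c ≠ 0 ∨ 1 ≤ μ₂) →
      MarcumLaplace.InConverges α β c p (μ₂ + n) μ₂ ∧
      (∀ j ∈ Finset.Icc 1 n, IntegrableOn (fun t : ℝ =>
        (t : ℂ) ^ ((μ₂ : ℂ) - 1) * (1 - (t : ℂ)) ^ (j - 1) *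
          Complex.exp (α ^ 2 * β ^ 2 / (2 * (MarcumLaplace.pTilde p α : ℂ)) * t) *
          MarcumLaplace.hyp0F1 μ₂
            (α ^ 2 * β ^ 2 * (c : ℂ) ^ 2 / (4 * (MarcumLaplace.pTilde p α : ℂ) ^ 2) * t))
        (Set.Ioc 0 1)) ∧
      MarcumLaplace.laplaceIn α β c p (μ₂ + n) μ₂ =
        MarcumLaplace.laplaceIn α β c p μ₂ μ₂ +
        2 / (MarcumLaplace.pTilde p α : ℂ) *
          ((β ^ 2) ^ ((μ₂ : ℂ) - 1) *
            ((c : ℂ) / (2 * (MarcumLaplace.pTilde p α : ℂ))) ^ ((μ₂ : ℂ) - 1)) *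
          (Complex.exp (-β ^ 2 / 2 + (c : ℂ) ^ 2 / (2 * (MarcumLaplace.pTilde p α : ℂ))) /
            Complex.Gamma μ₂) *
          ∑ j ∈ Finset.Icc 1 n, (β ^ 2 / 2) ^ j / ((j - 1).factorial : ℂ) *
            ∫ t in (0 : ℝ)..1,
              (t : ℂ) ^ ((μ₂ : ℂ) - 1) * (1 - (t : ℂ)) ^ (j - 1) *
                Complex.exp (α ^ 2 * β ^ 2 / (2 * (MarcumLaplace.pTilde p α : ℂ)) * t) *
                MarcumLaplace.hyp0F1 μ₂
                  (α ^ 2 * β ^ 2 * (c : ℂ) ^ 2 /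
                    (4 * (MarcumLaplace.pTilde p α : ℂ) ^ 2) * t)) ∧
    -- first order smaller
    (∀ (μ₁ : ℝ) (n : ℕ), 1 ≤ n → (0 < μ₁ + n ∨ ∃ m : ℕ, μ₁ + n = -(m : ℝ)) →
      α ≠ 0 → (β ≠ 0 ∨ 0 ≤ μ₁) → c ≠ 0 →
      MarcumLaplace.InConverges α β c p μ₁ (μ₁ + n) ∧
      MarcumLaplace.laplaceIn α β c p μ₁ (μ₁ + n) =
        MarcumLaplace.laplaceIn α β c p (μ₁ + n) (μ₁ + n) -
        2 / (c : ℂ) * ((c : ℂ) / (MarcumLaplace.pTilde p α : ℂ)) ^ n *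
          MarcumLaplace.divPow α β c (MarcumLaplace.pTilde p α) μ₁ *
          Complex.exp (((c : ℂ) ^ 2 / 2 - p * β ^ 2) / (MarcumLaplace.pTilde p α : ℂ)) *
          ∑ k ∈ Finset.range n, ∑ j ∈ Finset.range (n - k),
            (β / (c : ℂ)) ^ (j + k) * ((MarcumLaplace.pTilde p α : ℂ) / α) ^ k * (-α) ^ j *
              (MarcumLaplace.poch (-(n : ℂ) + k + 1) j / (j.factorial : ℂ)) *
              MarcumLaplace.besselI (μ₁ + k + j)
                ((c : ℂ) * (α * β / (MarcumLaplace.pTilde p α : ℂ)))) := by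
  obtain ⟨a, ha⟩ := MarcumLaplace.exists_sq_eq_two_mul_ofReal hα
  have hs : 0 < p + a := by
    rw [MarcumLaplace.pTilde_eq ha] at hpt
    linarith
  refine ⟨fun μ hμ _ => MarcumLaplace.laplaceIn_self ha hp hs hμ, fun μ n hμ _ hα0 hβ0 hc => ?_,
    fun μ n hμ _ _ => ?_, fun ν n _ hμ hα0 hβ0 hc => ?_⟩
  · exact ⟨(MarcumLaplace.laplaceIn_add_eq_sum_average ha hp hs hμ n).1,
      MarcumLaplace.laplaceIn_add_eq_sum_marcumQ ha hp hs hμ n hα0 hβ0 hc⟩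
  · exact ⟨(MarcumLaplace.laplaceIn_add_eq_sum_average ha hp hs hμ n).1,
      fun j _ => MarcumLaplace.integrableOn_cpow_mul_exp_mul_hyp0F1 hμ (j - 1) _ _,
      MarcumLaplace.laplaceIn_add_eq_sum_integral ha hp hs hμ n⟩
  · exact MarcumLaplace.laplaceIn_sub_eq_sum_besselI ha hp hs n hμ hα0 hβ0 hc
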